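/- Let $K$ be an algebraically closed field, of any characteristic, with a non-trivial valuation $v\colon K\to\Gamma_\infty=\Gamma\cup\{\infty\}$ onto, where $\Gamma$ is an ordered abelian group, and let $O$ be its valuation ring. Regard $(K,\Gamma_\infty,v)$ as a structure in the two-sorted language of valued fields (the ring language on $K$, the ordered group language with the point $\infty$ on $\Gamma_\infty$, and $v$), and assume that it is $\kappa$-saturated, where $\kappa$ is an infinite cardinal. Definable means definable with parameters, small means of cardinality less than $\kappa$, and a set is type-definable if it is a small intersection of definable sets. For $a\in K^\times$ let $o(a)$ be the set of $x\in K^\times$ such that $|n\,v(x)|<v(a)$ for every integer $n>0$. For $r\in\Gamma$ with $r>0$ let $U_r=\{x\in K\mid v(1-x)\ge r\}$, and for $r\in\Gamma$ with $r\ge 0$ let $U_r^-=\{x\in K\mid v(1-x)>r\}$. Let $X\subseteq K^\times$ be a type-definable subgroup. Then at least one of the following holds: 1. $X=K^\times$; 2. $X=O^\times$; 3. $X$ is the intersection of a small non-empty family of groups of the form $o(a)$, $a\in K^\times$; 4. $X$ is the intersection of a small non-empty family of definable groups, each of which contains, as a subgroup of finite index, a group $U_r$ with $r>0$ or a group $U_r^-$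 with $r\ge 0$; 5. $X$ is finite. -/

import Mathlib

universe u

namespace ACVF

/-! ### The two-sorted language of valued fields

There is a sort for the field `K` and a sort for `Γ∞ = WithTop Γ`; the language has the ring
language on `K`, the ordered group language with the point `∞` on `Γ∞`, and the function
`v : K → Γ∞`. Mathlib's first-order languages have a single sort, so the syntax is spelled out.
Variables of each sort are named by natural numbers. -/

/-- Terms of the field sort. -/
inductive FieldTerm : Type
  | var (n : ℕ) : FieldTerm
  | zero : FieldTerm
  | one : FieldTerm
  | neg (t : FieldTerm) : FieldTerm
  | add (s t : FieldTerm) : FieldTerm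
  | mul (s t : FieldTerm) : FieldTerm

/-- Terms of the value sort. -/
inductive ValueTerm : Type
  | var (n : ℕ) : ValueTerm
  | zero : ValueTerm
  | infty : ValueTerm
  | neg (t : ValueTerm) : ValueTerm
  | add (s t : ValueTerm) : ValueTerm
  | val (t : FieldTerm) : ValueTerm

/-- First-order formulas; `exField n φ` and `exValue n φ` quantify over the `n`-th variable of
the field sort and of the value sort. -/
inductive Formula : Type
  | eqField (s t : FieldTerm) : Formula
  | eqValue (s t : ValueTerm) : Formula
  | leValue (s t : ValueTerm) : Formula
  | not (φ : Formula) : Formula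
  | and (φ ψ : Formula) : Formula
  | exField (n : ℕ) (φ : Formula) : Formula
  | exValue (n : ℕ) (φ : Formula) : Formula

section Semantics

variable {K Γ : Type*} [Field K] [AddCommGroup Γ] [LinearOrder Γ] [IsOrderedAddMonoid Γ]

/-- The value of a term of the field sort under an assignment `e` of the field variables. -/
def FieldTerm.eval (e : ℕ → K) : FieldTerm → K
  | .var n => e n
  | .zero => 0
  | .one => 1
  | .neg t => - t.eval e
  | .add s t => s.eval e + t.eval e
  | .mul s t => s.eval e * t.eval e

/-- The value of a term of the value sort; as usual `-∞` is interpreted as `∞`. -/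
def ValueTerm.eval (v : AddValuation K (WithTop Γ)) (e : ℕ → K) (g : ℕ → WithTop Γ) :
    ValueTerm → WithTop Γ
  | .var n => g n
  | .zero => 0
  | .infty => ⊤
  | .neg t => WithTop.map (fun γ : Γ => -γ) (t.eval v e g)
  | .add s t => s.eval v e g + t.eval v e g
  | .val t => v (t.eval e)

/-- Truth of a formula in the valued field `(K, v)` under the assignments `e` and `g`. -/
def Formula.Realize (v : AddValuation K (WithTop Γ)) :
    Formula → (ℕ → K) → (ℕ → WithTop Γ) → Prop
  | .eqField s t, e, _ => s.eval e = t.eval e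
  | .eqValue s t, e, g => s.eval v e g = t.eval v e g
  | .leValue s t, e, g => s.eval v e g ≤ t.eval v e g
  | .not φ, e, g => ¬ φ.Realize v e g
  | .and φ ψ, e, g => φ.Realize v e g ∧ ψ.Realize v e g
  | .exField n φ, e, g => ∃ x : K, φ.Realize v (Function.update e n x) g
  | .exValue n φ, e, g => ∃ γ : WithTop Γ, φ.Realize v e (Function.update g n γ)

/-- `D ⊆ K` is definable with parameters from `A ⊆ K` and `B ⊆ Γ∞`: the variable `0` of the
field sort runs over `D`, the other variables are assigned parameters. Since `0` and `∞` are
constants of the language, they may always be used as parameters. -/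
def DefinableOver (v : AddValuation K (WithTop Γ)) (A : Set K) (B : Set (WithTop Γ))
    (D : Set K) : Prop :=
  ∃ (φ : Formula) (e : ℕ → K) (g : ℕ → WithTop Γ),
    (∀ n, e n ∈ insert 0 A) ∧ (∀ n, g n ∈ insert ⊤ B) ∧
      D = {x | φ.Realize v (Function.update e 0 x) g}

/-- `D ⊆ Γ∞` is definable with parameters from `A ⊆ K` and `B ⊆ Γ∞`. -/
def ValueDefinableOver (v : AddValuation K (WithTop Γ)) (A : Set K) (B : Set (WithTop Γ))
    (D : Set (WithTop Γ)) : Prop :=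
  ∃ (φ : Formula) (e : ℕ → K) (g : ℕ → WithTop Γ),
    (∀ n, e n ∈ insert 0 A) ∧ (∀ n, g n ∈ insert ⊤ B) ∧
      D = {γ | φ.Realize v e (Function.update g 0 γ)}

/-- Definable subsets of `K` (with arbitrary parameters). -/
def Definable (v : AddValuation K (WithTop Γ)) (D : Set K) : Prop :=
  DefinableOver v Set.univ Set.univ D

end Semantics

section Model

variable {K Γ : Type u} [Field K] [AddCommGroup Γ] [LinearOrder Γ] [IsOrderedAddMonoid Γ]

/-- The two-sorted structure `(K, Γ∞, v)` is `κ`-saturated: over fewer than `κ` parameters, every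
finitely satisfiable set of formulas in one variable (of either sort) is realized. -/
def IsSaturated (κ : Cardinal.{u}) (v : AddValuation K (WithTop Γ)) : Prop :=
  ∀ (A : Set K) (B : Set (WithTop Γ)), Cardinal.mk A < κ → Cardinal.mk B < κ →
    (∀ 𝒟 : Set (Set K), (∀ D ∈ 𝒟, DefinableOver v A B D) →
      (∀ 𝓕 ⊆ 𝒟, 𝓕.Finite → (⋂₀ 𝓕).Nonempty) → (⋂₀ 𝒟).Nonempty) ∧
    (∀ 𝒟 : Set (Set (WithTop Γ)), (∀ D ∈ 𝒟, ValueDefinableOver v A B D) →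
      (∀ 𝓕 ⊆ 𝒟, 𝓕.Finite → (⋂₀ 𝓕).Nonempty) → (⋂₀ 𝒟).Nonempty)

/-- A type-definable subset of `K`: an intersection of fewer than `κ` definable sets. -/
def TypeDefinable (κ : Cardinal.{u}) (v : AddValuation K (WithTop Γ)) (X : Set K) : Prop :=
  ∃ 𝒟 : Set (Set K), Cardinal.mk 𝒟 < κ ∧ (∀ D ∈ 𝒟, Definable v D) ∧ X = ⋂₀ 𝒟

/-- `X` is the intersection of a small (and non-empty) family of subgroups with property `P`. -/
def IsSmallInter (κ : Cardinal.{u}) (P : Subgroup Kˣ → Prop) (X : Subgroup Kˣ) : Prop :=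
  ∃ 𝓗 : Set (Subgroup Kˣ), 𝓗.Nonempty ∧ Cardinal.mk 𝓗 < κ ∧ (∀ H ∈ 𝓗, P H) ∧ X = sInf 𝓗

/-- The units of the valuation ring, as a subset of `Kˣ`. -/
def valuationUnits (v : AddValuation K (WithTop Γ)) : Set Kˣ := {x | v (x : K) = 0}

/-- `o(α) = {γ ∈ Γ : |n γ| < α for all n > 0}`. -/
def littleO (α : Γ) : Set Γ := {γ | ∀ n : ℕ, 0 < n → |n • γ| < α}

/-- `o(a) = v⁻¹(o(v(a)))` for `a ∈ Kˣ`. -/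
def littleOUnits (v : AddValuation K (WithTop Γ)) (a : Kˣ) : Set Kˣ :=
  {x | ∃ α γ : Γ, v (a : K) = α ∧ v (x : K) = γ ∧ γ ∈ littleO α}

/-- `U_r = {x : v(1 - x) ≥ r}`; used for `r > 0`. -/
def closedU (v : AddValuation K (WithTop Γ)) (r : Γ) : Set Kˣ :=
  {x | (r : WithTop Γ) ≤ v (1 - (x : K))}

/-- `U_r⁻ = {x : v(1 - x) > r}`; used for `r ≥ 0`. -/
def openU (v : AddValuation K (WithTop Γ)) (r : Γ) : Set Kˣ :=
  {x | (r : WithTop Γ) < v (1 - (x : K))}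

/-- `H` is one of the groups `o(a)`. -/
def IsLittleO (v : AddValuation K (WithTop Γ)) (H : Subgroup Kˣ) : Prop :=
  ∃ a : Kˣ, (H : Set Kˣ) = littleOUnits v a

/-- `H` is definable and has a subgroup of finite index which is `U_r` for an `r > 0` or `U_r⁻`
for an `r ≥ 0`. -/
def IsDefinableFiniteExtU (v : AddValuation K (WithTop Γ)) (H : Subgroup Kˣ) : Prop :=
  Definable v (Units.val '' (H : Set Kˣ)) ∧
    ∃ U : Subgroup Kˣ,
      ((∃ r : Γ, 0 < r ∧ (U : Set Kˣ) = closedU v r) ∨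
        (∃ r : Γ, 0 ≤ r ∧ (U : Set Kˣ) = openU v r)) ∧
      U ≤ H ∧ U.relIndex H ≠ 0

end Model

end ACVF

set_option linter.unusedSectionVars false

/-! The definable subsets of `K` are shown to be finite Boolean combinations of balls, and the group
law is then played against that shape.

Quantifier elimination is a back-and-forth between assignments with the same quantifier-free type
(`Sim.extend_value`, `Sim.extend_field`, `Sim.realize_iff`). The essential case adjoins a field
element `b` that is not a root of the finitely many polynomials involved. By factoring these, every
term has a value `n ρ + δ`, where `ρ` is the distance from `b` to a nearest root. Comparing terms
therefore amounts to locating `ρ` among finitely many known values. Roots can be carried along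
consistently because two extensions of a valuation to a finite normal extension are conjugate
(`exists_conjugate`). Compactness turns this into the description of definable sets by balls
(`Definable.tame`).

By compactness again, `X` is the intersection of a system of such sets in which every `D` contains
all quotients of some other member `D'` (`exists_isGroupSystem`). So `w ∈ D` as soon as `x` and `x *
w` lie in `D'` for a single `x ≠ 0`. Moreover membership in `D'` changes only at finitely many
critical distances, so one element of `X` in a region free of them puts the whole region into `D'`.

Suppose that some `x ∈ X` has positive value. Its powers run into a gap between critical values,
whence `X` is the full preimage of a convex subgroup of `Γ` (`IsGroupSystem.mem_of_ord_le`). Unless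
`X` is everything, a group `o(a)` then fits between `X` and each `D` (`exists_littleO_between`).

Otherwise `X` consists of units of the valuation ring. If it meets infinitely many residue classes,
it contains a generic one, and every unit is a quotient of generic units
(`IsGroupSystem.mem_of_mem_closedUnits` at radius `0`). If it meets finitely many and is infinite,
one asks which of the groups `U_r`, `U_r⁻` have a trace of finite index in `X`. Near the place where
the index becomes infinite there are enough elements of `X` to force such a group `U` into `D`
(`IsGroupSystem.exists_isUnitBall`), and `X U` is a definable group between `X` and `D`. -/

namespace ACVF

/-! ### Syntax: renaming variables and finite support -/

section Renaming

variable {K Γ : Type*} [Field K] [AddCommGroup Γ] [LinearOrder Γ] [IsOrderedAddMonoid Γ]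

/-- Renaming the variables of a term of the field sort. -/
def FieldTerm.rename (h : ℕ → ℕ) : FieldTerm → FieldTerm
  | .var n => .var (h n)
  | .zero => .zero
  | .one => .one
  | .neg t => .neg (t.rename h)
  | .add s t => .add (s.rename h) (t.rename h)
  | .mul s t => .mul (s.rename h) (t.rename h)

/-- Renaming the variables of a term of the value sort. -/
def ValueTerm.rename (h k : ℕ → ℕ) : ValueTerm → ValueTerm
  | .var n => .var (k n)
  | .zero => .zero
  | .infty => .infty
  | .neg t => .neg (t.rename h k)
  | .add s t => .add (s.rename h k) (t.rename h k)
  | .val t => .val (t.rename h)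

/-- Renaming the variables of a formula, bound variables included. -/
def Formula.rename (h k : ℕ → ℕ) : Formula → Formula
  | .eqField s t => .eqField (s.rename h) (t.rename h)
  | .eqValue s t => .eqValue (s.rename h k) (t.rename h k)
  | .leValue s t => .leValue (s.rename h k) (t.rename h k)
  | .not φ => .not (φ.rename h k)
  | .and φ ψ => .and (φ.rename h k) (ψ.rename h k)
  | .exField n φ => .exField (h n) (φ.rename h k)
  | .exValue n φ => .exValue (k n) (φ.rename h k)

theorem FieldTerm.eval_rename (h : ℕ → ℕ) (e : ℕ → K) (t : FieldTerm) :
    (t.rename h).eval e = t.eval (e ∘ h) := by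
  induction t <;> simp_all [FieldTerm.rename, FieldTerm.eval]

theorem ValueTerm.eval_rename (v : AddValuation K (WithTop Γ)) (h k : ℕ → ℕ) (e : ℕ → K)
    (g : ℕ → WithTop Γ) (t : ValueTerm) :
    (t.rename h k).eval v e g = t.eval v (e ∘ h) (g ∘ k) := by
  induction t <;> simp_all [ValueTerm.rename, ValueTerm.eval, FieldTerm.eval_rename]

/-- Bound variables are renamed too, so injectivity is what prevents capture. -/
theorem Formula.realize_rename (v : AddValuation K (WithTop Γ)) {h k : ℕ → ℕ}
    (hh : Function.Injective h) (hk : Function.Injective k) (φ : Formula) (e : ℕ → K)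
    (g : ℕ → WithTop Γ) :
    (φ.rename h k).Realize v e g ↔ φ.Realize v (e ∘ h) (g ∘ k) := by
  induction φ generalizing e g with
  | eqField s t => simp [Formula.rename, Formula.Realize, FieldTerm.eval_rename]
  | eqValue s t => simp [Formula.rename, Formula.Realize, ValueTerm.eval_rename]
  | leValue s t => simp [Formula.rename, Formula.Realize, ValueTerm.eval_rename]
  | not φ ih => simp [Formula.rename, Formula.Realize, ih]
  | and φ ψ ih ih' => simp [Formula.rename, Formula.Realize, ih, ih']
  | exField n φ ih =>
    simp [Formula.rename, Formula.Realize, ih, Function.update_comp_eq_of_injective _ hh]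
  | exValue n φ ih =>
    simp [Formula.rename, Formula.Realize, ih, Function.update_comp_eq_of_injective _ hk]

theorem FieldTerm.exists_support (K : Type*) [Field K] (t : FieldTerm) :
    ∃ N : ℕ, ∀ e e' : ℕ → K, (∀ n < N, e n = e' n) → t.eval e = t.eval e' := by
  induction t with
  | var n => exact ⟨n + 1, fun e e' h => h n (Nat.lt_succ_self n)⟩
  | zero => exact ⟨0, fun _ _ _ => rfl⟩
  | one => exact ⟨0, fun _ _ _ => rfl⟩
  | neg t ih =>
    obtain ⟨N, hN⟩ := ih
    exact ⟨N, fun e e' h => by simp [FieldTerm.eval, hN e e' h]⟩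
  | add s t ih ih' =>
    obtain ⟨N, hN⟩ := ih
    obtain ⟨N', hN'⟩ := ih'
    exact ⟨max N N', fun e e' h => by
      simp [FieldTerm.eval, hN e e' (fun n hn => h n (lt_max_of_lt_left hn)),
        hN' e e' (fun n hn => h n (lt_max_of_lt_right hn))]⟩
  | mul s t ih ih' =>
    obtain ⟨N, hN⟩ := ih
    obtain ⟨N', hN'⟩ := ih'
    exact ⟨max N N', fun e e' h => by
      simp [FieldTerm.eval, hN e e' (fun n hn => h n (lt_max_of_lt_left hn)),
        hN' e e' (fun n hn => h n (lt_max_of_lt_right hn))]⟩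

theorem ValueTerm.exists_support (v : AddValuation K (WithTop Γ)) (t : ValueTerm) :
    ∃ N : ℕ, ∀ (e e' : ℕ → K) (g g' : ℕ → WithTop Γ), (∀ n < N, e n = e' n) →
      (∀ n < N, g n = g' n) → t.eval v e g = t.eval v e' g' := by
  induction t with
  | var n => exact ⟨n + 1, fun e e' g g' _ h => h n (Nat.lt_succ_self n)⟩
  | zero => exact ⟨0, fun _ _ _ _ _ _ => rfl⟩
  | infty => exact ⟨0, fun _ _ _ _ _ _ => rfl⟩
  | neg t ih =>
    obtain ⟨N, hN⟩ := ih
    exact ⟨N, fun e e' g g' h h' => by simp [ValueTerm.eval, hN e e' g g' h h']⟩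
  | add s t ih ih' =>
    obtain ⟨N, hN⟩ := ih
    obtain ⟨N', hN'⟩ := ih'
    exact ⟨max N N', fun e e' g g' h h' => by
      simp [ValueTerm.eval, hN e e' g g' (fun n hn => h n (lt_max_of_lt_left hn))
          (fun n hn => h' n (lt_max_of_lt_left hn)),
        hN' e e' g g' (fun n hn => h n (lt_max_of_lt_right hn))
          (fun n hn => h' n (lt_max_of_lt_right hn))]⟩
  | val t =>
    obtain ⟨N, hN⟩ := t.exists_support K
    exact ⟨N, fun e e' g g' h _ => by simp [ValueTerm.eval, hN e e' h]⟩

theorem Formula.exists_support (v : AddValuation K (WithTop Γ)) (φ : Formula) :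
    ∃ N : ℕ, ∀ (e e' : ℕ → K) (g g' : ℕ → WithTop Γ), (∀ n < N, e n = e' n) →
      (∀ n < N, g n = g' n) → (φ.Realize v e g ↔ φ.Realize v e' g') := by
  induction φ with
  | eqField s t =>
    obtain ⟨N, hN⟩ := s.exists_support K
    obtain ⟨N', hN'⟩ := t.exists_support K
    exact ⟨max N N', fun e e' g g' h _ => by
      simp [Formula.Realize, hN e e' (fun n hn => h n (lt_max_of_lt_left hn)),
        hN' e e' (fun n hn => h n (lt_max_of_lt_right hn))]⟩
  | eqValue s t =>
    obtain ⟨N, hN⟩ := s.exists_support v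
    obtain ⟨N', hN'⟩ := t.exists_support v
    exact ⟨max N N', fun e e' g g' h h' => by
      simp [Formula.Realize, hN e e' g g' (fun n hn => h n (lt_max_of_lt_left hn))
          (fun n hn => h' n (lt_max_of_lt_left hn)),
        hN' e e' g g' (fun n hn => h n (lt_max_of_lt_right hn))
          (fun n hn => h' n (lt_max_of_lt_right hn))]⟩
  | leValue s t =>
    obtain ⟨N, hN⟩ := s.exists_support v
    obtain ⟨N', hN'⟩ := t.exists_support v
    exact ⟨max N N', fun e e' g g' h h' => by
      simp [Formula.Realize, hN e e' g g' (fun n hn => h n (lt_max_of_lt_left hn))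
          (fun n hn => h' n (lt_max_of_lt_left hn)),
        hN' e e' g g' (fun n hn => h n (lt_max_of_lt_right hn))
          (fun n hn => h' n (lt_max_of_lt_right hn))]⟩
  | not φ ih =>
    obtain ⟨N, hN⟩ := ih
    exact ⟨N, fun e e' g g' h h' => by simp [Formula.Realize, hN e e' g g' h h']⟩
  | and φ ψ ih ih' =>
    obtain ⟨N, hN⟩ := ih
    obtain ⟨N', hN'⟩ := ih'
    exact ⟨max N N', fun e e' g g' h h' => by
      simp [Formula.Realize, hN e e' g g' (fun n hn => h n (lt_max_of_lt_left hn))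
          (fun n hn => h' n (lt_max_of_lt_left hn)),
        hN' e e' g g' (fun n hn => h n (lt_max_of_lt_right hn))
          (fun n hn => h' n (lt_max_of_lt_right hn))]⟩
  | exField m φ ih =>
    obtain ⟨N, hN⟩ := ih
    refine ⟨N, fun e e' g g' h h' => exists_congr fun x => hN _ _ _ _ (fun n hn => ?_) h'⟩
    by_cases hnm : n = m
    · subst hnm; simp
    · simp [hnm, h n hn]
  | exValue m φ ih =>
    obtain ⟨N, hN⟩ := ih
    refine ⟨N, fun e e' g g' h h' => exists_congr fun x => hN _ _ _ _ h (fun n hn => ?_)⟩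
    by_cases hnm : n = m
    · subst hnm; simp
    · simp [hnm, h' n hn]

/-- A definable set is definable with finitely many parameters, whose assignments have finite
range. -/
theorem Definable.exists_finite_range {v : AddValuation K (WithTop Γ)} {D : Set K}
    (hD : Definable v D) :
    ∃ (φ : Formula) (e : ℕ → K) (g : ℕ → WithTop Γ), (Set.range e).Finite ∧
      (Set.range g).Finite ∧ D = {x | φ.Realize v (Function.update e 0 x) g} := by
  obtain ⟨φ, e, g, -, -, rfl⟩ := hD
  obtain ⟨N, hN⟩ := φ.exists_support v
  have fin : ∀ {α : Type _} (f : ℕ → α) (a : α),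
      (Set.range fun n => if n < N then f n else a).Finite := fun f a =>
    (((Set.finite_lt_nat N).image f).union (Set.finite_singleton a)).subset <| by
      rintro _ ⟨n, rfl⟩
      by_cases h : n < N
      · simp only [h, if_true]
        exact Or.inl ⟨n, h, rfl⟩
      · simp [h]
  refine ⟨φ, fun n => if n < N then e n else 0, fun n => if n < N then g n else ⊤,
    fin _ _, ?_, ?_⟩
  · refine (((Set.finite_lt_nat N).image g).union (Set.finite_singleton ⊤)).subset ?_
    rintro _ ⟨n, rfl⟩
    by_cases h : n < N
    · simp only [h, if_true]
      exact Or.inl ⟨n, h, rfl⟩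
    · simp [h]
  · ext x
    refine hN _ _ _ _ (fun n hn => ?_) (fun n hn => by simp [hn])
    by_cases h0 : n = 0
    · subst h0; simp
    · simp [h0, hn]

end Renaming

/-! ### Definable relations in two variables -/

section Relations

variable {K Γ : Type*} [Field K] [AddCommGroup Γ] [LinearOrder Γ] [IsOrderedAddMonoid Γ]
  {v : AddValuation K (WithTop Γ)} {A : Set K} {B : Set (WithTop Γ)}

/-- `R ⊆ K × K` is definable with parameters from `A ⊆ K` and `B ⊆ Γ∞`. -/
def RelDefinableOver (v : AddValuation K (WithTop Γ)) (A : Set K) (B : Set (WithTop Γ))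
    (R : K → K → Prop) : Prop :=
  ∃ (φ : Formula) (e : ℕ → K) (g : ℕ → WithTop Γ),
    (∀ n, e n ∈ insert 0 A) ∧ (∀ n, g n ∈ insert ⊤ B) ∧
      ∀ x y, R x y ↔ φ.Realize v (Function.update (Function.update e 0 x) 1 y) g

theorem DefinableOver.mono {A' : Set K} {B' : Set (WithTop Γ)} {D : Set K}
    (h : DefinableOver v A B D) (hA : A ⊆ A') (hB : B ⊆ B') : DefinableOver v A' B' D := by
  obtain ⟨φ, e, g, he, hg, rfl⟩ := h
  exact ⟨φ, e, g, fun n => Set.insert_subset_insert hA (he n),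
    fun n => Set.insert_subset_insert hB (hg n), rfl⟩

theorem RelDefinableOver.not {R : K → K → Prop} (h : RelDefinableOver v A B R) :
    RelDefinableOver v A B (fun x y => ¬ R x y) := by
  obtain ⟨φ, e, g, he, hg, h⟩ := h
  exact ⟨.not φ, e, g, he, hg, fun x y => by simp [Formula.Realize, h]⟩

theorem RelDefinableOver.and {R S : K → K → Prop} (hR : RelDefinableOver v A B R)
    (hS : RelDefinableOver v A B S) : RelDefinableOver v A B (fun x y => R x y ∧ S x y) := by
  obtain ⟨φ, e, g, he, hg, h⟩ := hR
  obtain ⟨φ', e', g', he', hg', h'⟩ := hS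
  -- The two formulas come with unrelated parameter assignments, which are interleaved: one on even
  -- indices, the other on odd ones. The field variables `0` and `1` are shared and stay fixed; no
  -- value variable is shared.
  set i : ℕ → ℕ := fun n => if n < 2 then n else 2 * n with hi
  set j : ℕ → ℕ := fun n => if n < 2 then n else 2 * n + 1 with hj
  have ii : Function.Injective i := fun a b hab => by grind
  have ij : Function.Injective j := fun a b hab => by grind
  have ii' : Function.Injective (fun n : ℕ => 2 * n) := fun a b hab => by grind
  have ij' : Function.Injective (fun n : ℕ => 2 * n + 1) := fun a b hab => by grind
  refine ⟨.and (φ.rename i fun n => 2 * n) (φ'.rename j fun n => 2 * n + 1),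
    fun n => if n % 2 = 0 then e (n / 2) else e' (n / 2),
    fun n => if n % 2 = 0 then g (n / 2) else g' (n / 2), fun n => ?_, fun n => ?_,
    fun x y => ?_⟩
  · dsimp only
    split_ifs
    exacts [he _, he' _]
  · dsimp only
    split_ifs
    exacts [hg _, hg' _]
  · dsimp only
    rw [h, h']
    simp only [Formula.Realize, Formula.realize_rename v ii ii',
      Formula.realize_rename v ij ij']
    refine and_congr (iff_of_eq ?_) (iff_of_eq ?_)
    · congr 1
      · ext n
        rcases n with _ | _ | n
        · simp [hi]
        · simp [hi]
        · have h1 : 2 * (n + 1 + 1) ≠ 1 := by omega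
          simp [hi, h1]
      · ext n
        simp
    · congr 1
      · ext n
        rcases n with _ | _ | n
        · simp [hj]
        · simp [hj]
        · have h3 : (2 * (n + 1 + 1) + 1) / 2 = n + 1 + 1 := by omega
          simp [hj, h3]
      · ext n
        have : (2 * n + 1) % 2 ≠ 0 := by omega
        have : (2 * n + 1) / 2 = n := by omega
        simp [this]

theorem RelDefinableOver.exists {R : K → K → Prop} (h : RelDefinableOver v A B R) :
    DefinableOver v A B {x | ∃ y, R x y} := by
  obtain ⟨φ, e, g, he, hg, h⟩ := h
  exact ⟨.exField 1 φ, e, g, he, hg, by ext x; simp [Formula.Realize, h]⟩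

theorem RelDefinableOver.left {R : K → K → Prop} (h : RelDefinableOver v A B R) {y : K}
    (hy : y ∈ insert 0 A) : DefinableOver v A B {x | R x y} := by
  obtain ⟨φ, e, g, he, hg, h⟩ := h
  refine ⟨φ, Function.update e 1 y, g, fun n => ?_, hg, ?_⟩
  · by_cases hn : n = 1
    · subst hn; simpa using hy
    · simpa [hn] using he n
  · ext x
    rw [Set.mem_ofPred_eq, Set.mem_ofPred_eq, h, Function.update_comm (by norm_num)]

theorem RelDefinableOver.swap {R : K → K → Prop} (h : RelDefinableOver v A B R) :
    RelDefinableOver v A B (fun x y => R y x) := by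
  obtain ⟨φ, e, g, he, hg, h⟩ := h
  refine ⟨φ.rename (Equiv.swap 0 1) id, e ∘ Equiv.swap 0 1, g, fun n => he _, hg, fun x y => ?_⟩
  dsimp only
  rw [h, Formula.realize_rename v (Equiv.injective _) Function.injective_id]
  refine iff_of_eq (congrArg₂ _ ?_ rfl)
  ext n
  by_cases h0 : n = 0
  · subst h0; simp
  by_cases h1 : n = 1
  · subst h1; simp
  simp [Equiv.swap_apply_of_ne_of_ne h0 h1, h0, h1]

theorem DefinableOver.relLeft {D : Set K} (h : DefinableOver v A B D) :
    RelDefinableOver v A B (fun x _ => x ∈ D) := by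
  obtain ⟨φ, e, g, he, hg, rfl⟩ := h
  have hi : Function.Injective (fun n : ℕ => if n = 0 then 0 else n + 1) :=
    fun a b hab => by grind
  refine ⟨φ.rename (fun n => if n = 0 then 0 else n + 1) id,
    fun n => if n = 0 then 0 else e (n - 1), g, fun n => ?_, hg, fun x y => ?_⟩
  · dsimp only
    split_ifs
    exacts [Set.mem_insert _ _, he _]
  · dsimp only
    rw [Set.mem_ofPred_eq, Formula.realize_rename v hi Function.injective_id]
    refine iff_of_eq (congrArg₂ _ ?_ rfl)
    ext n
    by_cases h0 : n = 0
    · subst h0; simp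
    · simp [h0]

theorem DefinableOver.relMul {D : Set K} (h : DefinableOver v A B D) :
    RelDefinableOver v A B (fun x y => x * y ∈ D) := by
  obtain ⟨φ, e, g, he, hg, rfl⟩ := h
  -- The quantified variable `2` holds the product. Shifting `φ` by `2` moves its free variable onto
  -- it and vacates `0` and `1` for the factors.
  refine ⟨.exField 2 (.and (.eqField (.var 2) (.mul (.var 0) (.var 1)))
    (φ.rename (fun n => n + 2) id)), fun n => e (n - 2), g, fun n => he _, hg, fun x y => ?_⟩
  simp only [Formula.Realize, FieldTerm.eval,
    Formula.realize_rename v (add_left_injective 2) Function.injective_id]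
  simp only [Set.mem_ofPred_eq, Function.update_self, ne_eq, OfNat.zero_ne_ofNat,
    not_false_eq_true, Function.update_of_ne, zero_ne_one, OfNat.one_ne_ofNat, exists_eq_left]
  refine iff_of_eq (congrArg₂ _ ?_ rfl)
  ext n
  by_cases h0 : n = 0
  · subst h0; simp
  · simp [h0]

theorem DefinableOver.compl {D : Set K} (h : DefinableOver v A B D) : DefinableOver v A B Dᶜ :=
  h.relLeft.not.left (Set.mem_insert _ _)

theorem DefinableOver.inter {D D' : Set K} (h : DefinableOver v A B D)
    (h' : DefinableOver v A B D') : DefinableOver v A B (D ∩ D') :=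
  (h.relLeft.and h'.relLeft).left (Set.mem_insert _ _)

theorem DefinableOver.union {D D' : Set K} (h : DefinableOver v A B D)
    (h' : DefinableOver v A B D') : DefinableOver v A B (D ∪ D') := by
  simpa [Set.compl_inter] using (h.compl.inter h'.compl).compl

theorem definableOver_univ : DefinableOver v A B Set.univ :=
  ⟨.eqField .zero .zero, fun _ => 0, fun _ => ⊤, by simp, by simp, by
    simp [Formula.Realize]⟩

theorem definableOver_empty : DefinableOver v A B ∅ := by
  simpa using definableOver_univ.compl

theorem definableOver_ne_zero : DefinableOver v A B {x | x ≠ 0} :=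
  ⟨.not (.eqField (.var 0) .zero), fun _ => 0, fun _ => ⊤, by simp, by simp, by
    simp [Formula.Realize, FieldTerm.eval]⟩

theorem DefinableOver.sInter {𝓕 : Set (Set K)} (hf : 𝓕.Finite)
    (h : ∀ D ∈ 𝓕, DefinableOver v A B D) : DefinableOver v A B (⋂₀ 𝓕) := by
  induction 𝓕, hf using Set.Finite.induction_on with
  | empty => simpa using definableOver_univ
  | insert _ _ ih =>
    rw [Set.sInter_insert]
    exact (h _ (Set.mem_insert _ _)).inter (ih fun D hD => h D (Set.mem_insert_of_mem _ hD))

theorem DefinableOver.sUnion {𝓕 : Set (Set K)} (hf : 𝓕.Finite)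
    (h : ∀ D ∈ 𝓕, DefinableOver v A B D) : DefinableOver v A B (⋃₀ 𝓕) := by
  induction 𝓕, hf using Set.Finite.induction_on with
  | empty => simpa using definableOver_empty
  | insert _ _ ih =>
    rw [Set.sUnion_insert]
    exact (h _ (Set.mem_insert _ _)).union (ih fun D hD => h D (Set.mem_insert_of_mem _ hD))

end Relations

end ACVF

namespace ACVF

/-! ### Consequences of saturation -/

section Saturation

variable {K Γ : Type u} [Field K] [AddCommGroup Γ] [LinearOrder Γ] [IsOrderedAddMonoid Γ]
  {v : AddValuation K (WithTop Γ)} {κ : Cardinal.{u}}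

theorem mk_iUnion_lt_of_finite {ι α : Type u} (hκ : Cardinal.aleph0 ≤ κ)
    (hι : Cardinal.mk ι < κ) (s : ι → Set α) (hs : ∀ i, (s i).Finite) :
    Cardinal.mk (⋃ i, s i) < κ := by
  cases finite_or_infinite ι with
  | inl h =>
    have : (⋃ i, s i).Finite := Set.finite_iUnion hs
    exact (Cardinal.lt_aleph0_iff_set_finite.2 this).trans_le hκ
  | inr h =>
    refine lt_of_le_of_lt ?_ hι
    refine (Cardinal.mk_iUnion_le s).trans ?_
    refine (mul_le_mul' le_rfl (ciSup_le' fun i =>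
      (Cardinal.lt_aleph0_iff_set_finite.2 (hs i)).le)).trans ?_
    exact (Cardinal.mul_aleph0_eq (Cardinal.infinite_iff.1 h)).le

theorem exists_small_parameters (hκ : Cardinal.aleph0 ≤ κ) {𝒟 : Set (Set K)}
    (h𝒟 : Cardinal.mk 𝒟 < κ) (hdef : ∀ D ∈ 𝒟, Definable v D) :
    ∃ (A : Set K) (B : Set (WithTop Γ)), Cardinal.mk A < κ ∧ Cardinal.mk B < κ ∧
      ∀ D ∈ 𝒟, DefinableOver v A B D := by
  choose φ e g he hg h using fun D : 𝒟 => (hdef D D.2).exists_finite_range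
  refine ⟨⋃ D, Set.range (e D), ⋃ D, Set.range (g D), mk_iUnion_lt_of_finite hκ h𝒟 _ he,
    mk_iUnion_lt_of_finite hκ h𝒟 _ hg, fun D hD => ⟨φ ⟨D, hD⟩, e ⟨D, hD⟩, g ⟨D, hD⟩,
    fun n => Or.inr (Set.mem_iUnion.2 ⟨⟨D, hD⟩, n, rfl⟩),
    fun n => Or.inr (Set.mem_iUnion.2 ⟨⟨D, hD⟩, n, rfl⟩), h ⟨D, hD⟩⟩⟩

/-- Compactness for quotients: if a small intersection of definable sets is a group, then each of
these sets contains the quotients of some finite subintersection. -/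
theorem exists_finite_quotient_subset (hκ : Cardinal.aleph0 ≤ κ) (hsat : IsSaturated κ v)
    {X : Subgroup Kˣ} {𝒟 : Set (Set K)} (h𝒟 : Cardinal.mk 𝒟 < κ)
    (hdef : ∀ D ∈ 𝒟, Definable v D) (hX : Units.val '' (X : Set Kˣ) = ⋂₀ 𝒟) {D : Set K}
    (hD : D ∈ 𝒟) :
    ∃ 𝓕 ⊆ 𝒟, 𝓕.Finite ∧ ∀ x y : K, x ≠ 0 → x ∈ ⋂₀ 𝓕 → x * y ∈ ⋂₀ 𝓕 → y ∈ D := by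
  obtain ⟨A, B, hA, hB, hAB⟩ := exists_small_parameters hκ h𝒟 hdef
  by_contra! hcon
  set R : Set (Set K) → K → K → Prop := fun 𝓕 x y =>
    (x ≠ 0 ∧ x ∈ ⋂₀ 𝓕) ∧ (x * y ∈ ⋂₀ 𝓕 ∧ y ∉ D) with hR
  have hRdef : ∀ 𝓕 ⊆ 𝒟, 𝓕.Finite → RelDefinableOver v A B (R 𝓕) := fun 𝓕 h𝓕 hfin => by
    have hs := DefinableOver.sInter hfin fun D hD => hAB D (h𝓕 hD)
    exact (definableOver_ne_zero.relLeft.and hs.relLeft).and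
      (hs.relMul.and (hAB D hD).relLeft.swap.not)
  -- Saturation realizes types in one variable only, so the pair is found in two stages: first an
  -- `x` that has a bad partner `y` for each finite subfamily, then, with `x` as a new parameter,
  -- one `y` that works for all of them.
  obtain ⟨x, hx⟩ := (hsat A B hA hB).1
    {Z | ∃ 𝓕 ⊆ 𝒟, 𝓕.Finite ∧ Z = {x | ∃ y, R 𝓕 x y}}
    (by rintro _ ⟨𝓕, h𝓕, hfin, rfl⟩; exact (hRdef 𝓕 h𝓕 hfin).exists) (by
      intro 𝓖 h𝓖 hfin
      have := hfin.to_subtype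
      choose f hf hffin hfeq using fun Z : 𝓖 => h𝓖 Z.2
      obtain ⟨x, y, hx0, hx, hxy, hy⟩ := hcon (⋃ Z, f Z) (Set.iUnion_subset hf)
        (Set.finite_iUnion hffin)
      refine ⟨x, fun Z hZ => ?_⟩
      have sub : f ⟨Z, hZ⟩ ⊆ ⋃ Z, f Z := Set.subset_iUnion f ⟨Z, hZ⟩
      rw [show Z = {x | ∃ y, R (f ⟨Z, hZ⟩) x y} from hfeq ⟨Z, hZ⟩]
      exact ⟨y, ⟨hx0, Set.sInter_subset_sInter sub hx⟩, Set.sInter_subset_sInter sub hxy, hy⟩)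
  have hxR : ∀ 𝓕 ⊆ 𝒟, 𝓕.Finite → ∃ y, R 𝓕 x y := fun 𝓕 h𝓕 hfin =>
    hx _ ⟨𝓕, h𝓕, hfin, rfl⟩
  have hAx : Cardinal.mk (insert x A : Set K) < κ := by
    refine Cardinal.mk_insert_le.trans_lt (Cardinal.add_lt_of_lt hκ hA ?_)
    exact Cardinal.one_lt_aleph0.trans_le hκ
  obtain ⟨y, hy⟩ := (hsat (insert x A) B hAx hB).1
    (insert Dᶜ ((fun E => {y | x * y ∈ E}) '' 𝒟)) (by
      rintro E (rfl | ⟨E, hE, rfl⟩)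
      · exact (hAB D hD).compl.mono (Set.subset_insert _ _) le_rfl
      · exact ((hAB E hE).mono (Set.subset_insert _ _) le_rfl).relMul.swap.left
          (Or.inr (Set.mem_insert _ _))) (by
      intro 𝓖 h𝓖 hfin
      have := hfin.to_subtype
      have key : ∀ Z : 𝓖, ∃ 𝓔 ⊆ 𝒟, 𝓔.Finite ∧ ∀ y, x * y ∈ ⋂₀ 𝓔 → y ∉ D → y ∈ Z.1 := by
        rintro ⟨Z, hZ⟩
        rcases h𝓖 hZ with rfl | ⟨E, hE, rfl⟩
        · exact ⟨∅, Set.empty_subset _, Set.finite_empty, fun y _ hy => hy⟩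
        · exact ⟨{E}, by simpa using hE, Set.finite_singleton E, fun y hy _ => by simpa using hy⟩
      choose f hf hffin hfeq using key
      obtain ⟨y, -, hxy, hy⟩ := hxR (⋃ Z, f Z) (Set.iUnion_subset hf) (Set.finite_iUnion hffin)
      exact ⟨y, fun Z hZ => hfeq ⟨Z, hZ⟩ y
        (Set.sInter_subset_sInter (Set.subset_iUnion f ⟨Z, hZ⟩) hxy) hy⟩)
  -- Now `x` and `x * y` lie in `X`, hence so does `y`, although `y ∉ D`.
  have hxX : x ∈ Units.val '' (X : Set Kˣ) := by
    rw [hX]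
    intro E hE
    obtain ⟨y, h1, -⟩ := hxR {E} (by simpa using hE) (Set.finite_singleton E)
    simpa using h1.2
  have hxyX : x * y ∈ Units.val '' (X : Set Kˣ) := by
    rw [hX]
    exact fun E hE => hy _ (Or.inr ⟨E, hE, rfl⟩)
  have hyX : y ∈ Units.val '' (X : Set Kˣ) := by
    obtain ⟨a, ha, rfl⟩ := hxX
    obtain ⟨b, hb, hab⟩ := hxyX
    refine ⟨a⁻¹ * b, X.mul_mem (X.inv_mem ha) hb, ?_⟩
    rw [Units.val_mul, hab, Units.inv_mul_cancel_left]
  rw [hX] at hyX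
  exact hy _ (Set.mem_insert _ _) (hyX D hD)

end Saturation

end ACVF

namespace ACVF

/-! ### Valuations on algebraic extensions -/

section Extensions

variable {N Γ : Type*} [Field N] [AddCommGroup Γ] [LinearOrder Γ] [IsOrderedAddMonoid Γ]

theorem exists_coe_eq (w : AddValuation N (WithTop Γ)) {x : N} (hx : x ≠ 0) :
    ∃ γ : Γ, w x = γ := by
  have := (AddValuation.ne_top_iff w).2 hx
  exact ⟨(w x).untop this, (WithTop.coe_untop _ _).symm⟩

/-- The unique term of least value dominates the sum. -/
theorem sum_ne_zero_of_injOn (w : AddValuation N (WithTop Γ)) {ι : Type*} {s : Finset ι}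
    (hs : s.Nonempty) {f : ι → N} (hf : ∀ i ∈ s, f i ≠ 0)
    (hinj : Set.InjOn (fun i => w (f i)) s) : ∑ i ∈ s, f i ≠ 0 := by
  classical
  obtain ⟨i, hi, hmin⟩ := s.exists_min_image (fun i => w (f i)) hs
  have hlt : w (f i) < w (∑ j ∈ s.erase i, f j) := by
    refine AddValuation.map_lt_sum w ((AddValuation.ne_top_iff w).2 (hf i hi)) fun j hj => ?_
    refine lt_of_le_of_ne (hmin j (Finset.mem_of_mem_erase hj)) fun h => ?_
    exact Finset.ne_of_mem_erase hj (hinj (Finset.mem_of_mem_erase hj) hi h.symm)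
  rw [← Finset.add_sum_erase s f hi]
  intro h
  have := AddValuation.map_add_eq_of_lt_left w hlt
  rw [h, AddValuation.map_zero] at this
  exact (AddValuation.ne_top_iff w).2 (hf i hi) this.symm

variable {E : Type*} [Field E] [Algebra E N]

/-- In an algebraic equation for `x` two nonzero terms must share their value; comparing them gives
the value of a power of `x` as that of a quotient of coefficients. -/
theorem exists_pow_map_eq (w : AddValuation N (WithTop Γ)) {x : N} (hx : x ≠ 0)
    (hxE : IsAlgebraic E x) :
    ∃ m : ℕ, 0 < m ∧ ∃ a : E, a ≠ 0 ∧ w (x ^ m) = w (algebraMap E N a) := by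
  obtain ⟨p, hp, hpx⟩ := hxE
  have hinj : ¬ Set.InjOn (fun i => w (algebraMap E N (p.coeff i) * x ^ i)) p.support := by
    intro h
    refine sum_ne_zero_of_injOn w (Polynomial.support_nonempty.2 hp) (fun i hi => ?_) h ?_
    · exact mul_ne_zero ((map_ne_zero _).2 (Polynomial.mem_support_iff.1 hi)) (pow_ne_zero _ hx)
    · rw [Polynomial.aeval_def, Polynomial.eval₂_eq_sum] at hpx
      exact hpx
  simp only [Set.InjOn, not_forall] at hinj
  obtain ⟨i, hi, j, hj, hij, hne⟩ := hinj
  wlog hlt : i < j generalizing i j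
  · exact this j hj i hi hij.symm (Ne.symm hne) (lt_of_le_of_ne (not_lt.1 hlt) (Ne.symm hne))
  have hi0 : p.coeff i ≠ 0 := Polynomial.mem_support_iff.1 hi
  have hj0 : p.coeff j ≠ 0 := Polynomial.mem_support_iff.1 hj
  refine ⟨j - i, Nat.sub_pos_of_lt hlt, p.coeff i / p.coeff j, div_ne_zero hi0 hj0, ?_⟩
  obtain ⟨a, ha⟩ := exists_coe_eq w ((map_ne_zero (algebraMap E N)).2 hi0)
  obtain ⟨b, hb⟩ := exists_coe_eq w ((map_ne_zero (algebraMap E N)).2 hj0)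
  obtain ⟨c, hc⟩ := exists_coe_eq w (pow_ne_zero i hx)
  obtain ⟨d, hd⟩ := exists_coe_eq w (pow_ne_zero (j - i) hx)
  obtain ⟨q, hq⟩ := exists_coe_eq w
    ((map_ne_zero (algebraMap E N)).2 (div_ne_zero hi0 hj0))
  have h1 : w (algebraMap E N (p.coeff i)) =
      w (algebraMap E N (p.coeff i / p.coeff j)) + w (algebraMap E N (p.coeff j)) := by
    rw [← AddValuation.map_mul, ← map_mul, div_mul_cancel₀ _ hj0]
  have h2 : x ^ j = x ^ i * x ^ (j - i) := by rw [← pow_add, Nat.add_sub_cancel' hlt.le]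
  simp only [h2, AddValuation.map_mul, ha, hb, hc, hd] at hij
  rw [ha, hb, hq] at h1
  rw [hd, hq]
  norm_cast at hij h1 ⊢
  rw [h1] at hij
  have : q + b + c = d + (b + c) := by rw [hij]; abel
  rw [add_assoc] at this
  exact (add_right_cancel this).symm

theorem map_pos_iff_not_inv_nonneg (w : AddValuation N (WithTop Γ)) {x : N} (hx : x ≠ 0) :
    0 < w x ↔ ¬ 0 ≤ w x⁻¹ := by
  obtain ⟨γ, hγ⟩ := exists_coe_eq w hx
  obtain ⟨δ, hδ⟩ := exists_coe_eq w (inv_ne_zero hx)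
  have : w x + w x⁻¹ = 0 := by
    rw [← AddValuation.map_mul, mul_inv_cancel₀ hx, AddValuation.map_one]
  rw [hγ, hδ] at this ⊢
  norm_cast at this ⊢
  rw [not_le, ← neg_eq_of_add_eq_zero_right this, neg_lt_zero]

theorem map_pos_congr {w w' : AddValuation N (WithTop Γ)} {x : N}
    (h : 0 ≤ w x⁻¹ ↔ 0 ≤ w' x⁻¹) : 0 < w x ↔ 0 < w' x := by
  by_cases hx : x = 0
  · simp [hx, AddValuation.map_zero]
  · rw [map_pos_iff_not_inv_nonneg w hx, map_pos_iff_not_inv_nonneg w' hx, h]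

theorem map_pow_nonneg (w : AddValuation N (WithTop Γ)) {x : N} (hx : 0 ≤ w x) (n : ℕ) :
    0 ≤ w (x ^ n) := by
  rw [AddValuation.map_pow]
  exact nsmul_nonneg hx n

/-- An element `u` which exhibits an algebraic element `x` as a quotient `(x * u) / u`,
simultaneously for all extensions of a valuation. -/
theorem exists_denominator (w : AddValuation N (WithTop Γ)) {x : N} (hx : x ≠ 0)
    (hxE : IsAlgebraic E x) :
    ∃ u : N, ∀ w' : AddValuation N (WithTop Γ),
      (∀ a : E, 0 ≤ w (algebraMap E N a) ↔ 0 ≤ w' (algebraMap E N a)) →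
        0 ≤ w' u ∧ 0 ≤ w' (x * u) ∧ (0 ≤ w' x → w' u = 0) := by
  obtain ⟨p, hp, hpx⟩ := hxE
  set f : ℕ → WithTop Γ := fun i => w (algebraMap E N (p.coeff i)) with hf
  obtain ⟨i₀, hi₀, hmin⟩ := p.support.exists_min_image f (Polynomial.support_nonempty.2 hp)
  -- Let `k` be the last index whose coefficient has least value. After division by that coefficient
  -- the equation is integral, with coefficient `1` at `k` and coefficients of positive value
  -- beyond. The tail from `k` on, divided by `x ^ k`, is the required `u`.
  set T := p.support.filter fun i => f i = f i₀ with hT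
  have hTne : T.Nonempty := ⟨i₀, Finset.mem_filter.2 ⟨hi₀, rfl⟩⟩
  set k := T.max' hTne with hk
  have hkT : k ∈ T := T.max'_mem hTne
  have hk0 : p.coeff k ≠ 0 := Polynomial.mem_support_iff.1 (Finset.mem_filter.1 hkT).1
  have hfk : f k = f i₀ := (Finset.mem_filter.1 hkT).2
  have hle : ∀ i, f k ≤ f i := fun i => by
    by_cases hi : p.coeff i = 0
    · simp [hf, hi, AddValuation.map_zero]
    · rw [hfk]
      exact hmin i (Polynomial.mem_support_iff.2 hi)
  have hlt : ∀ i, k < i → f k < f i := fun i hki => by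
    refine lt_of_le_of_ne (hle i) fun h => ?_
    by_cases hi : p.coeff i = 0
    · simp only [hf, hi, _root_.map_zero, AddValuation.map_zero] at h
      exact (AddValuation.ne_top_iff w).2 ((map_ne_zero (algebraMap E N)).2 hk0) h
    · exact (T.le_max' i (Finset.mem_filter.2 ⟨Polynomial.mem_support_iff.2 hi, by
        rw [← h, hfk]⟩)).not_gt hki
  set b : ℕ → E := fun i => p.coeff i / p.coeff k with hb
  have hbk : b k = 1 := div_self hk0
  have hfb : ∀ i, f i = w (algebraMap E N (b i)) + f k := fun i => by
    simp only [hf, hb]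
    rw [← AddValuation.map_mul, ← map_mul, div_mul_cancel₀ _ hk0]
  obtain ⟨c, hc⟩ := exists_coe_eq w ((map_ne_zero (algebraMap E N)).2 hk0)
  have hb0 : ∀ i, 0 ≤ w (algebraMap E N (b i)) := fun i => by
    have h1 := hle i
    rw [hfb i] at h1
    by_cases hi : b i = 0
    · simp [hi, AddValuation.map_zero]
    · obtain ⟨d, hd⟩ := exists_coe_eq w ((map_ne_zero (algebraMap E N)).2 hi)
      simp only [hf, hc, hd] at h1 ⊢
      norm_cast at h1 ⊢
      simpa using h1
  have hbpos : ∀ i, k < i → 0 < w (algebraMap E N (b i)) := fun i hki => by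
    have h1 := hlt i hki
    rw [hfb i] at h1
    by_cases hi : b i = 0
    · simp [hi, AddValuation.map_zero]
    · obtain ⟨d, hd⟩ := exists_coe_eq w ((map_ne_zero (algebraMap E N)).2 hi)
      simp only [hf, hc, hd] at h1 ⊢
      norm_cast at h1 ⊢
      simpa using h1
  have hkn : k ≤ p.natDegree := Polynomial.le_natDegree_of_ne_zero hk0
  have hsum : ∑ i ∈ Finset.range (p.natDegree + 1), algebraMap E N (b i) * x ^ i = 0 := by
    rw [Polynomial.aeval_eq_sum_range] at hpx
    have : ∑ i ∈ Finset.range (p.natDegree + 1), algebraMap E N (b i) * x ^ i =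
        (algebraMap E N (p.coeff k))⁻¹ *
          ∑ i ∈ Finset.range (p.natDegree + 1), p.coeff i • x ^ i := by
      rw [Finset.mul_sum]
      refine Finset.sum_congr rfl fun i _ => ?_
      simp only [hb, map_div₀, Algebra.smul_def]
      ring
    rw [this, hpx, mul_zero]
  set u := ∑ i ∈ Finset.Ico k (p.natDegree + 1), algebraMap E N (b i) * x ^ (i - k) with hu
  have hul : x ^ k * u = -∑ i ∈ Finset.range k, algebraMap E N (b i) * x ^ i := by
    rw [← Finset.sum_range_add_sum_Ico _ (hkn.trans (Nat.le_succ _))] at hsum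
    rw [eq_neg_iff_add_eq_zero, ← hsum, add_comm, hu, Finset.mul_sum]
    congr 1
    refine Finset.sum_congr rfl fun i hi => ?_
    rw [mul_left_comm, ← pow_add, Nat.add_sub_cancel' (Finset.mem_Ico.1 hi).1]
  refine ⟨u, fun w' hw' => ?_⟩
  have hb0' : ∀ i, 0 ≤ w' (algebraMap E N (b i)) := fun i => (hw' _).1 (hb0 i)
  have hbpos' : ∀ i, k < i → 0 < w' (algebraMap E N (b i)) := fun i hi => by
    refine (map_pos_congr (w := w) ?_).1 (hbpos i hi)
    rw [← map_inv₀]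
    exact hw' _
  -- If `x` is integral, `u` is `1` plus terms of positive value. If not, the equation rewrites `u`
  -- and `x * u` as polynomials in the integral element `x⁻¹`.
  rcases le_or_gt 0 (w' x) with hx0 | hx0
  · have hu0 : w' u = 0 := by
      rw [hu, Finset.sum_eq_sum_Ico_succ_bot (Nat.lt_succ_of_le hkn), hbk, Nat.sub_self, pow_zero,
        map_one, one_mul]
      have hlt : w' 1 < w' (∑ i ∈ Finset.Ico (k + 1) (p.natDegree + 1),
          algebraMap E N (b i) * x ^ (i - k)) := by
        rw [AddValuation.map_one]
        refine AddValuation.map_lt_sum w' WithTop.zero_ne_top fun i hi => ?_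
        rw [AddValuation.map_mul]
        exact add_pos_of_pos_of_nonneg (hbpos' i (Finset.mem_Ico.1 hi).1)
          (map_pow_nonneg w' hx0 _)
      rw [AddValuation.map_add_eq_of_lt_left w' hlt, AddValuation.map_one]
    refine ⟨hu0.ge, ?_, fun _ => hu0⟩
    rw [AddValuation.map_mul, hu0, add_zero]
    exact hx0
  · have hy : 0 ≤ w' x⁻¹ := by
      by_contra h
      exact hx0.not_gt ((map_pos_iff_not_inv_nonneg w' hx).2 h)
    have hu1 : u = -∑ i ∈ Finset.range k, algebraMap E N (b i) * x⁻¹ ^ (k - i) := by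
      rw [← mul_right_inj' (pow_ne_zero k hx), hul, mul_neg, Finset.mul_sum]
      congr 1
      refine Finset.sum_congr rfl fun i hi => ?_
      have : x ^ k = x ^ i * x ^ (k - i) := by
        rw [← pow_add, Nat.add_sub_cancel' (Finset.mem_range.1 hi).le]
      rw [this, inv_pow]
      have := pow_ne_zero (k - i) hx
      field_simp
    have hu2 : x * u = -∑ i ∈ Finset.range k, algebraMap E N (b i) * x⁻¹ ^ (k - i - 1) := by
      rw [hu1, mul_neg, Finset.mul_sum]
      congr 1
      refine Finset.sum_congr rfl fun i hi => ?_
      have : k - i = k - i - 1 + 1 := by have := Finset.mem_range.1 hi; omega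
      rw [this, pow_succ, Nat.add_sub_cancel]
      field_simp
    refine ⟨?_, ?_, fun h => absurd h hx0.not_ge⟩
    · rw [hu1, AddValuation.map_neg]
      refine AddValuation.map_le_sum w' fun i _ => ?_
      rw [AddValuation.map_mul]
      exact add_nonneg (hb0' i) (map_pow_nonneg w' hy _)
    · rw [hu2, AddValuation.map_neg]
      refine AddValuation.map_le_sum w' fun i _ => ?_
      rw [AddValuation.map_mul]
      exact add_nonneg (hb0' i) (map_pow_nonneg w' hy _)

/-- All roots of the minimal polynomial are conjugates of `y`, so it is `(X - y) ^ n`, and its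
constant term is `y ^ n` up to sign. A power is needed because `y` may be purely inseparable over
`E`. -/
theorem exists_pow_mem_range_of_fixed [Normal E N] {y : N} (hy : ∀ σ : N ≃ₐ[E] N, σ y = y) :
    ∃ n : ℕ, 0 < n ∧ ∃ a : E, y ^ n = algebraMap E N a := by
  have hint : IsIntegral E y := Normal.isIntegral inferInstance y
  have hsplit := Normal.splits (inferInstance : Normal E N) y
  have hroots : ∀ z ∈ ((minpoly E y).map (algebraMap E N)).roots, z = y := fun z hz => by
    have hev : Polynomial.aeval z (minpoly E y) = 0 := by
      rw [Polynomial.aeval_def, ← Polynomial.eval_map]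
      exact Polynomial.isRoot_of_mem_roots hz
    obtain ⟨σ, hσ⟩ := minpoly.exists_algEquiv_of_root' hint.isAlgebraic hev
    rw [← hσ, hy]
  have heq := hsplit.eq_prod_roots_of_monic ((minpoly.monic hint).map _)
  rw [Multiset.eq_replicate_of_mem hroots, Multiset.map_replicate, Multiset.prod_replicate] at heq
  set n := Multiset.card ((minpoly E y).map (algebraMap E N)).roots
  refine ⟨n, ?_, (-1) ^ n * (minpoly E y).coeff 0, ?_⟩
  · rw [Nat.pos_iff_ne_zero]
    intro h0
    rw [h0, pow_zero, ← Polynomial.map_one (algebraMap E N)] at heq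
    exact minpoly.ne_one E y (Polynomial.map_injective _ (algebraMap E N).injective heq)
  · have h : algebraMap E N ((minpoly E y).coeff 0) = (-y) ^ n := by
      rw [← Polynomial.coeff_map, heq, Polynomial.coeff_zero_eq_eval_zero]
      simp
    rw [map_mul, map_pow, map_neg, map_one, h, ← mul_pow]
    simp

end Extensions

end ACVF

namespace ACVF

/-! ### Conjugacy of the extensions of a valuation to a finite normal extension -/

section Conjugacy

variable {N Γ : Type*} [Field N] [AddCommGroup Γ] [LinearOrder Γ] [IsOrderedAddMonoid Γ]
  {E : Type*} [Field E] [Algebra E N]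

theorem map_pow_pos_iff (w : AddValuation N (WithTop Γ)) {x : N} {n : ℕ} (hn : 0 < n) :
    0 < w (x ^ n) ↔ 0 < w x := by
  by_cases hx : x = 0
  · simp [hx, hn.ne', AddValuation.map_zero]
  · obtain ⟨γ, hγ⟩ := exists_coe_eq w hx
    rw [AddValuation.map_pow, hγ]
    norm_cast
    exact smul_pos_iff_of_pos_left hn

/-- Two valuations on a finite normal extension whose valuation rings have the same trace on the
base field are conjugate. -/
theorem exists_conjugate [FiniteDimensional E N] [Normal E N] (w₁ w₂ : AddValuation N (WithTop Γ))
    (h : ∀ a : E, 0 ≤ w₁ (algebraMap E N a) ↔ 0 ≤ w₂ (algebraMap E N a)) :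
    ∃ σ : N ≃ₐ[E] N, ∀ x, 0 ≤ w₁ x ↔ 0 ≤ w₂ (σ x) := by
  classical
  have := Fintype.ofFinite (N ≃ₐ[E] N)
  have hpos : ∀ a : E, 0 < w₁ (algebraMap E N a) ↔ 0 < w₂ (algebraMap E N a) := fun a =>
    map_pos_congr (by rw [← map_inv₀]; exact h _)
  let w : (N ≃ₐ[E] N) → AddValuation N (WithTop Γ) := fun σ => w₂.comap (σ : N →+* N)
  have hw : ∀ σ x, w σ x = w₂ (σ x) := fun _ _ => rfl
  let w' : (N ≃ₐ[E] N) → AddValuation N (WithTop Γ) := fun σ => w₁.comap (σ : N →+* N)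
  have hw' : ∀ σ x, w' σ x = w₁ (σ x) := fun _ _ => rfl
  have hwE : ∀ σ (a : E), w σ (algebraMap E N a) = w₂ (algebraMap E N a) := fun σ a => by
    rw [hw, AlgEquiv.commutes]
  have hwE' : ∀ σ (a : E), w' σ (algebraMap E N a) = w₁ (algebraMap E N a) := fun σ a => by
    rw [hw', AlgEquiv.commutes]
  -- `R` is the intersection of all conjugates of both valuation rings; `P` and `Q σ` are the traces
  -- on it of the maximal ideals of `w₁` and of the conjugates of `w₂`. Prime avoidance will put `P`
  -- inside one `Q σ`.
  let R : Subring N :=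
    { carrier := {x | ∀ σ, 0 ≤ w' σ x ∧ 0 ≤ w σ x}
      mul_mem' := fun {x y} hx hy σ => by
        rw [AddValuation.map_mul, AddValuation.map_mul]
        exact ⟨add_nonneg (hx σ).1 (hy σ).1, add_nonneg (hx σ).2 (hy σ).2⟩
      one_mem' := fun σ => by simp [AddValuation.map_one]
      add_mem' := fun {x y} hx hy σ =>
        ⟨AddValuation.map_le_add _ (hx σ).1 (hy σ).1, AddValuation.map_le_add _ (hx σ).2 (hy σ).2⟩
      zero_mem' := fun σ => by simp [AddValuation.map_zero]
      neg_mem' := fun {x} hx σ => by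
        rw [AddValuation.map_neg, AddValuation.map_neg]
        exact hx σ }
  have hR : ∀ x, x ∈ R ↔ ∀ σ, 0 ≤ w' σ x ∧ 0 ≤ w σ x := fun x => Iff.rfl
  let P : Ideal R :=
    { carrier := {x | 0 < w₁ x}
      add_mem' := fun {x y} hx hy => show 0 < w₁ ((x : N) + y) from AddValuation.map_lt_add _ hx hy
      zero_mem' := by simp [AddValuation.map_zero]
      smul_mem' := fun c x hx => by
        simp only [smul_eq_mul, Set.mem_ofPred_eq, Subring.coe_mul, AddValuation.map_mul]
        rw [add_comm]
        exact add_pos_of_pos_of_nonneg hx (c.2 1).1 }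
  let Q : (N ≃ₐ[E] N) → Ideal R := fun σ =>
    { carrier := {x | 0 < w σ x}
      add_mem' := fun {x y} hx hy => show 0 < w σ ((x : N) + y) from AddValuation.map_lt_add _ hx hy
      zero_mem' := by simp [AddValuation.map_zero]
      smul_mem' := fun c x hx => by
        simp only [smul_eq_mul, Set.mem_ofPred_eq, Subring.coe_mul, AddValuation.map_mul]
        rw [add_comm]
        exact add_pos_of_pos_of_nonneg hx (c.2 σ).2 }
  have hQ : ∀ σ, (Q σ).IsPrime := fun σ => by
    refine ⟨fun htop => ?_, fun {x y} hxy => ?_⟩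
    · have h1 : (1 : R) ∈ Q σ := htop ▸ Submodule.mem_top
      have h2 : 0 < w σ 1 := h1
      rw [AddValuation.map_one] at h2
      exact lt_irrefl _ h2
    · have h1 : 0 < w σ (x * y) := hxy
      by_contra! hcon
      have hx : w σ x ≤ 0 := not_lt.1 hcon.1
      have hy : w σ y ≤ 0 := not_lt.1 hcon.2
      rw [AddValuation.map_mul] at h1
      exact h1.not_ge (add_nonpos hx hy)
  have hcover : (P : Set R) ⊆ ⋃ σ ∈ ((Finset.univ : Finset (N ≃ₐ[E] N)) : Set (N ≃ₐ[E] N)), Q σ := by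
    intro x hx
    have hx1 : 0 < w₁ x := hx
    -- The product of the conjugates has a power in `E`, where positivity passes from `w₁` to `w₂`;
    -- then one factor must be positive for `w₂`.
    have hfix : ∀ τ : N ≃ₐ[E] N, τ (∏ σ : N ≃ₐ[E] N, σ x) = ∏ σ : N ≃ₐ[E] N, σ x := fun τ => by
      rw [map_prod]
      exact Fintype.prod_equiv (Equiv.mulLeft τ) _ _ fun σ => rfl
    obtain ⟨n, hn, a, ha⟩ := exists_pow_mem_range_of_fixed hfix
    have hxR := (hR x).1 x.2
    have hprod : ∏ σ : N ≃ₐ[E] N, σ x = x * ∏ σ ∈ Finset.univ.erase (1 : N ≃ₐ[E] N), σ x :=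
      (Finset.mul_prod_erase _ (fun σ : N ≃ₐ[E] N => σ (x : N)) (Finset.mem_univ 1)).symm
    have nonneg : ∀ s : Finset (N ≃ₐ[E] N), 0 ≤ w₁ (∏ σ ∈ s, σ (x : N)) := fun s => by
      refine Finset.prod_induction _ (fun y => 0 ≤ w₁ y) (fun y z hy hz => ?_)
        (by rw [AddValuation.map_one]) fun σ _ => (hxR σ).1
      rw [AddValuation.map_mul]
      exact add_nonneg hy hz
    have h1 : 0 < w₁ (∏ σ : N ≃ₐ[E] N, σ x) := by
      rw [hprod, AddValuation.map_mul]
      exact add_pos_of_pos_of_nonneg hx1 (nonneg _)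
    rw [← map_pow_pos_iff w₁ hn, ha, hpos, ← ha, map_pow_pos_iff w₂ hn] at h1
    by_contra hcon
    simp only [Finset.coe_univ, Set.mem_univ, Set.iUnion_true, Set.mem_iUnion, not_exists] at hcon
    refine h1.not_ge ?_
    refine Finset.prod_induction _ (fun y => w₂ y ≤ 0) (fun y z hy hz => ?_)
      (by rw [AddValuation.map_one]) fun σ _ => not_lt.1 (hcon σ)
    rw [AddValuation.map_mul]
    exact add_nonpos hy hz
  obtain ⟨σ, -, hσ⟩ := (Ideal.subset_union_prime (1 : N ≃ₐ[E] N) 1 fun σ _ _ _ => hQ σ).1 hcover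
  -- Write `x` as `(x * u) / u` with both terms in `R`. As `u` is outside `Q σ` it is outside `P`,
  -- hence a unit for `w₁`.
  have hle : ∀ x, 0 ≤ w σ x → 0 ≤ w₁ x := fun x hx => by
    by_cases hx0 : x = 0
    · simp [hx0, AddValuation.map_zero]
    obtain ⟨u, hu⟩ := exists_denominator w₁ hx0 (Algebra.IsAlgebraic.isAlgebraic (R := E) x)
    have huR : u ∈ R := (hR u).2 fun τ => ⟨(hu (w' τ) fun a => by rw [hwE']).1,
      (hu (w τ) fun a => by rw [hwE, h]).1⟩
    have hu0 : w σ u = 0 := (hu (w σ) fun a => by rw [hwE, h]).2.2 hx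
    have hu1 : w₁ u = 0 := by
      refine le_antisymm (not_lt.1 fun hlt => ?_) (huR 1).1
      have : 0 < w σ u := hσ (show (⟨u, huR⟩ : R) ∈ P from hlt)
      exact this.ne' hu0
    have := (hu w₁ fun _ => Iff.rfl).2.1
    rwa [AddValuation.map_mul, hu1, add_zero] at this
  refine ⟨σ, fun x => ⟨fun hx => ?_, hle x⟩⟩
  by_cases hx0 : x = 0
  · simp [hx0, AddValuation.map_zero]
  rw [← hw]
  by_contra hcon
  have hxi : x⁻¹ ≠ 0 := inv_ne_zero hx0
  have hy : 0 < w σ x⁻¹ := by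
    rw [map_pos_iff_not_inv_nonneg _ hxi, inv_inv]
    exact hcon
  -- The inclusion of valuation rings is not proper: up to a unit of `w σ`, a power of `x⁻¹` lies in
  -- `E`, where both valuations agree on positivity.
  obtain ⟨m, hm, a, ha0, ha⟩ := exists_pow_map_eq (E := E) (w σ) hxi
    (Algebra.IsAlgebraic.isAlgebraic _)
  rw [← map_pow_pos_iff _ hm, ha, hwE, ← hpos] at hy
  have ha0' : algebraMap E N a ≠ 0 := (map_ne_zero _).2 ha0
  have hle' := hle (x⁻¹ ^ m / algebraMap E N a) (by
    rw [div_eq_mul_inv, AddValuation.map_mul, ha, ← AddValuation.map_mul, mul_inv_cancel₀ ha0',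
      AddValuation.map_one])
  have : 0 < w₁ (x⁻¹ ^ m) := by
    rw [← div_mul_cancel₀ (x⁻¹ ^ m) ha0', AddValuation.map_mul, add_comm]
    exact add_pos_of_pos_of_nonneg hy hle'
  rw [map_pow_pos_iff _ hm, map_pos_iff_not_inv_nonneg _ hxi, inv_inv] at this
  exact this hx

end Conjugacy

end ACVF

namespace ACVF

/-! ### Value terms as linear functions -/

section Linear

variable {K Γ : Type*} [Field K] [AddCommGroup Γ] [LinearOrder Γ] [IsOrderedAddMonoid Γ]

/-- The field terms `t` for which `v(t)` occurs in a value term. -/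
def ValueTerm.fieldTerms : ValueTerm → List FieldTerm
  | .var _ => []
  | .zero => []
  | .infty => []
  | .neg t => t.fieldTerms
  | .add s t => s.fieldTerms ++ t.fieldTerms
  | .val t => [t]

/-- `f` is a linear function `n ρ + δ` of the last coordinate `ρ` on `P` and `n ρ + δ'` on `P'`,
where `(δ, δ') ∈ Λ`; or it is constantly `∞` on both. -/
def IsLinear (Λ : AddSubgroup (Γ × Γ)) (P P' : Set ((ℕ → K) × (ℕ → WithTop Γ) × Γ))
    (f : (ℕ → K) × (ℕ → WithTop Γ) × Γ → WithTop Γ) : Prop :=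
  ((∀ p ∈ P, f p = ⊤) ∧ ∀ p ∈ P', f p = ⊤) ∨
    ∃ n : ℤ, ∃ l ∈ Λ, (∀ p ∈ P, f p = (n • p.2.2 + l.1 : Γ)) ∧
      ∀ p ∈ P', f p = (n • p.2.2 + l.2 : Γ)

variable {Λ : AddSubgroup (Γ × Γ)} {P P' : Set ((ℕ → K) × (ℕ → WithTop Γ) × Γ)}
  {f f' : (ℕ → K) × (ℕ → WithTop Γ) × Γ → WithTop Γ}

theorem IsLinear.const {c : WithTop Γ} (h : ∀ p ∈ P, f p = c) {c' : WithTop Γ}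
    (h' : ∀ p ∈ P', f p = c')
    (hc : (c = ⊤ ∧ c' = ⊤) ∨ ∃ l ∈ Λ, c = (l.1 : Γ) ∧ c' = (l.2 : Γ)) :
    IsLinear Λ P P' f := by
  rcases hc with ⟨rfl, rfl⟩ | ⟨l, hl, rfl, rfl⟩
  · exact Or.inl ⟨h, h'⟩
  · exact Or.inr ⟨0, l, hl, fun p hp => by simp [h p hp], fun p hp => by simp [h' p hp]⟩

theorem IsLinear.add (h : IsLinear Λ P P' f) (h' : IsLinear Λ P P' f') :
    IsLinear Λ P P' (fun p => f p + f' p) := by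
  rcases h with ⟨h1, h2⟩ | ⟨n, l, hl, h1, h2⟩
  · exact Or.inl ⟨fun p hp => by simp [h1 p hp], fun p hp => by simp [h2 p hp]⟩
  rcases h' with ⟨h1', h2'⟩ | ⟨n', l', hl', h1', h2'⟩
  · exact Or.inl ⟨fun p hp => by simp [h1' p hp], fun p hp => by simp [h2' p hp]⟩
  refine Or.inr ⟨n + n', l + l', Λ.add_mem hl hl', fun p hp => ?_, fun p hp => ?_⟩
  · dsimp only
    rw [h1 p hp, h1' p hp]
    norm_cast
    rw [Prod.fst_add, add_smul]
    abel
  · dsimp only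
    rw [h2 p hp, h2' p hp]
    norm_cast
    rw [Prod.snd_add, add_smul]
    abel

theorem IsLinear.neg (h : IsLinear Λ P P' f) :
    IsLinear Λ P P' (fun p => WithTop.map (fun γ : Γ => -γ) (f p)) := by
  rcases h with ⟨h1, h2⟩ | ⟨n, l, hl, h1, h2⟩
  · exact Or.inl ⟨fun p hp => by simp [h1 p hp], fun p hp => by simp [h2 p hp]⟩
  refine Or.inr ⟨-n, -l, Λ.neg_mem hl, fun p hp => ?_, fun p hp => ?_⟩
  · dsimp only
    rw [h1 p hp, WithTop.map_coe, neg_add, neg_smul, Prod.fst_neg]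
  · dsimp only
    rw [h2 p hp, WithTop.map_coe, neg_add, neg_smul, Prod.snd_neg]

theorem ValueTerm.isLinear {v : AddValuation K (WithTop Γ)} (s : ValueTerm)
    (hf : ∀ t ∈ s.fieldTerms, IsLinear Λ P P' (fun p => v (t.eval p.1)))
    (hv : ∀ n, IsLinear Λ P P' (fun p => p.2.1 n)) :
    IsLinear Λ P P' (fun p => s.eval v p.1 p.2.1) := by
  induction s with
  | var n => exact hv n
  | zero =>
    exact IsLinear.const (c := 0) (c' := 0) (fun p _ => rfl) (fun p _ => rfl)
      (Or.inr ⟨0, Λ.zero_mem, rfl, rfl⟩)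
  | infty =>
    exact IsLinear.const (c := ⊤) (c' := ⊤) (fun p _ => rfl) (fun p _ => rfl)
      (Or.inl ⟨rfl, rfl⟩)
  | neg t ih => exact (ih hf).neg
  | add s t ih ih' =>
    exact (ih fun t ht => hf t (List.mem_append_left _ ht)).add
      (ih' fun t ht => hf t (List.mem_append_right _ ht))
  | val t => exact hf t (by simp [ValueTerm.fieldTerms])

/-- The comparison of two linear functions only depends on the position of `ρ` with respect to a
threshold. -/
theorem IsLinear.exists_threshold (h : IsLinear Λ P P' f) (h' : IsLinear Λ P P' f')
    (hdiv : ∀ (γ : Γ) (m : ℕ), 0 < m → ∃ δ, m • δ = γ)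
    (hΛ : ∀ l ∈ Λ, 0 ≤ l.1 ↔ 0 ≤ l.2) (hΛdiv : ∀ (l : Γ × Γ) (m : ℕ), 0 < m → m • l ∈ Λ → l ∈ Λ) :
    ∃ r ∈ Λ, ∀ p ∈ P, ∀ p' ∈ P', (r.1 ≤ p.2.2 ↔ r.2 ≤ p'.2.2) → (p.2.2 ≤ r.1 ↔ p'.2.2 ≤ r.2) →
      (f p ≤ f' p ↔ f p' ≤ f' p') := by
  have hdiv2 : ∀ l ∈ Λ, ∀ m : ℕ, 0 < m → ∃ r ∈ Λ, m • r.1 = l.1 ∧ m • r.2 = l.2 := by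
    intro l hl m hm
    obtain ⟨a, ha⟩ := hdiv l.1 m hm
    obtain ⟨b, hb⟩ := hdiv l.2 m hm
    refine ⟨(a, b), hΛdiv _ m hm ?_, ha, hb⟩
    rwa [Prod.smul_mk, ha, hb]
  have htop : ∀ γ : Γ, ¬ (⊤ : WithTop Γ) ≤ γ := fun γ => not_le.2 (WithTop.coe_lt_top γ)
  rcases h' with ⟨h1', h2'⟩ | ⟨n', l', hl', h1', h2'⟩
  · exact ⟨0, Λ.zero_mem, fun p hp p' hp' _ _ => by simp [h1' p hp, h2' p' hp']⟩
  rcases h with ⟨h1, h2⟩ | ⟨n, l, hl, h1, h2⟩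
  · refine ⟨0, Λ.zero_mem, fun p hp p' hp' _ _ => ?_⟩
    rw [h1 p hp, h2 p' hp', h1' p hp, h2' p' hp']
    exact iff_of_false (htop _) (htop _)
  have main : ∀ (ρ a b : Γ), n • ρ + a ≤ n' • ρ + b ↔ 0 ≤ (n' - n) • ρ + (b - a) := by
    intro ρ a b
    rw [← sub_nonneg, sub_smul]
    apply iff_of_eq
    congr 1
    abel
  have red : ∀ r ∈ Λ, (∀ ρ ρ' : Γ, (r.1 ≤ ρ ↔ r.2 ≤ ρ') → (ρ ≤ r.1 ↔ ρ' ≤ r.2) →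
      (0 ≤ (n' - n) • ρ + (l' - l).1 ↔ 0 ≤ (n' - n) • ρ' + (l' - l).2)) →
      ∃ r ∈ Λ, ∀ p ∈ P, ∀ p' ∈ P', (r.1 ≤ p.2.2 ↔ r.2 ≤ p'.2.2) →
        (p.2.2 ≤ r.1 ↔ p'.2.2 ≤ r.2) → (f p ≤ f' p ↔ f p' ≤ f' p') := by
    intro r hr h
    refine ⟨r, hr, fun p hp p' hp' a b => ?_⟩
    rw [h1 p hp, h2 p' hp', h1' p hp, h2' p' hp', WithTop.coe_le_coe, WithTop.coe_le_coe, main,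
      main]
    exact h _ _ a b
  have hll := Λ.sub_mem hl' hl
  -- The threshold is the zero of the difference of the two linear functions, which exists in `Λ` by
  -- divisibility. For equal slopes the comparison is between constants and `0` serves as a dummy
  -- threshold.
  rcases lt_trichotomy (n' - n) 0 with hn | hn | hn
  · obtain ⟨m, hm⟩ := Int.eq_ofNat_of_zero_le (neg_nonneg.2 hn.le)
    have hm0 : 0 < m := by omega
    have hnm : n' - n = -(m : ℤ) := by omega
    obtain ⟨r, hr, hr1, hr2⟩ := hdiv2 _ hll m hm0
    refine red r hr fun ρ ρ' _ h => ?_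
    rw [← hr1, ← hr2, hnm, neg_smul, neg_smul, natCast_zsmul, natCast_zsmul, neg_add_eq_sub,
      neg_add_eq_sub, sub_nonneg, sub_nonneg, nsmul_le_nsmul_iff_right hm0.ne',
      nsmul_le_nsmul_iff_right hm0.ne', h]
  · refine red 0 Λ.zero_mem fun ρ ρ' _ _ => ?_
    rw [hn, zero_smul, zero_smul, zero_add, zero_add]
    exact hΛ _ hll
  · obtain ⟨m, hm⟩ := Int.eq_ofNat_of_zero_le hn.le
    have hm0 : 0 < m := by omega
    obtain ⟨r, hr, hr1, hr2⟩ := hdiv2 _ (Λ.neg_mem hll) m hm0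
    refine red r hr fun ρ ρ' h _ => ?_
    rw [Prod.fst_neg] at hr1
    rw [Prod.snd_neg] at hr2
    rw [eq_comm, neg_eq_iff_eq_neg] at hr1 hr2
    rw [hr1, hr2, hm, natCast_zsmul, natCast_zsmul, ← sub_eq_add_neg, ← sub_eq_add_neg,
      sub_nonneg, sub_nonneg, nsmul_le_nsmul_iff_right hm0.ne',
      nsmul_le_nsmul_iff_right hm0.ne', h]

/-- `Λ` is the graph of an order isomorphism between subgroups. So `ρ` either is a listed value and
has an image, or it determines a finite cut, whose image is filled by density and the absence of
endpoints. -/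
theorem exists_same_cut [DenselyOrdered Γ] [Nontrivial Γ] (hΛ : ∀ l ∈ Λ, 0 ≤ l.1 ↔ 0 ≤ l.2)
    {T : Set (Γ × Γ)} (hT : T.Finite) (hTΛ : T ⊆ Λ) (ρ : Γ) :
    ∃ ρ' : Γ, ∀ l ∈ T, (l.1 ≤ ρ ↔ l.2 ≤ ρ') ∧ (ρ ≤ l.1 ↔ ρ' ≤ l.2) := by
  classical
  have hle : ∀ l ∈ Λ, ∀ m ∈ Λ, l.1 ≤ m.1 ↔ l.2 ≤ m.2 := fun l hl m hm => by
    rw [← sub_nonneg, ← Prod.fst_sub, hΛ _ (Λ.sub_mem hm hl), Prod.snd_sub, sub_nonneg]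
  by_cases h : ∃ l ∈ T, l.1 = ρ
  · obtain ⟨l, hl, rfl⟩ := h
    exact ⟨l.2, fun m hm => ⟨hle m (hTΛ hm) l (hTΛ hl), hle l (hTΛ hl) m (hTΛ hm)⟩⟩
  push Not at h
  obtain ⟨ρ', h1, h2⟩ := Order.exists_between_finsets
    ((hT.toFinset.filter fun l => l.1 < ρ).image Prod.snd)
    ((hT.toFinset.filter fun l => ρ < l.1).image Prod.snd) (by
      simp only [Finset.mem_image, Finset.mem_filter, Set.Finite.mem_toFinset]
      rintro _ ⟨l, ⟨hl, hl1⟩, rfl⟩ _ ⟨m, ⟨hm, hm1⟩, rfl⟩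
      rw [← not_le, ← hle m (hTΛ hm) l (hTΛ hl), not_le]
      exact hl1.trans hm1)
  simp only [Finset.mem_image, Finset.mem_filter, Set.Finite.mem_toFinset,
    forall_exists_index, and_imp] at h1 h2
  refine ⟨ρ', fun l hl => ?_⟩
  rcases lt_or_gt_of_ne (h l hl) with hlt | hlt
  · have := h1 _ l hl hlt rfl
    exact ⟨iff_of_true hlt.le this.le, iff_of_false hlt.not_ge this.not_ge⟩
  · have := h2 _ l hl hlt rfl
    exact ⟨iff_of_false hlt.not_ge this.not_ge, iff_of_true hlt.le this.le⟩

end Linear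

/-! ### Assignments with the same quantifier-free type -/

section Sim

variable {K Γ : Type*} [Field K] [AddCommGroup Γ] [LinearOrder Γ] [IsOrderedAddMonoid Γ]
  {v : AddValuation K (WithTop Γ)} {e e' : ℕ → K} {g g' : ℕ → WithTop Γ}

/-- The two assignments have the same quantifier-free type. -/
def Sim (v : AddValuation K (WithTop Γ)) (e : ℕ → K) (g : ℕ → WithTop Γ) (e' : ℕ → K)
    (g' : ℕ → WithTop Γ) : Prop :=
  ∀ s t : ValueTerm, s.eval v e g ≤ t.eval v e g ↔ s.eval v e' g' ≤ t.eval v e' g'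

theorem Sim.symm (h : Sim v e g e' g') : Sim v e' g' e g := fun s t => (h s t).symm

theorem Sim.eq_top_iff (h : Sim v e g e' g') (s : ValueTerm) :
    s.eval v e g = ⊤ ↔ s.eval v e' g' = ⊤ := by
  rw [← top_le_iff, ← top_le_iff]
  exact h .infty s

theorem Sim.eval_eq_zero_iff (h : Sim v e g e' g') (t : FieldTerm) :
    t.eval e = 0 ↔ t.eval e' = 0 := by
  rw [← AddValuation.top_iff v, ← AddValuation.top_iff v]
  exact h.eq_top_iff (.val t)

theorem ValueTerm.exists_nsmul (s : ValueTerm) (n : ℕ) : ∃ t : ValueTerm,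
    (∀ (v : AddValuation K (WithTop Γ)) (e : ℕ → K) (g : ℕ → WithTop Γ),
      t.eval v e g = n • s.eval v e g) := by
  induction n with
  | zero => exact ⟨.zero, fun v e g => by simp [ValueTerm.eval]⟩
  | succ n ih =>
    obtain ⟨t, ht⟩ := ih
    exact ⟨.add t s, fun v e g => by rw [ValueTerm.eval, ht, succ_nsmul]⟩

/-- The divisible closure of the group of pairs of corresponding values. -/
def valuePairs (v : AddValuation K (WithTop Γ)) (e : ℕ → K) (g : ℕ → WithTop Γ) (e' : ℕ → K)
    (g' : ℕ → WithTop Γ) : AddSubgroup (Γ × Γ) where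
  carrier := {l | ∃ s : ValueTerm, ∃ m : ℕ, 0 < m ∧ s.eval v e g = (m • l.1 : Γ) ∧
    s.eval v e' g' = (m • l.2 : Γ)}
  zero_mem' := ⟨.zero, 1, one_pos, by simp [ValueTerm.eval], by simp [ValueTerm.eval]⟩
  add_mem' := by
    rintro l l' ⟨s, m, hm, h1, h2⟩ ⟨s', m', hm', h1', h2'⟩
    obtain ⟨t, ht⟩ := s.exists_nsmul (K := K) (Γ := Γ) m'
    obtain ⟨t', ht'⟩ := s'.exists_nsmul (K := K) (Γ := Γ) m
    refine ⟨.add t t', m * m', Nat.mul_pos hm hm', ?_, ?_⟩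
    · rw [ValueTerm.eval, ht, ht', h1, h1', Prod.fst_add, smul_add, mul_smul, mul_comm, mul_smul]
      norm_cast
      rw [smul_comm m' m, smul_comm m' m]
    · rw [ValueTerm.eval, ht, ht', h2, h2', Prod.snd_add, smul_add, mul_smul, mul_comm, mul_smul]
      norm_cast
      rw [smul_comm m' m, smul_comm m' m]
  neg_mem' := by
    rintro l ⟨s, m, hm, h1, h2⟩
    exact ⟨.neg s, m, hm, by rw [ValueTerm.eval, h1, WithTop.map_coe, Prod.fst_neg, smul_neg],
      by rw [ValueTerm.eval, h2, WithTop.map_coe, Prod.snd_neg, smul_neg]⟩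

theorem mem_valuePairs_of_nsmul_mem (l : Γ × Γ) (m : ℕ) (hm : 0 < m)
    (h : m • l ∈ valuePairs v e g e' g') : l ∈ valuePairs v e g e' g' := by
  obtain ⟨s, k, hk, h1, h2⟩ := h
  exact ⟨s, k * m, Nat.mul_pos hk hm, by rw [h1, mul_smul, Prod.smul_fst],
    by rw [h2, mul_smul, Prod.smul_snd]⟩

theorem Sim.nonneg_iff (h : Sim v e g e' g') : ∀ l ∈ valuePairs v e g e' g', 0 ≤ l.1 ↔ 0 ≤ l.2 := by
  rintro l ⟨s, m, hm, h1, h2⟩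
  have := h .zero s
  rw [h1, h2] at this
  simp only [ValueTerm.eval] at this
  norm_cast at this
  rwa [nsmul_nonneg_iff hm.ne', nsmul_nonneg_iff hm.ne'] at this

theorem Sim.eval_pair (h : Sim v e g e' g') (s : ValueTerm) :
    (s.eval v e g = ⊤ ∧ s.eval v e' g' = ⊤) ∨
      ∃ l ∈ valuePairs v e g e' g', s.eval v e g = (l.1 : Γ) ∧ s.eval v e' g' = (l.2 : Γ) := by
  by_cases hs : s.eval v e g = ⊤
  · exact Or.inl ⟨hs, (h.eq_top_iff s).1 hs⟩
  · have hs' := fun h' => hs ((h.eq_top_iff s).2 h')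
    obtain ⟨a, ha⟩ := WithTop.ne_top_iff_exists.1 hs
    obtain ⟨b, hb⟩ := WithTop.ne_top_iff_exists.1 hs'
    exact Or.inr ⟨(a, b), ⟨s, 1, one_pos, by simp [ha], by simp [hb]⟩, ha.symm, hb.symm⟩

end Sim

end ACVF

namespace ACVF

/-! ### Extending assignments with the same quantifier-free type -/

section Extend

variable {K Γ : Type u} [Field K] [AddCommGroup Γ] [LinearOrder Γ] [IsOrderedAddMonoid Γ]
  {v : AddValuation K (WithTop Γ)} {κ : Cardinal.{u}} {e e' : ℕ → K} {g g' : ℕ → WithTop Γ}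

theorem definableOver_formula (φ : Formula) (e : ℕ → K) (g : ℕ → WithTop Γ) (n : ℕ) :
    DefinableOver v (Set.range e) (Set.range g) {x | φ.Realize v (Function.update e n x) g} := by
  refine ⟨φ.rename (Equiv.swap 0 n) id, e ∘ Equiv.swap 0 n, g, fun i => Or.inr ⟨_, rfl⟩,
    fun i => Or.inr ⟨i, rfl⟩, ?_⟩
  ext x
  rw [Set.mem_ofPred_eq, Set.mem_ofPred_eq,
    Formula.realize_rename v (Equiv.injective _) Function.injective_id]
  refine iff_of_eq (congrArg₂ _ ?_ rfl)
  have : Function.update (e ∘ Equiv.swap 0 n) 0 x =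
      Function.update e n x ∘ Equiv.swap 0 n := by
    rw [← Function.update_comp_eq_of_injective _ (Equiv.injective _), Equiv.swap_apply_left]
  rw [this]
  ext i
  simp

theorem valueDefinableOver_formula (φ : Formula) (e : ℕ → K) (g : ℕ → WithTop Γ) (n : ℕ) :
    ValueDefinableOver v (Set.range e) (Set.range g)
      {x | φ.Realize v e (Function.update g n x)} := by
  refine ⟨φ.rename id (Equiv.swap 0 n), e, g ∘ Equiv.swap 0 n, fun i => Or.inr ⟨i, rfl⟩,
    fun i => Or.inr ⟨_, rfl⟩, ?_⟩
  ext x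
  rw [Set.mem_ofPred_eq, Set.mem_ofPred_eq,
    Formula.realize_rename v Function.injective_id (Equiv.injective _)]
  refine iff_of_eq (congrArg₂ _ rfl ?_)
  have : Function.update (g ∘ Equiv.swap 0 n) 0 x =
      Function.update g n x ∘ Equiv.swap 0 n := by
    rw [← Function.update_comp_eq_of_injective _ (Equiv.injective _), Equiv.swap_apply_left]
  rw [this]
  ext i
  simp

/-- Saturation reduces the extension step to finitely many comparisons at a time. The type `α` is
either sort, so that one argument serves both. -/
theorem exists_sim_of_finite {α : Type*} (F : α → (ℕ → K) × (ℕ → WithTop Γ))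
    (hsat : ∀ 𝒟 : Set (Set α), (∀ D ∈ 𝒟, ∃ φ : Formula, D = {x | φ.Realize v (F x).1 (F x).2}) →
      (∀ 𝓕 ⊆ 𝒟, 𝓕.Finite → (⋂₀ 𝓕).Nonempty) → (⋂₀ 𝒟).Nonempty)
    (h : ∀ L : Set (ValueTerm × ValueTerm), L.Finite → ∃ x, ∀ p ∈ L,
      p.1.eval v e g ≤ p.2.eval v e g ↔
        p.1.eval v (F x).1 (F x).2 ≤ p.2.eval v (F x).1 (F x).2) :
    ∃ x, Sim v e g (F x).1 (F x).2 := by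
  let Z : ValueTerm × ValueTerm → Set α := fun p => {x | p.1.eval v e g ≤ p.2.eval v e g ↔
        p.1.eval v (F x).1 (F x).2 ≤ p.2.eval v (F x).1 (F x).2}
  obtain ⟨x, hx⟩ := hsat (Set.range Z) (by
      rintro _ ⟨p, rfl⟩
      by_cases hp : p.1.eval v e g ≤ p.2.eval v e g
      · exact ⟨.leValue p.1 p.2, by simp [Z, hp, Formula.Realize]⟩
      · exact ⟨.not (.leValue p.1 p.2), by simp [Z, hp, Formula.Realize]⟩) (by
      intro 𝓕 h𝓕 hfin
      have := hfin.to_subtype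
      choose f hf using fun D : 𝓕 => h𝓕 D.2
      obtain ⟨x, hx⟩ := h (Set.range f) (Set.finite_range f)
      refine ⟨x, fun D hD => ?_⟩
      have : x ∈ Z (f ⟨D, hD⟩) := hx _ ⟨⟨D, hD⟩, rfl⟩
      rwa [hf] at this)
  exact ⟨x, fun s t => hx _ ⟨(s, t), rfl⟩⟩

theorem exists_sim_field (hκ : Cardinal.aleph0 ≤ κ) (hsat : IsSaturated κ v)
    (he : (Set.range e').Finite) (hg : (Set.range g').Finite) {e₁ : ℕ → K} {g₁ : ℕ → WithTop Γ}
    (n : ℕ) (h : ∀ L : Set (ValueTerm × ValueTerm), L.Finite → ∃ x : K, ∀ p ∈ L,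
      p.1.eval v e₁ g₁ ≤ p.2.eval v e₁ g₁ ↔
        p.1.eval v (Function.update e' n x) g' ≤ p.2.eval v (Function.update e' n x) g') :
    ∃ x, Sim v e₁ g₁ (Function.update e' n x) g' := by
  refine exists_sim_of_finite (fun x => (Function.update e' n x, g')) (fun 𝒟 h𝒟 => ?_) h
  refine (hsat _ _ ((Cardinal.lt_aleph0_iff_set_finite.2 he).trans_le hκ)
    ((Cardinal.lt_aleph0_iff_set_finite.2 hg).trans_le hκ)).1 𝒟 fun D hD => ?_
  obtain ⟨φ, rfl⟩ := h𝒟 D hD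
  exact definableOver_formula φ e' g' n

theorem exists_sim_value (hκ : Cardinal.aleph0 ≤ κ) (hsat : IsSaturated κ v)
    (he : (Set.range e').Finite) (hg : (Set.range g').Finite) {e₁ : ℕ → K} {g₁ : ℕ → WithTop Γ}
    (n : ℕ) (h : ∀ L : Set (ValueTerm × ValueTerm), L.Finite → ∃ x : WithTop Γ, ∀ p ∈ L,
      p.1.eval v e₁ g₁ ≤ p.2.eval v e₁ g₁ ↔
        p.1.eval v e' (Function.update g' n x) ≤ p.2.eval v e' (Function.update g' n x)) :
    ∃ x, Sim v e₁ g₁ e' (Function.update g' n x) := by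
  refine exists_sim_of_finite (fun x => (e', Function.update g' n x)) (fun 𝒟 h𝒟 => ?_) h
  refine (hsat _ _ ((Cardinal.lt_aleph0_iff_set_finite.2 he).trans_le hκ)
    ((Cardinal.lt_aleph0_iff_set_finite.2 hg).trans_le hκ)).2 𝒟 fun D hD => ?_
  obtain ⟨φ, rfl⟩ := h𝒟 D hD
  exact valueDefinableOver_formula φ e' g' n

theorem finite_range_update {α : Type*} {f : ℕ → α} (hf : (Set.range f).Finite) (n : ℕ) (x : α) :
    (Set.range (Function.update f n x)).Finite := by
  refine (hf.insert x).subset ?_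
  rintro _ ⟨i, rfl⟩
  by_cases hi : i = n
  · subst hi; simp
  · simp [hi]

/-- Finitely many comparisons of linear value terms can be transferred. -/
theorem exists_value_transfer [DenselyOrdered Γ] [Nontrivial Γ]
    (hdiv : ∀ (γ : Γ) (m : ℕ), 0 < m → ∃ δ, m • δ = γ) {Λ : AddSubgroup (Γ × Γ)}
    (hΛ : ∀ l ∈ Λ, 0 ≤ l.1 ↔ 0 ≤ l.2) (hΛdiv : ∀ (l : Γ × Γ) (m : ℕ), 0 < m → m • l ∈ Λ → l ∈ Λ)
    {P P' : Set ((ℕ → K) × (ℕ → WithTop Γ) × Γ)} {L : Set (ValueTerm × ValueTerm)}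
    (hL : L.Finite) {L' : Set (Γ × Γ)} (hL' : L'.Finite) (hL'Λ : L' ⊆ Λ)
    (h1 : ∀ p ∈ L, IsLinear Λ P P' (fun a => p.1.eval v a.1 a.2.1))
    (h2 : ∀ p ∈ L, IsLinear Λ P P' (fun a => p.2.eval v a.1 a.2.1)) (ρ : Γ) :
    ∃ ρ' : Γ, (∀ l ∈ L', (l.1 ≤ ρ ↔ l.2 ≤ ρ') ∧ (ρ ≤ l.1 ↔ ρ' ≤ l.2)) ∧
      ∀ p ∈ L, ∀ a ∈ P, a.2.2 = ρ → ∀ a' ∈ P', a'.2.2 = ρ' →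
      (p.1.eval v a.1 a.2.1 ≤ p.2.eval v a.1 a.2.1 ↔
        p.1.eval v a'.1 a'.2.1 ≤ p.2.eval v a'.1 a'.2.1) := by
  have := hL.to_subtype
  choose r hr hthr using fun p : L =>
    (h1 p p.2).exists_threshold (h2 p p.2) hdiv hΛ hΛdiv
  obtain ⟨ρ', hρ'⟩ := exists_same_cut hΛ ((Set.finite_range r).union hL')
    (Set.union_subset (by rintro _ ⟨p, rfl⟩; exact hr p) hL'Λ) ρ
  refine ⟨ρ', fun l hl => hρ' l (Or.inr hl), fun p hp a ha haρ a' ha' haρ' => ?_⟩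
  have := hρ' _ (Or.inl ⟨⟨p, hp⟩, rfl⟩)
  rw [← haρ, ← haρ'] at this
  exact hthr ⟨p, hp⟩ a ha a' ha' this.1 this.2

theorem Sim.extend_value [DenselyOrdered Γ] [Nontrivial Γ]
    (hdiv : ∀ (γ : Γ) (m : ℕ), 0 < m → ∃ δ, m • δ = γ) (hκ : Cardinal.aleph0 ≤ κ)
    (hsat : IsSaturated κ v) (he : (Set.range e').Finite) (hg : (Set.range g').Finite)
    (h : Sim v e g e' g') (n : ℕ) (β : WithTop Γ) :
    ∃ β', Sim v e (Function.update g n β) e' (Function.update g' n β') := by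
  have hf : ∀ {P P' : Set ((ℕ → K) × (ℕ → WithTop Γ) × Γ)}, (∀ p ∈ P, p.1 = e) →
      (∀ p ∈ P', p.1 = e') → ∀ t : FieldTerm,
      IsLinear (valuePairs v e g e' g') P P' (fun p => v (t.eval p.1)) := fun hP hP' t =>
    IsLinear.const (fun p hp => by rw [hP p hp]; rfl) (fun p hp => by rw [hP' p hp]; rfl)
      (h.eval_pair (.val t))
  refine exists_sim_value hκ hsat he hg n fun L hL => ?_
  induction β using WithTop.recTopCoe with
  | top =>
    -- Every term is constant here; the last coordinate is idle and is given the dummy value `0`.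
    let P : Set ((ℕ → K) × (ℕ → WithTop Γ) × Γ) := {p | p.1 = e ∧ p.2.1 = Function.update g n ⊤}
    let P' : Set ((ℕ → K) × (ℕ → WithTop Γ) × Γ) :=
      {p | p.1 = e' ∧ p.2.1 = Function.update g' n ⊤}
    have hlin : ∀ s : ValueTerm,
        IsLinear (valuePairs v e g e' g') P P' (fun p => s.eval v p.1 p.2.1) := fun s => by
      refine s.isLinear (fun t _ => hf (fun p hp => hp.1) (fun p hp => hp.1) t) fun i => ?_
      by_cases hi : i = n
      · subst hi
        exact IsLinear.const (c := ⊤) (c' := ⊤) (fun p hp => by simp [hp.2])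
          (fun p hp => by simp [hp.2]) (Or.inl ⟨rfl, rfl⟩)
      · exact IsLinear.const (c := g i) (c' := g' i) (fun p hp => by simp [hp.2, hi])
          (fun p hp => by simp [hp.2, hi]) (h.eval_pair (.var i))
    obtain ⟨ρ', -, hρ'⟩ := exists_value_transfer hdiv h.nonneg_iff mem_valuePairs_of_nsmul_mem hL
      Set.finite_empty (Set.empty_subset _) (fun p _ => hlin p.1) (fun p _ => hlin p.2) 0
    exact ⟨⊤, fun p hp => hρ' p hp (e, Function.update g n ⊤, 0) ⟨rfl, rfl⟩ rfl
      (e', Function.update g' n ⊤, ρ') ⟨rfl, rfl⟩ rfl⟩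
  | coe ρ =>
    let P : Set ((ℕ → K) × (ℕ → WithTop Γ) × Γ) :=
      {p | p.1 = e ∧ p.2.1 = Function.update g n p.2.2}
    let P' : Set ((ℕ → K) × (ℕ → WithTop Γ) × Γ) :=
      {p | p.1 = e' ∧ p.2.1 = Function.update g' n p.2.2}
    have hlin : ∀ s : ValueTerm,
        IsLinear (valuePairs v e g e' g') P P' (fun p => s.eval v p.1 p.2.1) := fun s => by
      refine s.isLinear (fun t _ => hf (fun p hp => hp.1) (fun p hp => hp.1) t) fun i => ?_
      by_cases hi : i = n
      · subst hi
        exact Or.inr ⟨1, 0, zero_mem _, fun p hp => by simp [hp.2], fun p hp => by simp [hp.2]⟩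
      · exact IsLinear.const (c := g i) (c' := g' i) (fun p hp => by simp [hp.2, hi])
          (fun p hp => by simp [hp.2, hi]) (h.eval_pair (.var i))
    obtain ⟨ρ', -, hρ'⟩ := exists_value_transfer hdiv h.nonneg_iff mem_valuePairs_of_nsmul_mem hL
      Set.finite_empty (Set.empty_subset _) (fun p _ => hlin p.1) (fun p _ => hlin p.2) ρ
    exact ⟨ρ', fun p hp => hρ' p hp (e, Function.update g n ρ, ρ) ⟨rfl, rfl⟩ rfl
      (e', Function.update g' n ρ', ρ') ⟨rfl, rfl⟩ rfl⟩

end Extend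

end ACVF

namespace ACVF

/-! ### Field terms as polynomials -/

section Polynomials

open Polynomial

variable {K Γ N : Type*} [Field K] [AddCommGroup Γ] [LinearOrder Γ] [IsOrderedAddMonoid Γ]
  {v : AddValuation K (WithTop Γ)} [Field N]

/-- A term of the field sort as a polynomial in the variable `m`. -/
noncomputable def FieldTerm.poly (ε : ℕ → N) (m : ℕ) : FieldTerm → N[X]
  | .var n => if n = m then X else C (ε n)
  | .zero => 0
  | .one => 1
  | .neg t => - t.poly ε m
  | .add s t => s.poly ε m + t.poly ε m
  | .mul s t => s.poly ε m * t.poly ε m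

theorem FieldTerm.eval₂_poly (j : N →+* K) (ε : ℕ → N) (m : ℕ) (x : K) (t : FieldTerm) :
    (t.poly ε m).eval₂ j x = t.eval (Function.update (j ∘ ε) m x) := by
  induction t with
  | var n =>
    by_cases hn : n = m
    · subst hn; simp [FieldTerm.poly, FieldTerm.eval]
    · simp [FieldTerm.poly, FieldTerm.eval, hn]
  | zero => simp [FieldTerm.poly, FieldTerm.eval]
  | one => simp [FieldTerm.poly, FieldTerm.eval]
  | neg t ih => simp [FieldTerm.poly, FieldTerm.eval, ih]
  | add s t ih ih' => simp [FieldTerm.poly, FieldTerm.eval, ih, ih', eval₂_add]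
  | mul s t ih ih' => simp [FieldTerm.poly, FieldTerm.eval, ih, ih', eval₂_mul]

theorem FieldTerm.map_poly {E : Type*} [Field E] (f : E →+* N) (ε : ℕ → E) (m : ℕ)
    (t : FieldTerm) : (t.poly ε m).map f = t.poly (f ∘ ε) m := by
  induction t with
  | var n =>
    by_cases hn : n = m
    · subst hn; simp [FieldTerm.poly]
    · simp [FieldTerm.poly, hn]
  | zero => simp [FieldTerm.poly]
  | one => simp [FieldTerm.poly]
  | neg t ih => simp [FieldTerm.poly, ih]
  | add s t ih ih' => simp [FieldTerm.poly, ih, ih']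
  | mul s t ih ih' => simp [FieldTerm.poly, ih, ih']

theorem map_multiset_prod (v : AddValuation K (WithTop Γ)) {ι : Type*} (s : Multiset ι)
    (f : ι → K) : v (s.map f).prod = (s.map fun i => v (f i)).sum := by
  induction s using Multiset.induction_on with
  | empty => simp [AddValuation.map_one]
  | cons i s ih => simp [AddValuation.map_mul, ih]

theorem map_eval₂_of_splits (v : AddValuation K (WithTop Γ)) (j : N →+* K) {p : N[X]}
    (hp : p.Splits) (x : K) :
    v (p.eval₂ j x) = v (j p.leadingCoeff) + (p.roots.map fun c => v (x - j c)).sum := by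
  conv_lhs => rw [hp.eq_prod_roots]
  rw [eval₂_mul, eval₂_C, AddValuation.map_mul, ← map_multiset_prod, eval₂_multiset_prod,
    Multiset.map_map]
  simp

/-- The assignments of an element `x` at the variable `m` whose distance to `c ∈ C` is `ρ`, if
`c ∉ S`, and the distance of `c` to `c₀`, if `c ∈ S`. -/
def positionSet (v : AddValuation K (WithTop Γ)) (j : N →+* K) (ε : ℕ → N) (m : ℕ)
    (g : ℕ → WithTop Γ) (C : Finset N) (c₀ : N) (S : Finset N) :
    Set ((ℕ → K) × (ℕ → WithTop Γ) × Γ) :=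
  {a | ∃ x, a.1 = Function.update (j ∘ ε) m x ∧ a.2.1 = g ∧
    (∀ c ∈ C, c ∈ S → v (x - j c) = v (j (c₀ - c))) ∧ ∀ c ∈ C, c ∉ S → v (x - j c) = a.2.2}

variable {Λ : AddSubgroup (Γ × Γ)} {j j' : N →+* K} {ε : ℕ → N} {m : ℕ} {g g' : ℕ → WithTop Γ}

/-- Each root in `S` contributes the known distance `v (c₀ - c)` to the constant, and each other
root contributes one copy of `ρ` to the slope. -/
theorem exists_linear_sum_roots
    (hΛ : ∀ y : N, y ≠ 0 → ∃ l ∈ Λ, v (j y) = (l.1 : Γ) ∧ v (j' y) = (l.2 : Γ))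
    {C : Finset N} {c₀ : N} {S : Finset N} (hS : c₀ ∉ S) (R : Multiset N) (hR : ∀ c ∈ R, c ∈ C) :
    ∃ n : ℤ, ∃ l ∈ Λ,
      (∀ a ∈ positionSet v j ε m g C c₀ S,
        (R.map fun c => v (a.1 m - j c)).sum = (n • a.2.2 + l.1 : Γ)) ∧
      ∀ a ∈ positionSet v j' ε m g' C c₀ S,
        (R.map fun c => v (a.1 m - j' c)).sum = (n • a.2.2 + l.2 : Γ) := by
  induction R using Multiset.induction_on with
  | empty => exact ⟨0, 0, Λ.zero_mem, fun a _ => by simp, fun a _ => by simp⟩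
  | cons c R ih =>
    obtain ⟨n, l, hl, h1, h2⟩ := ih fun d hd => hR d (Multiset.mem_cons_of_mem hd)
    have hc := hR c (Multiset.mem_cons_self c R)
    by_cases hcS : c ∈ S
    · obtain ⟨r, hr, hr1, hr2⟩ := hΛ (c₀ - c) (sub_ne_zero.2 fun h => hS (h ▸ hcS))
      refine ⟨n, r + l, Λ.add_mem hr hl, fun a ha => ?_, fun a ha => ?_⟩
      · rw [Multiset.map_cons, Multiset.sum_cons, h1 a ha]
        obtain ⟨x, hx, -, hx1, -⟩ := ha
        rw [hx, Function.update_self, hx1 c hc hcS, hr1]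
        norm_cast
        rw [Prod.fst_add]
        abel
      · rw [Multiset.map_cons, Multiset.sum_cons, h2 a ha]
        obtain ⟨x, hx, -, hx1, -⟩ := ha
        rw [hx, Function.update_self, hx1 c hc hcS, hr2]
        norm_cast
        rw [Prod.snd_add]
        abel
    · refine ⟨n + 1, l, hl, fun a ha => ?_, fun a ha => ?_⟩
      · rw [Multiset.map_cons, Multiset.sum_cons, h1 a ha]
        obtain ⟨x, hx, -, -, hx1⟩ := ha
        rw [hx, Function.update_self, hx1 c hc hcS]
        norm_cast
        rw [add_smul, one_smul]
        abel
      · rw [Multiset.map_cons, Multiset.sum_cons, h2 a ha]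
        obtain ⟨x, hx, -, -, hx1⟩ := ha
        rw [hx, Function.update_self, hx1 c hc hcS]
        norm_cast
        rw [add_smul, one_smul]
        abel

theorem ValueTerm.isLinear_positionSet
    (hΛ : ∀ y : N, y ≠ 0 → ∃ l ∈ Λ, v (j y) = (l.1 : Γ) ∧ v (j' y) = (l.2 : Γ))
    (hg : ∀ n, (g n = ⊤ ∧ g' n = ⊤) ∨ ∃ l ∈ Λ, g n = (l.1 : Γ) ∧ g' n = (l.2 : Γ))
    {C : Finset N} {c₀ : N} {S : Finset N} (hS : c₀ ∉ S) (s : ValueTerm)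
    (hs : ∀ t ∈ s.fieldTerms, t.poly ε m ≠ 0 →
      (t.poly ε m).Splits ∧ ∀ c ∈ (t.poly ε m).roots, c ∈ C) :
    IsLinear Λ (positionSet v j ε m g C c₀ S) (positionSet v j' ε m g' C c₀ S)
      (fun p => s.eval v p.1 p.2.1) := by
  refine s.isLinear (fun t ht => ?_) fun n => ?_
  · by_cases h0 : t.poly ε m = 0
    · refine IsLinear.const (c := ⊤) (c' := ⊤) ?_ ?_ (Or.inl ⟨rfl, rfl⟩)
      all_goals
        rintro a ⟨x, hx, -⟩
        rw [hx, ← FieldTerm.eval₂_poly, h0, eval₂_zero, AddValuation.map_zero]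
    obtain ⟨hsplit, hroots⟩ := hs t ht h0
    have hlead : (t.poly ε m).leadingCoeff ≠ 0 := leadingCoeff_ne_zero.2 h0
    obtain ⟨n, l, hl, h1, h2⟩ :=
      exists_linear_sum_roots (v := v) (ε := ε) (m := m) (g := g) (g' := g') hΛ hS _ hroots
    obtain ⟨r, hr, hr1, hr2⟩ := hΛ _ hlead
    refine Or.inr ⟨n, r + l, Λ.add_mem hr hl, fun a ha => ?_, fun a ha => ?_⟩
    · have h := h1 a ha
      obtain ⟨x, hx, -⟩ := ha
      rw [hx, Function.update_self] at h
      dsimp only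
      rw [hx, ← FieldTerm.eval₂_poly, map_eval₂_of_splits v j hsplit, hr1, h]
      norm_cast
      rw [Prod.fst_add]
      abel
    · have h := h2 a ha
      obtain ⟨x, hx, -⟩ := ha
      rw [hx, Function.update_self] at h
      dsimp only
      rw [hx, ← FieldTerm.eval₂_poly, map_eval₂_of_splits v j' hsplit, hr2, h]
      norm_cast
      rw [Prod.snd_add]
      abel
  · exact IsLinear.const (c := g n) (c' := g' n)
      (by rintro a ⟨x, -, ha, -⟩; rw [ha]) (by rintro a ⟨x, -, ha, -⟩; rw [ha]) (hg n)

end Polynomials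

end ACVF

namespace ACVF

/-! ### Algebraically closed valued fields -/

section AlgClosed

open Polynomial

variable {K Γ : Type*} [Field K] [AddCommGroup Γ] [LinearOrder Γ] [IsOrderedAddMonoid Γ]

theorem exists_nsmul_eq [IsAlgClosed K] {v : AddValuation K (WithTop Γ)}
    (hv : Function.Surjective v) (γ : Γ) (m : ℕ) (hm : 0 < m) : ∃ δ, m • δ = γ := by
  obtain ⟨x, hx⟩ := hv γ
  obtain ⟨y, hy⟩ := IsAlgClosed.exists_pow_nat_eq x hm
  have hy0 : y ≠ 0 := by
    rintro rfl
    rw [zero_pow hm.ne'] at hy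
    rw [← hy, AddValuation.map_zero] at hx
    exact WithTop.top_ne_coe hx
  obtain ⟨δ, hδ⟩ := exists_coe_eq v hy0
  refine ⟨δ, ?_⟩
  rw [← hy, AddValuation.map_pow, hδ] at hx
  exact_mod_cast hx

theorem denselyOrdered_of_isAlgClosed [IsAlgClosed K] {v : AddValuation K (WithTop Γ)}
    (hv : Function.Surjective v) : DenselyOrdered Γ := by
  refine ⟨fun a b hab => ?_⟩
  obtain ⟨δ, hδ⟩ := exists_nsmul_eq hv (b - a) 2 two_pos
  have h0 : 0 < δ := by
    rw [← nsmul_pos_iff (n := 2) two_ne_zero, hδ]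
    exact sub_pos.2 hab
  refine ⟨a + δ, lt_add_of_pos_right a h0, ?_⟩
  have : b = a + (δ + δ) := by rw [← two_nsmul, hδ]; abel
  rw [this, ← add_assoc]
  exact lt_add_of_pos_right _ h0

/-- This is the infinity of the residue field. Take a root `u` of `∏ (X - d) - 1` over `d ∈ D ∪
{0}`: the factors `u - d` are integral with product `1`, so all are units. -/
theorem exists_unit_avoiding [IsAlgClosed K] (v : AddValuation K (WithTop Γ)) (D : Finset K)
    (hD : ∀ d ∈ D, 0 ≤ v d) : ∃ u : K, v u = 0 ∧ ∀ d ∈ D, v (u - d) = 0 := by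
  classical
  set p : K[X] := ∏ d ∈ insert 0 D, (X - C d) with hp
  have hpm : p.Monic := monic_prod_of_monic _ _ fun d _ => monic_X_sub_C d
  have hpd : p.natDegree = (insert 0 D).card := by
    rw [hp, natDegree_prod_of_monic _ _ fun d _ => monic_X_sub_C d]
    simp
  have hcard : 0 < (insert 0 D).card := Finset.card_pos.2 (Finset.insert_nonempty _ _)
  obtain ⟨u, hu⟩ := IsAlgClosed.exists_root (p - 1) (by
    have : (p - 1).degree = p.degree := by
      refine degree_sub_eq_left_of_degree_lt ?_
      rw [degree_one, degree_eq_natDegree hpm.ne_zero, hpd]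
      exact_mod_cast hcard
    rw [this, degree_eq_natDegree hpm.ne_zero, hpd]
    exact_mod_cast hcard.ne')
  have hprod : ∏ d ∈ insert 0 D, (u - d) = 1 := by
    rw [IsRoot, eval_sub, eval_one, sub_eq_zero, hp, eval_prod] at hu
    simpa using hu
  have hD' : ∀ d ∈ insert 0 D, 0 ≤ v d := fun d hd => by
    rcases Finset.mem_insert.1 hd with rfl | hd
    · simp [AddValuation.map_zero]
    · exact hD d hd
  have hneg : ∀ s : Finset K, (∀ d ∈ s, v (u - d) ≤ 0) → v (∏ d ∈ s, (u - d)) ≤ 0 :=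
    fun s hs => Finset.prod_induction _ (fun y => v y ≤ 0) (fun y z hy hz => by
      rw [AddValuation.map_mul]; exact add_nonpos hy hz) (by rw [AddValuation.map_one]) hs
  have hpos : ∀ s : Finset K, (∀ d ∈ s, 0 ≤ v (u - d)) → 0 ≤ v (∏ d ∈ s, (u - d)) :=
    fun s hs => Finset.prod_induction _ (fun y => 0 ≤ v y) (fun y z hy hz => by
      rw [AddValuation.map_mul]; exact add_nonneg hy hz) (by rw [AddValuation.map_one]) hs
  -- If `v u < 0`, all factors have the negative value `v u`, and so has their product. The case
  -- split only isolates the factor at `0`.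
  have hu0 : 0 ≤ v u := by
    by_contra! hlt
    have hd : ∀ d ∈ insert 0 D, v (u - d) = v u := fun d hd =>
      AddValuation.map_sub_eq_of_lt_left v (hlt.trans_le (hD' d hd))
    have h1 := hneg D fun d hd' => (hd d (Finset.mem_insert_of_mem hd')).trans_le hlt.le
    by_cases h0 : (0 : K) ∈ D
    · rw [Finset.insert_eq_of_mem h0, ← Finset.mul_prod_erase _ _ h0] at hprod
      have := congrArg v hprod
      rw [AddValuation.map_mul, AddValuation.map_one, sub_zero] at this
      have h2 := hneg (D.erase 0) fun d hd' =>
        (hd d (Finset.mem_insert_of_mem (Finset.mem_of_mem_erase hd'))).trans_le hlt.le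
      exact (add_neg_of_neg_of_nonpos hlt h2).ne this
    · rw [Finset.prod_insert h0, sub_zero] at hprod
      have := congrArg v hprod
      rw [AddValuation.map_mul, AddValuation.map_one] at this
      exact (add_neg_of_neg_of_nonpos hlt h1).ne this
  have hud : ∀ d ∈ insert 0 D, 0 ≤ v (u - d) := fun d hd =>
    AddValuation.map_le_sub v hu0 (hD' d hd)
  have main : ∀ d ∈ insert 0 D, v (u - d) = 0 := by
    refine fun d hd => le_antisymm (not_lt.1 fun hlt => ?_) (hud d hd)
    have := congrArg v hprod
    rw [← Finset.mul_prod_erase _ _ hd, AddValuation.map_mul, AddValuation.map_one] at this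
    exact (add_pos_of_pos_of_nonneg hlt
      (hpos _ fun d' hd' => hud d' (Finset.mem_of_mem_erase hd'))).ne' this
  exact ⟨u, by simpa using main 0 (Finset.mem_insert_self _ _),
    fun d hd => main d (Finset.mem_insert_of_mem hd)⟩

/-- In the closed ball of radius `ρ` around `a` there is a point at distance `ρ` of finitely many
given points of the ball. -/
theorem exists_generic [IsAlgClosed K] {v : AddValuation K (WithTop Γ)}
    (hv : Function.Surjective v) (a : K) (ρ : Γ) (C : Finset K) :
    ∃ x : K, v (x - a) = ρ ∧ ∀ c ∈ C, (ρ : WithTop Γ) ≤ v (c - a) → v (x - c) = ρ := by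
  classical
  obtain ⟨d, hd⟩ := hv ρ
  have hd0 : d ≠ 0 := by
    rintro rfl
    rw [AddValuation.map_zero] at hd
    exact WithTop.top_ne_coe hd
  have hdiv : ∀ y, v y = v (y / d) + ρ := fun y => by
    rw [← hd, ← AddValuation.map_mul, div_mul_cancel₀ _ hd0]
  obtain ⟨u, hu0, hu⟩ := exists_unit_avoiding v
    ((C.filter fun c => (ρ : WithTop Γ) ≤ v (c - a)).image fun c => (c - a) / d) (by
      intro y hy
      obtain ⟨c, hc, rfl⟩ := Finset.mem_image.1 hy
      have := (Finset.mem_filter.1 hc).2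
      rw [hdiv (c - a)] at this
      by_contra! hlt
      refine this.not_gt ?_
      rw [← zero_add (ρ : WithTop Γ)]
      obtain ⟨γ, hγ⟩ := WithTop.ne_top_iff_exists.1 hlt.ne_top
      rw [← hγ] at hlt ⊢
      norm_cast at hlt ⊢
      simpa using hlt)
  refine ⟨a + d * u, ?_, fun c hc hca => ?_⟩
  · rw [add_sub_cancel_left, AddValuation.map_mul, hu0, add_zero, hd]
  · have := hu ((c - a) / d)
      (Finset.mem_image_of_mem _ (Finset.mem_filter.2 ⟨hc, hca⟩))
    have h : a + d * u - c = d * (u - (c - a) / d) := by field_simp; ring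
    rw [h, AddValuation.map_mul, this, add_zero, hd]

end AlgClosed

/-! ### The field generated by an assignment -/

section GeneratedField

variable {K Γ : Type*} [Field K] [AddCommGroup Γ] [LinearOrder Γ] [IsOrderedAddMonoid Γ]
  {v : AddValuation K (WithTop Γ)} {e e' : ℕ → K} {g g' : ℕ → WithTop Γ}

theorem exists_fieldTerm (p : MvPolynomial ℕ ℤ) : ∃ t : FieldTerm, ∀ e : ℕ → K,
    MvPolynomial.eval₂ (Int.castRingHom K) e p = t.eval e := by
  induction p using MvPolynomial.induction_on with
  | C n =>
    induction n using Int.induction_on with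
    | zero => exact ⟨.zero, fun e => by simp [FieldTerm.eval]⟩
    | succ n ih =>
      obtain ⟨t, ht⟩ := ih
      refine ⟨.add t .one, fun e => ?_⟩
      rw [FieldTerm.eval, ← ht e]
      simp [FieldTerm.eval]
    | pred n ih =>
      obtain ⟨t, ht⟩ := ih
      refine ⟨.add t (.neg .one), fun e => ?_⟩
      rw [FieldTerm.eval, ← ht e]
      simp [FieldTerm.eval, sub_eq_add_neg]
  | add p q ihp ihq =>
    obtain ⟨s, hs⟩ := ihp
    obtain ⟨t, ht⟩ := ihq
    exact ⟨.add s t, fun e => by simp [FieldTerm.eval, hs, ht]⟩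
  | mul_X p n ih =>
    obtain ⟨t, ht⟩ := ih
    exact ⟨.mul t (.var n), fun e => by simp [FieldTerm.eval, ht]⟩

/-- Both assignments satisfy the same polynomial equations over `ℤ`, so the fields they generate are
two embeddings in `K` of one fraction field. -/
theorem Sim.exists_field (h : Sim v e g e' g') :
    ∃ (E : Type) (_ : Field E) (i i' : E →+* K) (ε : ℕ → E), i ∘ ε = e ∧ i' ∘ ε = e' ∧
      ∀ x : E, x ≠ 0 → ∃ l ∈ valuePairs v e g e' g', v (i x) = (l.1 : Γ) ∧ v (i' x) = (l.2 : Γ) := by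
  set φ : MvPolynomial ℕ ℤ →+* K := MvPolynomial.eval₂Hom (Int.castRingHom K) e with hφ
  set φ' : MvPolynomial ℕ ℤ →+* K := MvPolynomial.eval₂Hom (Int.castRingHom K) e' with hφ'
  set I := RingHom.ker φ with hI
  have hker : ∀ p, φ p = 0 ↔ φ' p = 0 := fun p => by
    obtain ⟨t, ht⟩ := exists_fieldTerm (K := K) p
    simp only [hφ, hφ', MvPolynomial.coe_eval₂Hom, ht]
    exact h.eval_eq_zero_iff t
  have hprime : I.IsPrime := RingHom.ker_isPrime φ
  let ψ : MvPolynomial ℕ ℤ ⧸ I →+* K := Ideal.Quotient.lift I φ fun a ha => ha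
  let ψ' : MvPolynomial ℕ ℤ ⧸ I →+* K := Ideal.Quotient.lift I φ' fun a ha => (hker a).1 ha
  have hψ : Function.Injective ψ := by
    rw [injective_iff_map_eq_zero]
    intro a ha
    obtain ⟨a, rfl⟩ := Ideal.Quotient.mk_surjective a
    have ha' : φ a = 0 := ha
    exact Ideal.Quotient.eq_zero_iff_mem.2 ha'
  have hψ' : Function.Injective ψ' := by
    rw [injective_iff_map_eq_zero]
    intro a ha
    obtain ⟨a, rfl⟩ := Ideal.Quotient.mk_surjective a
    have ha' : φ' a = 0 := ha
    exact Ideal.Quotient.eq_zero_iff_mem.2 ((hker a).2 ha')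
  let i : FractionRing (MvPolynomial ℕ ℤ ⧸ I) →+* K := IsFractionRing.lift hψ
  let i' : FractionRing (MvPolynomial ℕ ℤ ⧸ I) →+* K := IsFractionRing.lift hψ'
  have hi : ∀ p, i (algebraMap _ _ (Ideal.Quotient.mk I p)) = φ p := fun p => by
    simp only [i, IsFractionRing.lift_algebraMap]
    rfl
  have hi' : ∀ p, i' (algebraMap _ _ (Ideal.Quotient.mk I p)) = φ' p := fun p => by
    simp only [i', IsFractionRing.lift_algebraMap]
    rfl
  refine ⟨FractionRing (MvPolynomial ℕ ℤ ⧸ I), inferInstance, i, i',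
    fun n => algebraMap _ _ (Ideal.Quotient.mk I (MvPolynomial.X n)), ?_, ?_, fun x hx => ?_⟩
  · ext n
    simp [hi, hφ]
  · ext n
    simp [hi', hφ']
  have hpair : ∀ a : MvPolynomial ℕ ℤ ⧸ I, a ≠ 0 → ∃ l ∈ valuePairs v e g e' g',
      v (i (algebraMap _ _ a)) = (l.1 : Γ) ∧ v (i' (algebraMap _ _ a)) = (l.2 : Γ) := by
    intro a ha
    obtain ⟨p, rfl⟩ := Ideal.Quotient.mk_surjective a
    have hp : φ p ≠ 0 := fun hp => ha (Ideal.Quotient.eq_zero_iff_mem.2 hp)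
    rw [hi, hi']
    obtain ⟨t, ht⟩ := exists_fieldTerm (K := K) p
    have h1 : φ p = t.eval e := ht e
    have h2 : φ' p = t.eval e' := ht e'
    rw [h1] at hp ⊢
    rw [h2]
    exact (h.eval_pair (.val t)).resolve_left fun h' => (AddValuation.ne_top_iff v).2 hp h'.1
  obtain ⟨a, b, hb, rfl⟩ := IsFractionRing.div_surjective (A := MvPolynomial ℕ ℤ ⧸ I) x
  have hb0 : b ≠ 0 := nonZeroDivisors.ne_zero hb
  have ha0 : a ≠ 0 := by
    rintro rfl
    simp at hx
  obtain ⟨l, hl, hl1, hl2⟩ := hpair a ha0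
  obtain ⟨r, hr, hr1, hr2⟩ := hpair b hb0
  refine ⟨l - r, sub_mem hl hr, ?_, ?_⟩
  · rw [map_div₀, AddValuation.map_div, hl1, hr1, Prod.fst_sub]
    rfl
  · rw [map_div₀, AddValuation.map_div, hl2, hr2, Prod.snd_sub]
    rfl

end GeneratedField

end ACVF

namespace ACVF

/-! ### Extending assignments by field elements -/

section ExtendField

open Polynomial

theorem exists_ringHom_extension {K E N : Type*} [Field K] [IsAlgClosed K] [Field E] [Field N]
    [Algebra E N] [Algebra.IsAlgebraic E N] (i : E →+* K) :
    ∃ j : N →+* K, ∀ a, j (algebraMap E N a) = i a := by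
  let := i.toAlgebra
  exact ⟨(IsAlgClosed.lift : N →ₐ[E] K).toRingHom,
    fun a => (IsAlgClosed.lift : N →ₐ[E] K).commutes a⟩

/-- Extend both embeddings arbitrarily, then correct the second by an automorphism that matches the
valuation rings. The valuation ring determines the order of values, and some power of `y` has the
value of an element of the base, so the pair of values of `y` lies in the divisible group `Λ`. -/
theorem exists_valued_extension {K Γ : Type*} [Field K] [IsAlgClosed K] [AddCommGroup Γ]
    [LinearOrder Γ] [IsOrderedAddMonoid Γ] {v : AddValuation K (WithTop Γ)} {E N : Type*} [Field E]
    [Field N] [Algebra E N] [FiniteDimensional E N] [Normal E N] (i i' : E →+* K)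
    {Λ : AddSubgroup (Γ × Γ)} (hΛ : ∀ l ∈ Λ, 0 ≤ l.1 ↔ 0 ≤ l.2)
    (hΛdiv : ∀ (l : Γ × Γ) (m : ℕ), 0 < m → m • l ∈ Λ → l ∈ Λ)
    (hi : ∀ x : E, x ≠ 0 → ∃ l ∈ Λ, v (i x) = (l.1 : Γ) ∧ v (i' x) = (l.2 : Γ)) :
    ∃ j j' : N →+* K, (∀ a, j (algebraMap E N a) = i a) ∧ (∀ a, j' (algebraMap E N a) = i' a) ∧
      ∀ y : N, y ≠ 0 → ∃ l ∈ Λ, v (j y) = (l.1 : Γ) ∧ v (j' y) = (l.2 : Γ) := by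
  obtain ⟨j, hj⟩ := exists_ringHom_extension (N := N) i
  obtain ⟨j₀, hj₀⟩ := exists_ringHom_extension (N := N) i'
  obtain ⟨σ, hσ⟩ := exists_conjugate (E := E) (v.comap j) (v.comap j₀) (fun a => by
    change 0 ≤ v (j _) ↔ 0 ≤ v (j₀ _)
    rw [hj, hj₀]
    by_cases ha : a = 0
    · simp [ha, AddValuation.map_zero]
    obtain ⟨l, hl, h1, h2⟩ := hi a ha
    rw [h1, h2]
    exact_mod_cast hΛ l hl)
  have hσ' : ∀ x, 0 ≤ v (j x) ↔ 0 ≤ v (j₀ (σ x)) := hσ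
  refine ⟨j, j₀.comp (σ : N →+* N), hj, fun a => ?_, fun y hy => ?_⟩
  · rw [RingHom.comp_apply, ← hj₀]
    congr 1
    exact AlgEquiv.commutes σ a
  change ∃ l ∈ Λ, v (j y) = (l.1 : Γ) ∧ v (j₀ (σ y)) = (l.2 : Γ)
  obtain ⟨m, hm, a, ha, hya⟩ := exists_pow_map_eq (E := E) (v.comap j) hy
    (Algebra.IsAlgebraic.isAlgebraic y)
  have hya1 : v (j (y ^ m)) = v (i a) := by
    rw [← hj]
    exact hya
  have haN : algebraMap E N a ≠ 0 := (_root_.map_ne_zero _).2 ha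
  obtain ⟨l, hl, hl1, hl2⟩ := hi a ha
  obtain ⟨γ, hγ⟩ := exists_coe_eq v ((_root_.map_ne_zero j).2 hy)
  obtain ⟨γ', hγ'⟩ := exists_coe_eq v ((_root_.map_ne_zero j₀).2 ((_root_.map_ne_zero σ).2 hy))
  have hle : ∀ x z : N, z ≠ 0 → (v (j z) ≤ v (j x) ↔ v (j₀ (σ z)) ≤ v (j₀ (σ x))) := by
    intro x z hz
    have key : ∀ (f : N →+* K), v (f z) ≤ v (f x) ↔ 0 ≤ v (f (x / z)) := fun f => by
      have hx : v (f x) = v (f (x / z)) + v (f z) := by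
        rw [← AddValuation.map_mul, ← map_mul, div_mul_cancel₀ _ hz]
      obtain ⟨c, hc⟩ := exists_coe_eq v ((_root_.map_ne_zero f).2 hz)
      by_cases hxz : f (x / z) = 0
      · simp [hx, hxz, AddValuation.map_zero]
      obtain ⟨d, hd⟩ := exists_coe_eq v hxz
      rw [hx, hc, hd]
      norm_cast
      simp
    rw [key j, hσ']
    exact (key (j₀.comp (σ : N →+* N))).symm
  have hya2 : v (j₀ (σ (y ^ m))) = v (i' a) := by
    have h1 := hle (y ^ m) (algebraMap E N a) haN
    have h2 := hle (algebraMap E N a) (y ^ m) (pow_ne_zero m hy)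
    rw [AlgEquiv.commutes, hj, hj₀, hya1] at h1 h2
    exact le_antisymm (h2.1 le_rfl) (h1.1 le_rfl)
  refine ⟨(γ, γ'), hΛdiv _ m hm ?_, hγ, hγ'⟩
  rw [map_pow, AddValuation.map_pow, hγ, hl1] at hya1
  rw [map_pow, map_pow, AddValuation.map_pow, hγ', hl2] at hya2
  have h1 : m • γ = l.1 := by exact_mod_cast hya1
  have h2 : m • γ' = l.2 := by exact_mod_cast hya2
  rw [Prod.smul_mk, h1, h2]
  exact hl

variable {K Γ : Type u} [Field K] [AddCommGroup Γ] [LinearOrder Γ] [IsOrderedAddMonoid Γ]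
  {v : AddValuation K (WithTop Γ)} {κ : Cardinal.{u}} {e e' : ℕ → K} {g g' : ℕ → WithTop Γ}

theorem Sim.exists_splitting (h : Sim v e g e' g') [IsAlgClosed K] (m : ℕ)
    {T : Set FieldTerm} (hT : T.Finite) :
    ∃ (N : Type) (_ : Field N) (j j' : N →+* K) (ε : ℕ → N) (C : Finset N), j ∘ ε = e ∧
      j' ∘ ε = e' ∧ 0 ∈ C ∧
      (∀ y : N, y ≠ 0 → ∃ l ∈ valuePairs v e g e' g', v (j y) = (l.1 : Γ) ∧
        v (j' y) = (l.2 : Γ)) ∧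
      ∀ t ∈ T, t.poly ε m ≠ 0 → (t.poly ε m).Splits ∧ ∀ c ∈ (t.poly ε m).roots, c ∈ C := by
  classical
  obtain ⟨E, _, i, i', ε, hi, hi', hpair⟩ := h.exists_field
  -- The factor `X` puts `0` among the roots, so that a nearest root always exists.
  set q : E[X] := X * ∏ p ∈ (hT.toFinset.image fun t => t.poly ε m).erase 0, p with hq
  have hq0 : q ≠ 0 := mul_ne_zero X_ne_zero
    (Finset.prod_ne_zero_iff.2 fun p hp => Finset.ne_of_mem_erase hp)
  have : Normal E q.SplittingField := Normal.of_isSplittingField q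
  obtain ⟨j, j', hj, hj', hjj⟩ := exists_valued_extension (N := q.SplittingField) i i'
    h.nonneg_iff mem_valuePairs_of_nsmul_mem hpair
  have hqsplit := SplittingField.splits q
  have hqm0 : q.map (algebraMap E q.SplittingField) ≠ 0 :=
    (Polynomial.map_ne_zero_iff (algebraMap E q.SplittingField).injective).2 hq0
  refine ⟨q.SplittingField, inferInstance, j, j', algebraMap E _ ∘ ε,
    (q.map (algebraMap E q.SplittingField)).roots.toFinset, ?_, ?_, ?_, hjj, fun t ht ht0 => ?_⟩
  · rw [← hi]
    ext n
    exact hj _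
  · rw [← hi']
    ext n
    exact hj' _
  · rw [Multiset.mem_toFinset, mem_roots hqm0, IsRoot, hq]
    simp
  · have hdvd : t.poly (algebraMap E q.SplittingField ∘ ε) m ∣ q.map (algebraMap E _) := by
      rw [← FieldTerm.map_poly]
      refine Polynomial.map_dvd _ (Dvd.dvd.mul_left (Finset.dvd_prod_of_mem (fun p => p) ?_) _)
      refine Finset.mem_erase.2 ⟨fun h0 => ht0 ?_,
        Finset.mem_image_of_mem _ (hT.mem_toFinset.2 ht)⟩
      rw [← FieldTerm.map_poly, h0, Polynomial.map_zero]
    refine ⟨hqsplit.of_dvd hqm0 hdvd, fun c hc => ?_⟩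
    rw [Multiset.mem_toFinset, mem_roots hqm0]
    exact (isRoot_of_mem_roots hc).dvd hdvd

/-- A root is sent to the corresponding root. Otherwise let `c₀` be a nearest root, at distance `ρ`:
the roots in `S` are those whose distance to `c₀` is coarser than `ρ`, and every other root is at
distance exactly `ρ` from `b`. A matching `ρ'` and a generic point of the closed ball of radius `ρ'`
around the image of `c₀` reproduce this position. -/
theorem Sim.extend_field [IsAlgClosed K] [Nontrivial Γ] (hv : Function.Surjective v)
    (hκ : Cardinal.aleph0 ≤ κ)
    (hsat : IsSaturated κ v) (he : (Set.range e').Finite) (hg : (Set.range g').Finite)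
    (h : Sim v e g e' g') (m : ℕ) (b : K) :
    ∃ b', Sim v (Function.update e m b) g (Function.update e' m b') g' := by
  classical
  have hdense := denselyOrdered_of_isAlgClosed hv
  have hdiv := exists_nsmul_eq hv
  refine exists_sim_field hκ hsat he hg m fun L hL => ?_
  set T : Set FieldTerm := ⋃ p ∈ L, {t | t ∈ p.1.fieldTerms ++ p.2.fieldTerms} with hTdef
  have hT : T.Finite := hL.biUnion fun p _ => List.finite_toSet _
  obtain ⟨N, _, j, j', ε, C, rfl, rfl, hC0, hjj, hroots⟩ := h.exists_splitting m hT
  have hT1 : ∀ p ∈ L, ∀ t ∈ p.1.fieldTerms, t ∈ T := fun p hp t ht =>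
    Set.mem_biUnion hp (show t ∈ _ ++ _ from List.mem_append_left _ ht)
  have hT2 : ∀ p ∈ L, ∀ t ∈ p.2.fieldTerms, t ∈ T := fun p hp t ht =>
    Set.mem_biUnion hp (show t ∈ _ ++ _ from List.mem_append_right _ ht)
  have hgg : ∀ n, (g n = ⊤ ∧ g' n = ⊤) ∨ ∃ l ∈ valuePairs v (j ∘ ε) g (j' ∘ ε) g',
    g n = (l.1 : Γ) ∧ g' n = (l.2 : Γ) := fun n => h.eval_pair (.var n)
  by_cases hbC : ∃ c ∈ C, j c = b
  · obtain ⟨c, -, rfl⟩ := hbC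
    let P : Set ((ℕ → K) × (ℕ → WithTop Γ) × Γ) :=
      {p | p.1 = Function.update (j ∘ ε) m (j c) ∧ p.2.1 = g}
    let P' : Set ((ℕ → K) × (ℕ → WithTop Γ) × Γ) :=
      {p | p.1 = Function.update (j' ∘ ε) m (j' c) ∧ p.2.1 = g'}
    have hlin : ∀ s : ValueTerm, IsLinear (valuePairs v (j ∘ ε) g (j' ∘ ε) g') P P'
        (fun p => s.eval v p.1 p.2.1) := fun s => by
      refine s.isLinear (fun t _ => ?_) fun n => ?_
      · refine IsLinear.const (c := v (j ((t.poly ε m).eval c)))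
          (c' := v (j' ((t.poly ε m).eval c))) ?_ ?_ ?_
        · intro p hp
          rw [hp.1, ← FieldTerm.eval₂_poly, Polynomial.eval₂_at_apply]
        · intro p hp
          rw [hp.1, ← FieldTerm.eval₂_poly, Polynomial.eval₂_at_apply]
        · by_cases h0 : (t.poly ε m).eval c = 0
          · exact Or.inl (by simp [h0, AddValuation.map_zero])
          · exact Or.inr (hjj _ h0)
      · exact IsLinear.const (c := g n) (c' := g' n) (fun p hp => by rw [hp.2])
          (fun p hp => by rw [hp.2]) (hgg n)
    obtain ⟨ρ', -, hρ'⟩ := exists_value_transfer hdiv h.nonneg_iff mem_valuePairs_of_nsmul_mem hL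
      Set.finite_empty (Set.empty_subset _) (fun p _ => hlin p.1) (fun p _ => hlin p.2) 0
    exact ⟨j' c, fun p hp => hρ' p hp (Function.update (j ∘ ε) m (j c), g, 0) ⟨rfl, rfl⟩ rfl
      (Function.update (j' ∘ ε) m (j' c), g', ρ') ⟨rfl, rfl⟩ rfl⟩
  push Not at hbC
  obtain ⟨c₀, hc₀, hmax⟩ := C.exists_max_image (fun c => v (b - j c)) ⟨0, hC0⟩
  obtain ⟨ρ, hρ⟩ := exists_coe_eq v (sub_ne_zero.2 (hbC c₀ hc₀).symm)
  set S : Finset N := C.filter fun c => v (j (c₀ - c)) < ρ with hS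
  have hc₀S : c₀ ∉ S := by simp [hS, AddValuation.map_zero]
  have hb1 : ∀ c ∈ C, c ∈ S → v (b - j c) = v (j (c₀ - c)) := fun c hc hcS => by
    have hlt : v (j (c₀ - c)) < v (b - j c₀) := hρ ▸ (Finset.mem_filter.1 hcS).2
    have : b - j c = j (c₀ - c) + (b - j c₀) := by rw [map_sub]; ring
    rw [this, AddValuation.map_add_eq_of_lt_left v hlt]
  have hb2 : ∀ c ∈ C, c ∉ S → v (b - j c) = ρ := fun c hc hcS => by
    refine le_antisymm (hρ ▸ hmax c hc) ?_
    have hle : (ρ : WithTop Γ) ≤ v (j (c₀ - c)) :=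
      not_lt.1 fun hlt => hcS (Finset.mem_filter.2 ⟨hc, hlt⟩)
    have : b - j c = j (c₀ - c) + (b - j c₀) := by rw [map_sub]; ring
    rw [this]
    exact AddValuation.map_le_add v hle hρ.ge
  choose! l hl hl1 hl2 using hjj
  have hlin : ∀ s : ValueTerm, (∀ t ∈ s.fieldTerms, t ∈ T) →
      IsLinear (valuePairs v (j ∘ ε) g (j' ∘ ε) g') (positionSet v j ε m g C c₀ S)
        (positionSet v j' ε m g' C c₀ S) (fun p => s.eval v p.1 p.2.1) := fun s hs =>
    s.isLinear_positionSet (fun y hy => ⟨l y, hl y hy, hl1 y hy, hl2 y hy⟩) hgg hc₀S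
      fun t ht => hroots t (hs t ht)
  -- The pairs in `L'` keep `ρ'` on the same side of the distances between roots, so that `S` has
  -- the same meaning on both sides. Here `c = c₀` is left out because its distance is `∞`.
  obtain ⟨ρ', hcut, hρ'⟩ := exists_value_transfer hdiv h.nonneg_iff mem_valuePairs_of_nsmul_mem hL
    (L' := (fun c => l (c₀ - c)) '' {c | c ∈ C ∧ c ≠ c₀})
    ((C.finite_toSet.subset fun c hc => hc.1).image _)
    (by rintro _ ⟨c, hc, rfl⟩; exact hl _ (sub_ne_zero.2 hc.2.symm))
    (fun p hp => hlin p.1 (hT1 p hp)) (fun p hp => hlin p.2 (hT2 p hp)) ρ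
  have hS' : ∀ c ∈ C, c ∈ S ↔ v (j' (c₀ - c)) < ρ' := fun c hc => by
    by_cases hcc : c = c₀
    · subst hcc
      simp [hc₀S, AddValuation.map_zero]
    · have hne : c₀ - c ≠ 0 := sub_ne_zero.2 (Ne.symm hcc)
      have := (hcut _ ⟨c, ⟨hc, hcc⟩, rfl⟩).2
      rw [hS, Finset.mem_filter, and_iff_right hc, hl1 _ hne, hl2 _ hne, ← not_le, ← not_le]
      exact_mod_cast not_congr this
  obtain ⟨b', hb', hgen⟩ := exists_generic hv (j' c₀) ρ' (C.image j')
  refine ⟨b', fun p hp => hρ' p hp (_, g, ρ) ⟨b, rfl, rfl, hb1, hb2⟩ rfl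
    (_, g', ρ') ⟨b', rfl, rfl, fun c hc hcS => ?_, fun c hc hcS => ?_⟩ rfl⟩
  · have hlt : v (j' (c₀ - c)) < v (b' - j' c₀) := hb' ▸ (hS' c hc).1 hcS
    have : b' - j' c = j' (c₀ - c) + (b' - j' c₀) := by rw [map_sub]; ring
    rw [this, AddValuation.map_add_eq_of_lt_left v hlt]
  · refine hgen _ (Finset.mem_image_of_mem _ hc) ?_
    rw [← map_sub, ← neg_sub, map_neg, AddValuation.map_neg]
    exact not_lt.1 fun hlt => hcS ((hS' c hc).2 hlt)

/-- Back-and-forth: a quantifier is handled by extending the similarity to a witness, in either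
direction. Assignments of finite range suffice for saturation and are preserved by the extension. -/
theorem Sim.realize_iff [IsAlgClosed K] [Nontrivial Γ] (hv : Function.Surjective v)
    (hκ : Cardinal.aleph0 ≤ κ) (hsat : IsSaturated κ v) (φ : Formula) {e e' : ℕ → K}
    {g g' : ℕ → WithTop Γ} (he : (Set.range e).Finite) (hg : (Set.range g).Finite)
    (he' : (Set.range e').Finite) (hg' : (Set.range g').Finite) (h : Sim v e g e' g') :
    φ.Realize v e g ↔ φ.Realize v e' g' := by
  have hdense := denselyOrdered_of_isAlgClosed hv
  have hdiv := exists_nsmul_eq hv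
  induction φ generalizing e e' g g' with
  | eqField s t =>
    have := h.eval_eq_zero_iff (.add s (.neg t))
    simpa [Formula.Realize, FieldTerm.eval, ← sub_eq_add_neg, sub_eq_zero] using this
  | eqValue s t => simp [Formula.Realize, le_antisymm_iff, h s t, h t s]
  | leValue s t => exact h s t
  | not φ ih => exact not_congr (ih he hg he' hg' h)
  | and φ ψ ih ih' => exact and_congr (ih he hg he' hg' h) (ih' he hg he' hg' h)
  | exField n φ ih =>
    constructor
    · rintro ⟨b, hb⟩
      obtain ⟨b', hb'⟩ := h.extend_field hv hκ hsat he' hg' n b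
      exact ⟨b', (ih (finite_range_update he n b) hg (finite_range_update he' n b') hg' hb').1 hb⟩
    · rintro ⟨b, hb⟩
      obtain ⟨b', hb'⟩ := h.symm.extend_field hv hκ hsat he hg n b
      exact ⟨b', (ih (finite_range_update he' n b) hg' (finite_range_update he n b') hg hb').1 hb⟩
  | exValue n φ ih =>
    constructor
    · rintro ⟨b, hb⟩
      obtain ⟨b', hb'⟩ := h.extend_value hdiv hκ hsat he' hg' n b
      exact ⟨b', (ih he (finite_range_update hg n b) he' (finite_range_update hg' n b') hb').1 hb⟩
    · rintro ⟨b, hb⟩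
      obtain ⟨b', hb'⟩ := h.symm.extend_value hdiv hκ hsat he hg n b
      exact ⟨b', (ih he' (finite_range_update hg' n b) he (finite_range_update hg n b') hb').1 hb⟩

end ExtendField

end ACVF

namespace ACVF

/-! ### Definable sets are finite unions of cells -/

section Tame

variable {K Γ : Type*} [Field K] [AddCommGroup Γ] [LinearOrder Γ] [IsOrderedAddMonoid Γ]
  {v : AddValuation K (WithTop Γ)}

/-- The values `v(x - c)` and `v(y - c)`, for `c ∈ C`, compare in the same way with each
`r ∈ F`. -/
def SameCell (v : AddValuation K (WithTop Γ)) (C : Finset K) (F : Finset (WithTop Γ))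
    (x y : K) : Prop :=
  ∀ c ∈ C, ∀ r ∈ F, (r ≤ v (x - c) ↔ r ≤ v (y - c)) ∧ (v (x - c) ≤ r ↔ v (y - c) ≤ r)

/-- `D` is a union of cells for some finite sets of centers and radii; that is, a finite Boolean
combination of balls. -/
def Tame (v : AddValuation K (WithTop Γ)) (D : Set K) : Prop :=
  ∃ (C : Finset K) (F : Finset (WithTop Γ)), ∀ x y, SameCell v C F x y → x ∈ D → y ∈ D

theorem SameCell.symm {C : Finset K} {F : Finset (WithTop Γ)} {x y : K}
    (h : SameCell v C F x y) : SameCell v C F y x :=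
  fun c hc r hr => ⟨(h c hc r hr).1.symm, (h c hc r hr).2.symm⟩

theorem SameCell.mono {C C' : Finset K} {F F' : Finset (WithTop Γ)} {x y : K}
    (h : SameCell v C F x y) (hC : C' ⊆ C) (hF : F' ⊆ F) : SameCell v C' F' x y :=
  fun c hc r hr => h c (hC hc) r (hF hr)

theorem Tame.compl {D : Set K} (h : Tame v D) : Tame v Dᶜ := by
  obtain ⟨C, F, h⟩ := h
  exact ⟨C, F, fun x y hxy hx hy => hx (h y x hxy.symm hy)⟩

theorem Tame.inter {D D' : Set K} (h : Tame v D) (h' : Tame v D') : Tame v (D ∩ D') := by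
  classical
  obtain ⟨C, F, h⟩ := h
  obtain ⟨C', F', h'⟩ := h'
  exact ⟨C ∪ C', F ∪ F', fun x y hxy hx =>
    ⟨h x y (hxy.mono Finset.subset_union_left Finset.subset_union_left) hx.1,
      h' x y (hxy.mono Finset.subset_union_right Finset.subset_union_right) hx.2⟩⟩

theorem Tame.sInter {𝓕 : Set (Set K)} (hf : 𝓕.Finite) (h : ∀ D ∈ 𝓕, Tame v D) :
    Tame v (⋂₀ 𝓕) := by
  induction 𝓕, hf using Set.Finite.induction_on with
  | empty => exact ⟨∅, ∅, fun _ _ _ _ => by simp⟩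
  | insert _ _ ih =>
    rw [Set.sInter_insert]
    exact (h _ (Set.mem_insert _ _)).inter (ih fun D hD => h D (Set.mem_insert_of_mem _ hD))

/-- The machinery of the extension step applies with both embeddings the identity and `Λ` the
diagonal: for a fixed nearest root `c₀` and set `S`, the truth of the inequality depends only on the
side of one threshold on which the distance to `c₀` lies. -/
theorem tame_atomic [IsAlgClosed K] (hv : Function.Surjective v) (s t : ValueTerm)
    (e : ℕ → K) (g : ℕ → WithTop Γ) (m : ℕ) :
    Tame v {x | s.eval v (Function.update e m x) g ≤ t.eval v (Function.update e m x) g} := by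
  classical
  have hdiv := exists_nsmul_eq hv
  set Λ : AddSubgroup (Γ × Γ) := (AddMonoidHom.fst Γ Γ).eqLocus (AddMonoidHom.snd Γ Γ) with hΛdef
  have hmem : ∀ l : Γ × Γ, l ∈ Λ ↔ l.1 = l.2 := fun l => Iff.rfl
  have hΛ : ∀ l ∈ Λ, 0 ≤ l.1 ↔ 0 ≤ l.2 := fun l hl => by rw [(hmem l).1 hl]
  have hΛdiv : ∀ (l : Γ × Γ) (m : ℕ), 0 < m → m • l ∈ Λ → l ∈ Λ := fun l m hm hl => by
    rw [hmem] at hl ⊢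
    exact nsmul_right_injective hm.ne' hl
  have hpair : ∀ γ : WithTop Γ, (γ = ⊤ ∧ γ = ⊤) ∨ ∃ l ∈ Λ, γ = (l.1 : Γ) ∧ γ = (l.2 : Γ) := by
    intro γ
    induction γ using WithTop.recTopCoe with
    | top => exact Or.inl ⟨rfl, rfl⟩
    | coe γ => exact Or.inr ⟨(γ, γ), rfl, rfl, rfl⟩
  set T : List FieldTerm := s.fieldTerms ++ t.fieldTerms with hT
  set C : Finset K := T.toFinset.biUnion (fun t => (t.poly e m).roots.toFinset) ∪ {0} with hC
  have hroots : ∀ t ∈ T, t.poly e m ≠ 0 → (t.poly e m).Splits ∧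
      ∀ c ∈ (t.poly e m).roots, c ∈ C := fun t ht _ =>
    ⟨IsAlgClosed.splits _, fun c hc => Finset.mem_union_left _
      (Finset.mem_biUnion.2 ⟨t, List.mem_toFinset.2 ht, Multiset.mem_toFinset.2 hc⟩)⟩
  have hthr : ∀ q : K × Finset K, ∃ r : Γ, q.1 ∉ q.2 →
      ∀ a ∈ positionSet v (RingHom.id K) e m g C q.1 q.2,
      ∀ a' ∈ positionSet v (RingHom.id K) e m g C q.1 q.2,
        (r ≤ a.2.2 ↔ r ≤ a'.2.2) → (a.2.2 ≤ r ↔ a'.2.2 ≤ r) →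
        (s.eval v a.1 a.2.1 ≤ t.eval v a.1 a.2.1 ↔
          s.eval v a'.1 a'.2.1 ≤ t.eval v a'.1 a'.2.1) := by
    rintro ⟨c₀, S⟩
    by_cases hS : c₀ ∈ S
    · exact ⟨0, fun h => absurd hS h⟩
    have hlin : ∀ u : ValueTerm, (∀ t ∈ u.fieldTerms, t ∈ T) →
        IsLinear Λ (positionSet v (RingHom.id K) e m g C c₀ S)
          (positionSet v (RingHom.id K) e m g C c₀ S) (fun p => u.eval v p.1 p.2.1) := fun u hu =>
      u.isLinear_positionSet (fun y hy => (hpair _).resolve_left fun h =>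
        (AddValuation.ne_top_iff v).2 hy h.1) (fun n => hpair _) hS
        fun t ht => hroots t (hu t ht)
    obtain ⟨r, hr, h⟩ := (hlin s fun t ht => List.mem_append_left _ ht).exists_threshold
      (hlin t fun t ht => List.mem_append_right _ ht) hdiv hΛ hΛdiv
    rw [← (hmem r).1 hr] at h
    exact ⟨r.1, fun _ => h⟩
  choose r hr using hthr
  -- The distances between centers determine `S`, and include `∞`, which detects when a point is a
  -- center. The thresholds for all pairs `(c₀, S)` settle the inequality.
  set F : Finset (WithTop Γ) := (C ×ˢ C).image (fun q => v (q.1 - q.2)) ∪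
    (C ×ˢ C.powerset).image (fun q => (r q : WithTop Γ)) with hF
  refine ⟨C, F, fun x y hxy hx => ?_⟩
  have hCF : ∀ c ∈ C, ∀ d ∈ C, v (c - d) ∈ F := fun c hc d hd => Finset.mem_union_left _
    (Finset.mem_image.2 ⟨(c, d), Finset.mem_product.2 ⟨hc, hd⟩, rfl⟩)
  have h0C : (0 : K) ∈ C := Finset.mem_union_right _ (Finset.mem_singleton_self 0)
  have htop : (⊤ : WithTop Γ) ∈ F := by
    have := hCF 0 h0C 0 h0C
    rwa [sub_zero, AddValuation.map_zero] at this
  by_cases hxC : x ∈ C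
  · have := (hxy x hxC ⊤ htop).1
    rw [sub_self, AddValuation.map_zero, top_le_iff, top_le_iff, AddValuation.top_iff,
      sub_eq_zero] at this
    rwa [this.1 rfl]
  obtain ⟨c₀, hc₀, hmax⟩ := C.exists_max_image (fun c => v (x - c)) ⟨0, h0C⟩
  obtain ⟨ρ, hρ⟩ := exists_coe_eq v (sub_ne_zero.2 fun h => hxC (h ▸ hc₀) : x - c₀ ≠ 0)
  have hyC : y - c₀ ≠ 0 := fun h => by
    have := (hxy c₀ hc₀ ⊤ htop).1
    rw [h, AddValuation.map_zero, hρ] at this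
    simp at this
  obtain ⟨ρ', hρ'⟩ := exists_coe_eq v hyC
  set S : Finset K := C.filter fun c => v (c₀ - c) < ρ with hS
  have hc₀S : c₀ ∉ S := by simp [hS, AddValuation.map_zero]
  have hsub : ∀ z c : K, z - c = (c₀ - c) + (z - c₀) := fun z c => by ring
  have hS' : ∀ c ∈ C, c ∈ S ↔ v (c₀ - c) < ρ' := fun c hc => by
    rw [hS, Finset.mem_filter, and_iff_right hc, ← hρ, ← hρ', ← not_le, ← not_le]
    exact not_congr (hxy c₀ hc₀ _ (hCF c₀ hc₀ c hc)).2
  have hx1 : ∀ c ∈ C, c ∈ S → v (x - c) = v (c₀ - c) := fun c hc hcS => by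
    have hlt : v (c₀ - c) < v (x - c₀) := hρ ▸ (Finset.mem_filter.1 hcS).2
    rw [hsub x, AddValuation.map_add_eq_of_lt_left v hlt]
  have hx2 : ∀ c ∈ C, c ∉ S → v (x - c) = ρ := fun c hc hcS => by
    refine le_antisymm (hρ ▸ hmax c hc) ?_
    have hle : (ρ : WithTop Γ) ≤ v (c₀ - c) :=
      not_lt.1 fun hlt => hcS (Finset.mem_filter.2 ⟨hc, hlt⟩)
    rw [hsub x]
    exact AddValuation.map_le_add v hle hρ.ge
  have hy1 : ∀ c ∈ C, c ∈ S → v (y - c) = v (c₀ - c) := fun c hc hcS => by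
    have hlt : v (c₀ - c) < v (y - c₀) := hρ' ▸ (hS' c hc).1 hcS
    rw [hsub y, AddValuation.map_add_eq_of_lt_left v hlt]
  have hy2 : ∀ c ∈ C, c ∉ S → v (y - c) = ρ' := fun c hc hcS => by
    have hle : (ρ' : WithTop Γ) ≤ v (c₀ - c) := not_lt.1 fun hlt => hcS ((hS' c hc).2 hlt)
    refine le_antisymm (not_lt.1 fun hlt => ?_) ?_
    -- If `y` were nearer to `c` than to `c₀`, then `v (c₀ - c) = ρ'`. Comparison with this radius
    -- would make `x` nearer to `c` too, against the choice of `c₀`.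
    · have heq : v (c₀ - c) = ρ' := by
        have : c₀ - c = (y - c) - (y - c₀) := by ring
        rw [this, AddValuation.map_sub_eq_of_lt_right v (hρ'.symm ▸ hlt), hρ']
      have hmem := hCF c₀ hc₀ c hc
      have h1 : ¬ v (x - c) ≤ v (c₀ - c) := by
        rw [(hxy c hc _ hmem).2, heq]
        exact hlt.not_ge
      have h2 : v (x - c₀) ≤ v (c₀ - c) := by
        rw [(hxy c₀ hc₀ _ hmem).2, heq, hρ']
      exact h1 ((hmax c hc).trans h2)
    · rw [hsub y]
      exact AddValuation.map_le_add v hle hρ'.ge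
  have hrF : (r (c₀, S) : WithTop Γ) ∈ F := Finset.mem_union_right _ (Finset.mem_image.2
    ⟨(c₀, S), Finset.mem_product.2 ⟨hc₀, Finset.mem_powerset.2 (Finset.filter_subset _ _)⟩, rfl⟩)
  have hcut := hxy c₀ hc₀ _ hrF
  rw [hρ, hρ', WithTop.coe_le_coe, WithTop.coe_le_coe, WithTop.coe_le_coe,
    WithTop.coe_le_coe] at hcut
  exact (hr (c₀, S) hc₀S (Function.update e m x, g, ρ) ⟨x, rfl, rfl, hx1, hx2⟩
    (Function.update e m y, g, ρ') ⟨y, rfl, rfl, hy1, hy2⟩ hcut.1 hcut.2).1 hx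

end Tame

/-! ### From quantifier elimination to finite Boolean combinations of balls, by compactness -/

section TameDefinable

variable {K Γ : Type u} [Field K] [AddCommGroup Γ] [LinearOrder Γ] [IsOrderedAddMonoid Γ]
  {v : AddValuation K (WithTop Γ)} {κ : Cardinal.{u}}

theorem Definable.tame [IsAlgClosed K] [Nontrivial Γ] (hv : Function.Surjective v)
    (hκ : Cardinal.aleph0 ≤ κ) (hsat : IsSaturated κ v) {D : Set K} (hD : Definable v D) :
    Tame v D := by
  obtain ⟨φ, e, g, he, hg, rfl⟩ := hD.exists_finite_range
  set D := {x | φ.Realize v (Function.update e 0 x) g} with hDdef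
  have hDA : DefinableOver v (Set.range e) (Set.range g) D := definableOver_formula φ e g 0
  have hsat' := (hsat _ _ ((Cardinal.lt_aleph0_iff_set_finite.2 he).trans_le hκ)
    ((Cardinal.lt_aleph0_iff_set_finite.2 hg).trans_le hκ)).1
  let Z : ValueTerm × ValueTerm → Set K := fun p =>
    {x | p.1.eval v (Function.update e 0 x) g ≤ p.2.eval v (Function.update e 0 x) g}
  have hZdef : ∀ p, DefinableOver v (Set.range e) (Set.range g) (Z p) := fun p =>
    definableOver_formula (.leValue p.1 p.2) e g 0
  have hZtame : ∀ p, Tame v (Z p) := fun p => tame_atomic hv p.1 p.2 e g 0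
  -- The atomic conditions true or false at `x` imply membership in `D`, hence finitely many of them
  -- do. A second use of compactness covers `D` by finitely many of these `W`.
  have hloc : ∀ x ∈ D, ∃ W : Set K, x ∈ W ∧ W ⊆ D ∧ Tame v W ∧
      DefinableOver v (Set.range e) (Set.range g) W := by
    intro x hx
    by_contra! hcon
    obtain ⟨y, hy⟩ := hsat'
      (insert Dᶜ {W | (∃ p, W = Z p ∨ W = (Z p)ᶜ) ∧ x ∈ W}) (by
        rintro W (rfl | ⟨⟨p, rfl | rfl⟩, -⟩)
        exacts [hDA.compl, hZdef p, (hZdef p).compl]) (by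
        intro 𝓕 h𝓕 hfin
        have hprop : ∀ W ∈ 𝓕 \ {Dᶜ}, (∃ p, W = Z p ∨ W = (Z p)ᶜ) ∧ x ∈ W := fun W hW =>
          (h𝓕 hW.1).resolve_left hW.2
        have hfin' : (𝓕 \ {Dᶜ}).Finite := hfin.subset Set.sdiff_subset
        have hnot : ¬ ⋂₀ (𝓕 \ {Dᶜ}) ⊆ D := fun hsub =>
          hcon (⋂₀ (𝓕 \ {Dᶜ})) (fun W hW => (hprop W hW).2) hsub
            (Tame.sInter hfin' fun W hW => by
              obtain ⟨⟨p, rfl | rfl⟩, -⟩ := hprop W hW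
              exacts [hZtame p, (hZtame p).compl])
            (DefinableOver.sInter hfin' fun W hW => by
              obtain ⟨⟨p, rfl | rfl⟩, -⟩ := hprop W hW
              exacts [hZdef p, (hZdef p).compl])
        obtain ⟨y, hy, hyD⟩ := Set.not_subset.1 hnot
        refine ⟨y, fun W hW => ?_⟩
        by_cases hWD : W = Dᶜ
        · rw [hWD]
          exact hyD
        · exact hy W ⟨hW, hWD⟩)
    have hsim : Sim v (Function.update e 0 x) g (Function.update e 0 y) g := fun s t => by
      by_cases hst : x ∈ Z (s, t)
      · exact iff_of_true hst (hy _ (Or.inr ⟨⟨(s, t), Or.inl rfl⟩, hst⟩))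
      · exact iff_of_false hst (hy (Z (s, t))ᶜ (Or.inr ⟨⟨(s, t), Or.inr rfl⟩, hst⟩))
    exact hy _ (Set.mem_insert _ _) ((hsim.realize_iff hv hκ hsat φ (finite_range_update he 0 x) hg
      (finite_range_update he 0 y) hg).1 hx)
  by_contra hnt
  obtain ⟨y, hy⟩ := hsat' (insert D {W | ∃ W', W = W'ᶜ ∧ W' ⊆ D ∧ Tame v W' ∧
      DefinableOver v (Set.range e) (Set.range g) W'}) (by
      rintro W (rfl | ⟨W', rfl, -, -, h⟩)
      exacts [hDA, h.compl]) (by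
      intro 𝓕 h𝓕 hfin
      have hprop : ∀ W ∈ 𝓕 \ {D}, ∃ W', W = W'ᶜ ∧ W' ⊆ D ∧ Tame v W' ∧
          DefinableOver v (Set.range e) (Set.range g) W' := fun W hW =>
        (h𝓕 hW.1).resolve_left hW.2
      by_contra hempty
      refine hnt ?_
      have : D = (⋂₀ (𝓕 \ {D}))ᶜ := by
        ext x
        constructor
        · intro hx hx'
          refine hempty ⟨x, fun W hW => ?_⟩
          by_cases hWD : W = D
          · rwa [hWD]
          · exact hx' W ⟨hW, hWD⟩
        · intro hx
          simp only [Set.mem_compl_iff, Set.mem_sInter, not_forall] at hx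
          obtain ⟨W, hW, hxW⟩ := hx
          obtain ⟨W', rfl, hsub, -⟩ := hprop W hW
          exact hsub (not_not.1 hxW)
      rw [this]
      refine (Tame.sInter (hfin.subset Set.sdiff_subset) fun W hW => ?_).compl
      obtain ⟨W', rfl, -, h, -⟩ := hprop W hW
      exact h.compl)
  obtain ⟨W, hyW, hsub, ht, hd⟩ := hloc y (hy D (Set.mem_insert _ _))
  exact hy _ (Or.inr ⟨W, rfl, hsub, ht, hd⟩) hyW

end TameDefinable

end ACVF

namespace ACVF

/-! ### Groups which are intersections of tame sets -/

section Groups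

variable {K Γ : Type u} [Field K] [AddCommGroup Γ] [LinearOrder Γ] [IsOrderedAddMonoid Γ]
  {v : AddValuation K (WithTop Γ)} {κ : Cardinal.{u}}

/-- The valuation of a unit, as an element of `Γ`. -/
def ord (v : AddValuation K (WithTop Γ)) (x : Kˣ) : Γ :=
  (v (x : K)).untop ((AddValuation.ne_top_iff v).2 x.ne_zero)

theorem coe_ord (v : AddValuation K (WithTop Γ)) (x : Kˣ) :
    ((ord v x : Γ) : WithTop Γ) = v (x : K) :=
  WithTop.coe_untop _ _

theorem ord_mul (x y : Kˣ) : ord v (x * y) = ord v x + ord v y := by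
  have : ((ord v (x * y) : Γ) : WithTop Γ) = ((ord v x + ord v y : Γ) : WithTop Γ) := by
    rw [WithTop.coe_add, coe_ord, coe_ord, coe_ord, Units.val_mul, AddValuation.map_mul]
  exact_mod_cast this

theorem ord_one : ord v (1 : Kˣ) = 0 := by
  have := ord_mul (v := v) (1 : Kˣ) 1
  rwa [mul_one, left_eq_add] at this

theorem ord_inv (x : Kˣ) : ord v x⁻¹ = -ord v x := by
  rw [eq_neg_iff_add_eq_zero, ← ord_mul, inv_mul_cancel, ord_one]

theorem ord_pow (x : Kˣ) (n : ℕ) : ord v (x ^ n) = n • ord v x := by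
  induction n with
  | zero => rw [pow_zero, zero_smul, ord_one]
  | succ n ih => rw [pow_succ, ord_mul, ih, succ_nsmul]

theorem exists_ord_eq (hv : Function.Surjective v) (γ : Γ) : ∃ x : Kˣ, ord v x = γ := by
  obtain ⟨x, hx⟩ := hv γ
  have hx0 : x ≠ 0 := by
    rintro rfl
    rw [AddValuation.map_zero] at hx
    exact WithTop.top_ne_coe hx
  refine ⟨Units.mk0 x hx0, ?_⟩
  rw [← WithTop.coe_eq_coe, coe_ord, Units.val_mk0, hx]

/-- Membership in a tame set only depends on the distance to a given point `a`, as long as it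
avoids crossing finitely many values. -/
theorem Tame.exists_values {D : Set K} (hD : Tame v D) (a : K) :
    ∃ B : Finset (WithTop Γ), ∀ y z, (∀ β ∈ B, (β < v (y - a) ∧ β < v (z - a)) ∨
      (v (y - a) < β ∧ v (z - a) < β)) → y ∈ D → z ∈ D := by
  classical
  obtain ⟨C, F, h⟩ := hD
  -- If both points are nearer to `a` than `c` is, their distance to `c` is `v (a - c)`. If both are
  -- farther, it is their distance to `a`, which is compared with the radii.
  refine ⟨F ∪ C.image fun c => v (a - c), fun y z hyz hy => h y z (fun c hc r hr => ?_) hy⟩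
  have hsub : ∀ x, x - c = (a - c) + (x - a) := fun x => by ring
  rcases hyz _ (Finset.mem_union_right _ (Finset.mem_image_of_mem _ hc)) with h1 | h1
  · rw [hsub y, hsub z, AddValuation.map_add_eq_of_lt_left v h1.1,
      AddValuation.map_add_eq_of_lt_left v h1.2]
    exact ⟨Iff.rfl, Iff.rfl⟩
  · rw [hsub y, hsub z, AddValuation.map_add_eq_of_lt_right v h1.1,
      AddValuation.map_add_eq_of_lt_right v h1.2]
    rcases hyz r (Finset.mem_union_left _ hr) with h2 | h2
    · exact ⟨iff_of_true h2.1.le h2.2.le, iff_of_false h2.1.not_ge h2.2.not_ge⟩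
    · exact ⟨iff_of_false h2.1.not_ge h2.2.not_ge, iff_of_true h2.1.le h2.2.le⟩

/-- A family of tame sets with intersection `X`, closed under passing to a set whose quotients
lie in a given member. -/
structure IsGroupSystem (v : AddValuation K (WithTop Γ)) (X : Subgroup Kˣ)
    (𝓓 : Set (Set K)) : Prop where
  tame : ∀ D ∈ 𝓓, Tame v D
  mem : ∀ D ∈ 𝓓, ∀ x ∈ X, (x : K) ∈ D
  quot : ∀ D ∈ 𝓓, ∃ D' ∈ 𝓓, ∀ x y : K, x ≠ 0 → x ∈ D' → x * y ∈ D' → y ∈ D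
  inter : ∀ x : Kˣ, (∀ D ∈ 𝓓, (x : K) ∈ D) → x ∈ X

/-- The finite intersections of members of `𝒟` form the system, the compactness lemma for quotients
being applied to each factor. -/
theorem exists_isGroupSystem [IsAlgClosed K] [Nontrivial Γ] (hv : Function.Surjective v)
    (hκ : Cardinal.aleph0 ≤ κ) (hsat : IsSaturated κ v) {X : Subgroup Kˣ} {𝒟 : Set (Set K)}
    (h𝒟 : Cardinal.mk 𝒟 < κ) (hdef : ∀ D ∈ 𝒟, Definable v D)
    (hX : Units.val '' (X : Set Kˣ) = ⋂₀ 𝒟) :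
    ∃ 𝓓, 𝒟 ⊆ 𝓓 ∧ IsGroupSystem v X 𝓓 := by
  have hsingle : 𝒟 ⊆ {D | ∃ 𝓕 ⊆ 𝒟, 𝓕.Finite ∧ D = ⋂₀ 𝓕} := fun D hD =>
    ⟨{D}, by simpa using hD, Set.finite_singleton D, by simp⟩
  have hXmem : ∀ x ∈ X, ∀ D ∈ 𝒟, (x : K) ∈ D := fun x hx D hD => by
    have : (x : K) ∈ ⋂₀ 𝒟 := hX ▸ ⟨x, hx, rfl⟩
    exact this D hD
  refine ⟨{D | ∃ 𝓕 ⊆ 𝒟, 𝓕.Finite ∧ D = ⋂₀ 𝓕}, hsingle, ⟨?_, ?_, ?_, fun x hx => ?_⟩⟩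
  · rintro _ ⟨𝓕, h𝓕, hfin, rfl⟩
    exact Tame.sInter hfin fun D hD => (hdef D (h𝓕 hD)).tame hv hκ hsat
  · rintro _ ⟨𝓕, h𝓕, hfin, rfl⟩ x hx D hD
    exact hXmem x hx D (h𝓕 hD)
  · rintro _ ⟨𝓕, h𝓕, hfin, rfl⟩
    have := hfin.to_subtype
    choose f hf hffin hfq using fun D : 𝓕 =>
      exists_finite_quotient_subset hκ hsat h𝒟 hdef hX (h𝓕 D.2)
    refine ⟨_, ⟨⋃ D, f D, Set.iUnion_subset hf, Set.finite_iUnion hffin, rfl⟩,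
      fun x y hx0 hx hxy D hD => ?_⟩
    have hsub : f ⟨D, hD⟩ ⊆ ⋃ D, f D := Set.subset_iUnion f ⟨D, hD⟩
    exact hfq ⟨D, hD⟩ x y hx0 (Set.sInter_subset_sInter hsub hx)
      (Set.sInter_subset_sInter hsub hxy)
  · have : (x : K) ∈ Units.val '' (X : Set Kˣ) := by
      rw [hX]
      exact fun D hD => hx D (hsingle hD)
    obtain ⟨y, hy, hyx⟩ := this
    rwa [← Units.ext hyx]

theorem isSmallInter_of_forall {P : Subgroup Kˣ → Prop} {X : Subgroup Kˣ} {𝒟 : Set (Set K)}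
    (h𝒟 : Cardinal.mk 𝒟 < κ) (hX : Units.val '' (X : Set Kˣ) = ⋂₀ 𝒟)
    (h : ∀ D ∈ 𝒟, ∃ H : Subgroup Kˣ, P H ∧ X ≤ H ∧ ∀ x ∈ H, (x : K) ∈ D) :
    IsSmallInter κ P X := by
  choose f hP hle hsub using fun D : 𝒟 => h D D.2
  refine ⟨Set.range f, ?_, Cardinal.mk_range_le.trans_lt h𝒟, ?_, le_antisymm ?_ ?_⟩
  -- The empty family would have intersection `K`, which contains `0`.
  · by_contra hne
    rw [Set.not_nonempty_iff_eq_empty, Set.range_eq_empty_iff] at hne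
    have h𝒟0 : 𝒟 = ∅ := Set.isEmpty_coe_sort.1 hne
    have : (0 : K) ∈ Units.val '' (X : Set Kˣ) := by simp [hX, h𝒟0]
    obtain ⟨x, -, hx⟩ := this
    exact x.ne_zero hx
  · rintro _ ⟨D, rfl⟩
    exact hP D
  · refine le_sInf ?_
    rintro _ ⟨D, rfl⟩
    exact hle D
  · intro x hx
    rw [Subgroup.mem_sInf] at hx
    have : (x : K) ∈ Units.val '' (X : Set Kˣ) := by
      rw [hX]
      exact fun D hD => hsub ⟨D, hD⟩ x (hx _ ⟨⟨D, hD⟩, rfl⟩)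
    obtain ⟨y, hy, hyx⟩ := this
    rwa [← Units.ext hyx]

/-- The intervals `[2nγ, (2n+1)γ]` are pairwise disjoint, so each `β` spoils at most one `n`. -/
theorem exists_gap {γ : Γ} (hγ : 0 < γ) (B : Finset (WithTop Γ)) :
    ∃ n : ℕ, ∀ β ∈ B, β < ((2 * n) • γ : Γ) ∨ (((2 * n + 1) • γ : Γ) : WithTop Γ) < β := by
  have hfin : (⋃ β ∈ B, {n : ℕ | (((2 * n) • γ : Γ) : WithTop Γ) ≤ β ∧
      β ≤ (((2 * n + 1) • γ : Γ) : WithTop Γ)}).Finite := by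
    refine B.finite_toSet.biUnion fun β _ => Set.Subsingleton.finite ?_
    have key : ∀ m n : ℕ, (((2 * n) • γ : Γ) : WithTop Γ) ≤ β →
        β ≤ (((2 * m + 1) • γ : Γ) : WithTop Γ) → n ≤ m := by
      intro m n h1 h2
      have h3 := h1.trans h2
      rw [WithTop.coe_le_coe, nsmul_le_nsmul_iff_left hγ] at h3
      omega
    exact fun m hm n hn => le_antisymm (key n m hm.1 hn.2) (key m n hn.1 hm.2)
  obtain ⟨n, hn⟩ := hfin.infinite_compl.nonempty
  refine ⟨n, fun β hβ => ?_⟩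
  by_contra! hcon
  exact hn (Set.mem_biUnion (by exact hβ) hcon)

/-- The valuations of the elements of `X` form a convex group, and `X` is the full preimage, if
not all of these valuations are zero. -/
theorem IsGroupSystem.mem_of_ord_le {X : Subgroup Kˣ} {𝓓 : Set (Set K)}
    (hX : IsGroupSystem v X 𝓓) {x w : Kˣ} (hx : x ∈ X) (hx0 : 0 < ord v x) (hw0 : 0 ≤ ord v w)
    (hwx : ord v w ≤ ord v x) : w ∈ X := by
  refine hX.inter w fun D hD => ?_
  obtain ⟨D', hD', hquot⟩ := hX.quot D hD
  obtain ⟨B, hB⟩ := (hX.tame D' hD').exists_values 0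
  -- The values of `x ^ (2 * n)` and of `x ^ (2 * n) * w` lie in one gap, so both elements are in
  -- `D'`; their quotient is `w`.
  obtain ⟨n, hn⟩ := exists_gap hx0 B
  have hy : ((x ^ (2 * n) : Kˣ) : K) ∈ D' := hX.mem D' hD' _ (X.pow_mem hx _)
  refine hquot _ w (x ^ (2 * n)).ne_zero hy ?_
  rw [← Units.val_mul]
  refine hB _ _ (fun β hβ => ?_) hy
  rw [sub_zero, sub_zero, ← coe_ord, ← coe_ord, ord_mul, ord_pow]
  rcases hn β hβ with h | h
  · refine Or.inl ⟨h, h.trans_le ?_⟩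
    rw [WithTop.coe_le_coe]
    exact le_add_of_nonneg_right hw0
  · refine Or.inr ⟨lt_of_le_of_lt ?_ h, lt_of_le_of_lt ?_ h⟩
    · rw [WithTop.coe_le_coe, succ_nsmul]
      exact le_add_of_nonneg_right hx0.le
    · rw [WithTop.coe_le_coe, succ_nsmul]
      exact add_le_add_right hwx _

theorem mem_littleOUnits {a x : Kˣ} :
    x ∈ littleOUnits v a ↔ ∀ n : ℕ, 0 < n → |n • ord v x| < ord v a := by
  constructor
  · rintro ⟨α, γ, hα, hγ, h⟩
    rw [← coe_ord, WithTop.coe_eq_coe] at hα hγ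
    rw [hα, hγ]
    exact h
  · exact fun h => ⟨ord v a, ord v x, (coe_ord v a).symm, (coe_ord v x).symm, h⟩

/-- The group `o(a)`, for `v(a) > 0`. -/
def littleOSubgroup (v : AddValuation K (WithTop Γ)) (a : Kˣ) (ha : 0 < ord v a) :
    Subgroup Kˣ where
  carrier := littleOUnits v a
  one_mem' := mem_littleOUnits.2 fun n _ => by simpa [ord_one] using ha
  inv_mem' := fun {x} hx => mem_littleOUnits.2 fun n hn => by
    rw [ord_inv, smul_neg, abs_neg]
    exact mem_littleOUnits.1 hx n hn
  mul_mem' := fun {x y} hx hy => mem_littleOUnits.2 fun n hn => by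
    -- The factor `2` leaves room for the sum of two elements: each half is less than `v(a) / 2`.
    have hx2 := mem_littleOUnits.1 hx (2 * n) (by omega)
    have hy2 := mem_littleOUnits.1 hy (2 * n) (by omega)
    rw [mul_smul, abs_nsmul] at hx2 hy2
    have h3 : 2 • |n • ord v (x * y)| < 2 • ord v a := by
      calc 2 • |n • ord v (x * y)| ≤ 2 • (|n • ord v x| + |n • ord v y|) := by
            refine nsmul_le_nsmul_right ?_ 2
            rw [ord_mul, smul_add]
            exact abs_add_le _ _
        _ = 2 • |n • ord v x| + 2 • |n • ord v y| := smul_add _ _ _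
        _ < ord v a + ord v a := add_lt_add hx2 hy2
        _ = 2 • ord v a := (two_nsmul _).symm
    exact lt_of_nsmul_lt_nsmul_right 2 h3

/-- Choose `α` above all values of `X` and `y₀ ∈ X` so that no critical value lies in `[v(y₀), α)`.
An element of `o(a)` outside `X`, with `v(a) = α`, has absolute value in this range, so it is in `D`
along with `y₀` or `y₀⁻¹`. Since `X` is closed under powers and bounded by `α`, it lies in `o(a)`.
-/
theorem exists_littleO_between (hv : Function.Surjective v) {X : Subgroup Kˣ}
    (hconv : ∀ x ∈ X, 0 < ord v x → ∀ w : Kˣ, 0 ≤ ord v w → ord v w ≤ ord v x → w ∈ X)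
    (hXtop : X ≠ ⊤) {x₀ : Kˣ} (hx₀ : x₀ ∈ X) (hx₀pos : 0 < ord v x₀) {D : Set K} (hD : Tame v D)
    (hXD : ∀ x ∈ X, (x : K) ∈ D) :
    ∃ H : Subgroup Kˣ, IsLittleO v H ∧ X ≤ H ∧ ∀ x ∈ H, (x : K) ∈ D := by
  classical
  have habove : ∀ b : Kˣ, b ∉ X → 0 < ord v b → ∀ y ∈ X, ord v y < ord v b := by
    intro b hb hb0 y hy
    by_contra! hle
    exact hb (hconv y hy (hb0.trans_le hle) b hb0.le hle)
  have hne0 : ∀ b : Kˣ, b ∉ X → ord v b ≠ 0 := fun b hb h0 =>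
    hb (hconv x₀ hx₀ hx₀pos b h0.ge (h0.trans_le hx₀pos.le))
  obtain ⟨b, hb, hb0⟩ : ∃ b : Kˣ, b ∉ X ∧ 0 < ord v b := by
    obtain ⟨b, hb⟩ : ∃ b, b ∉ X := by
      by_contra! h
      exact hXtop (eq_top_iff.2 fun x _ => h x)
    rcases lt_or_gt_of_ne (hne0 b hb) with h | h
    · exact ⟨b⁻¹, fun h' => hb (X.inv_mem_iff.1 h'), by rw [ord_inv]; exact neg_pos.2 h⟩
    · exact ⟨b, hb, h⟩
  obtain ⟨B, hB⟩ := hD.exists_values 0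
  simp only [sub_zero] at hB
  have hinj : Function.Injective ((↑) : Γ → WithTop Γ) := WithTop.coe_injective
  -- The negatives are included because elements of negative value will be compared with `y₀⁻¹`.
  set Bad : Finset Γ := B.preimage _ hinj.injOn ∪
    (B.preimage _ hinj.injOn).image fun γ => -γ with hBad
  have hBad1 : ∀ β : Γ, (β : WithTop Γ) ∈ B → β ∈ Bad := fun β hβ =>
    Finset.mem_union_left _ (Finset.mem_preimage.2 hβ)
  have hBad2 : ∀ β : Γ, (β : WithTop Γ) ∈ B → -β ∈ Bad := fun β hβ =>
    Finset.mem_union_right _ (Finset.mem_image_of_mem _ (Finset.mem_preimage.2 hβ))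
  -- Without `ord v b` there might be no candidate, as no critical value need lie above `X`.
  set Up : Finset Γ := insert (ord v b) (Bad.filter fun β => ∀ y ∈ X, ord v y < β) with hUp
  set α := Up.min' (Finset.insert_nonempty _ _) with hα
  have hαX : ∀ y ∈ X, ord v y < α := fun y hy => by
    rcases Finset.mem_insert.1 (Up.min'_mem (Finset.insert_nonempty _ _)) with h | h
    · rw [hα, h]
      exact habove b hb hb0 y hy
    · exact (Finset.mem_filter.1 h).2 y hy
  have hαpos : 0 < α := by simpa [ord_one] using hαX 1 X.one_mem
  obtain ⟨y₀, hy₀, hy₀pos, hlow⟩ : ∃ y₀ ∈ X, 0 < ord v y₀ ∧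
      ∀ β ∈ Bad, (∃ y ∈ X, β ≤ ord v y) → β < ord v y₀ := by
    have : ∀ s : Finset Γ, ∃ y₀ ∈ X, 0 < ord v y₀ ∧
        ∀ β ∈ s, (∃ y ∈ X, β ≤ ord v y) → β < ord v y₀ := by
      intro s
      induction s using Finset.induction_on with
      | empty => exact ⟨x₀, hx₀, hx₀pos, by simp⟩
      | insert β s _ ih =>
        obtain ⟨y₀, hy₀, hpos, h⟩ := ih
        by_cases hβ : ∃ y ∈ X, β ≤ ord v y
        · obtain ⟨y, hy, hle⟩ := hβ
          rcases le_or_gt (ord v y) 0 with hy0 | hy0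
          · refine ⟨y₀, hy₀, hpos, fun γ hγ hγX => ?_⟩
            rcases Finset.mem_insert.1 hγ with rfl | hγ
            · exact hle.trans_lt (hy0.trans_lt hpos)
            · exact h γ hγ hγX
          · refine ⟨y₀ * y, X.mul_mem hy₀ hy, by rw [ord_mul]; exact add_pos hpos hy0,
              fun γ hγ hγX => ?_⟩
            rw [ord_mul]
            rcases Finset.mem_insert.1 hγ with rfl | hγ
            · exact hle.trans_lt (lt_add_of_pos_left _ hpos)
            · exact (h γ hγ hγX).trans (lt_add_of_pos_right _ hy0)
        · refine ⟨y₀, hy₀, hpos, fun γ hγ hγX => ?_⟩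
          rcases Finset.mem_insert.1 hγ with rfl | hγ
          · exact absurd hγX hβ
          · exact h γ hγ hγX
    exact this Bad
  have hup : ∀ β ∈ Bad, ¬ (∃ y ∈ X, β ≤ ord v y) → α ≤ β := fun β hβ h => by
    push Not at h
    exact Up.min'_le _ (Finset.mem_insert_of_mem (Finset.mem_filter.2 ⟨hβ, h⟩))
  obtain ⟨a, ha⟩ := exists_ord_eq hv α
  refine ⟨littleOSubgroup v a (ha ▸ hαpos), ⟨a, rfl⟩, fun y hy => ?_, fun w hw => ?_⟩
  · refine mem_littleOUnits.2 fun n _ => ?_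
    rw [ha, abs_lt]
    have h1 := hαX _ (X.pow_mem hy n)
    have h2 := hαX _ (X.inv_mem (X.pow_mem hy n))
    rw [ord_inv, ord_pow] at h2
    rw [ord_pow] at h1
    exact ⟨neg_lt.1 h2, h1⟩
  · have hwα := mem_littleOUnits.1 hw 1 one_pos
    rw [one_smul, ha, abs_lt] at hwα
    by_cases hwX : w ∈ X
    · exact hXD w hwX
    have hy₀α := hαX y₀ hy₀
    rcases lt_or_gt_of_ne (hne0 w hwX) with hneg | hpos
    · have hwy := habove w⁻¹ (fun h' => hwX (X.inv_mem_iff.1 h'))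
        (by rw [ord_inv]; exact neg_pos.2 hneg) y₀ hy₀
      rw [ord_inv] at hwy
      refine hB ((y₀⁻¹ : Kˣ) : K) w (fun β hβ => ?_) (hXD _ (X.inv_mem hy₀))
      rw [← coe_ord, ← coe_ord, ord_inv]
      induction β using WithTop.recTopCoe with
      | top => exact Or.inr ⟨WithTop.coe_lt_top _, WithTop.coe_lt_top _⟩
      | coe β =>
        simp only [WithTop.coe_lt_coe]
        by_cases hβX : ∃ y ∈ X, -β ≤ ord v y
        · have := hlow _ (hBad2 β hβ) hβX
          exact Or.inr ⟨neg_lt.1 this, (lt_neg.1 hwy).trans (neg_lt.1 this)⟩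
        · have := hup _ (hBad2 β hβ) hβX
          have hle : β ≤ -α := le_neg.1 this
          exact Or.inl ⟨hle.trans_lt (neg_lt_neg hy₀α), hle.trans_lt hwα.1⟩
    · have hwy := habove w hwX hpos y₀ hy₀
      refine hB y₀ w (fun β hβ => ?_) (hXD _ hy₀)
      rw [← coe_ord, ← coe_ord]
      induction β using WithTop.recTopCoe with
      | top => exact Or.inr ⟨WithTop.coe_lt_top _, WithTop.coe_lt_top _⟩
      | coe β =>
        simp only [WithTop.coe_lt_coe]
        by_cases hβX : ∃ y ∈ X, β ≤ ord v y
        · have := hlow _ (hBad1 β hβ) hβX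
          exact Or.inl ⟨this, this.trans hwy⟩
        · have := hup _ (hBad1 β hβ) hβX
          exact Or.inr ⟨hy₀α.trans_le this, hwα.2.trans_le this⟩

end Groups

end ACVF

namespace ACVF

/-! ### Groups of units of the valuation ring -/

section UnitGroups

variable {K Γ : Type u} [Field K] [AddCommGroup Γ] [LinearOrder Γ] [IsOrderedAddMonoid Γ]
  {v : AddValuation K (WithTop Γ)} {κ : Cardinal.{u}}

theorem map_inv_of_map_eq_zero {x : Kˣ} (hx : v (x : K) = 0) : v ((x⁻¹ : Kˣ) : K) = 0 := by
  rw [← coe_ord] at hx ⊢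
  rw [ord_inv, WithTop.coe_eq_zero.1 hx, neg_zero, WithTop.coe_zero]

theorem map_eq_zero_of_map_one_sub_pos {y : K} (hy : 0 < v (1 - y)) : v y = 0 := by
  have h : v (1 - (1 - y)) = v 1 :=
    AddValuation.map_sub_eq_of_lt_left v (by rwa [AddValuation.map_one])
  rwa [sub_sub_cancel, AddValuation.map_one] at h

theorem map_one_sub_mul {x : K} (hx : v x = 0) (y : K) :
    min (v (1 - x)) (v (1 - y)) ≤ v (1 - x * y) := by
  have h : 1 - x * y = (1 - x) + x * (1 - y) := by ring
  have := v.map_add (1 - x) (x * (1 - y))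
  rwa [AddValuation.map_mul, hx, zero_add, ← h] at this

theorem map_one_sub_mul_of_ne {x y : K} (hx : v x = 0) (h : v (1 - x) ≠ v (1 - y)) :
    v (1 - x * y) = min (v (1 - x)) (v (1 - y)) := by
  have h1 : 1 - x * y = (1 - x) + x * (1 - y) := by ring
  have h2 : v (x * (1 - y)) = v (1 - y) := by rw [AddValuation.map_mul, hx, zero_add]
  rw [h1, AddValuation.map_add_of_distinct_val v (by rwa [h2]), h2]

/-- The group of all `y` such that `v(y) = 0` and `v(1 - y) ∈ W`, for an upper set `W`. -/
def congruenceUnits (v : AddValuation K (WithTop Γ)) (W : Set (WithTop Γ)) (hW : IsUpperSet W)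
    (htop : ⊤ ∈ W) : Subgroup Kˣ where
  carrier := {y | v (y : K) = 0 ∧ v (1 - (y : K)) ∈ W}
  one_mem' := by simpa using htop
  mul_mem' := fun {x y} hx hy => by
    refine ⟨by rw [Units.val_mul, AddValuation.map_mul, hx.1, hy.1, zero_add], ?_⟩
    rw [Units.val_mul]
    refine hW (map_one_sub_mul hx.1 _) ?_
    rcases min_choice (v (1 - (x : K))) (v (1 - (y : K))) with h | h <;> rw [h]
    exacts [hx.2, hy.2]
  inv_mem' := fun {x} hx => by
    refine ⟨map_inv_of_map_eq_zero hx.1, ?_⟩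
    have h : 1 - ((x⁻¹ : Kˣ) : K) = -(((x⁻¹ : Kˣ) : K) * (1 - x)) := by
      rw [mul_sub, Units.inv_mul]; ring
    rw [h, AddValuation.map_neg, AddValuation.map_mul, map_inv_of_map_eq_zero hx.1, zero_add]
    exact hx.2

/-- The group of all `y` such that `v(y) = 0` and `v(1 - y) ≥ r`. -/
def closedUnits (v : AddValuation K (WithTop Γ)) (r : WithTop Γ) : Subgroup Kˣ :=
  congruenceUnits v (Set.Ici r) (isUpperSet_Ici r) (Set.mem_Ici.2 le_top)

/-- The group of all `y` such that `v(y) = 0` and `v(1 - y) > r`. -/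
def openUnits (v : AddValuation K (WithTop Γ)) (r : Γ) : Subgroup Kˣ :=
  congruenceUnits v (Set.Ioi (r : WithTop Γ)) (isUpperSet_Ioi _) (WithTop.coe_lt_top r)

theorem mem_closedUnits {r : WithTop Γ} {y : Kˣ} :
    y ∈ closedUnits v r ↔ v (y : K) = 0 ∧ r ≤ v (1 - (y : K)) := Iff.rfl

theorem coe_closedUnits {r : Γ} (hr : 0 < r) :
    (closedUnits v (r : WithTop Γ) : Set Kˣ) = closedU v r :=
  Set.ext fun _ => ⟨fun h => h.2, fun h =>
    ⟨map_eq_zero_of_map_one_sub_pos ((WithTop.coe_pos.2 hr).trans_le h), h⟩⟩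

theorem coe_openUnits {r : Γ} (hr : 0 ≤ r) : (openUnits v r : Set Kˣ) = openU v r :=
  Set.ext fun _ => ⟨fun h => h.2, fun h =>
    ⟨map_eq_zero_of_map_one_sub_pos ((WithTop.coe_nonneg.2 hr).trans_lt h), h⟩⟩

theorem closedUnits_le {r s : WithTop Γ} (h : r ≤ s) : closedUnits v s ≤ closedUnits v r :=
  fun _ hx => ⟨hx.1, h.trans hx.2⟩

theorem closedUnits_top : closedUnits v ⊤ = ⊥ := by
  refine eq_bot_iff.2 fun x hx => ?_
  have h : (1 : K) - x = 0 := (AddValuation.top_iff v).1 (top_le_iff.1 hx.2)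
  exact Subgroup.mem_bot.2 (Units.ext (sub_eq_zero.1 h).symm)

/-- This supplies elements of `X` whose distance to `1` lies in a window, between a ball of finite
index and one of infinite index. -/
theorem exists_mem_notMem_of_relIndex {G : Type*} [Group G] {X U V : Subgroup G}
    (hU : U.relIndex X ≠ 0) (hV : V.relIndex X = 0) : ∃ x ∈ X, x ∈ U ∧ x ∉ V := by
  by_contra! h
  have hle : X ⊓ U ≤ V := fun x hx => h x hx.1 hx.2
  refine hU ?_
  rw [← Subgroup.inf_relIndex_left]
  exact Subgroup.relIndex_eq_zero_of_le_left hle hV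

/-- If the points at a distance from `1` in `W` are in `D'`, then the points whose distance lies
above `W`, or in `W`, are quotients of elements of `D'`. -/
theorem mem_of_window {D D' : Set K} (hquot : ∀ x y : K, x ≠ 0 → x ∈ D' → x * y ∈ D' → y ∈ D)
    (hv : Function.Surjective v) {W : Set (WithTop Γ)}
    (hW : ∀ y : K, v (1 - y) ∈ W → y ∈ D') {t : Γ} (ht0 : 0 < t) (ht : (t : WithTop Γ) ∈ W)
    {w : K} (hw : (t : WithTop Γ) < v (1 - w) ∨
      v (1 - w) < (t : WithTop Γ) ∧ v (1 - w) ∈ W) : w ∈ D := by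
  -- The denominator is `1 - z`, at distance exactly `t` from `1`. Since `v (1 - w) ≠ t`, the
  -- product with `w` is at distance exactly the minimum of the two, which is in `W`.
  obtain ⟨z, hz⟩ := hv t
  have h1 : v (1 - (1 - z)) = t := by rw [sub_sub_cancel, hz]
  have h0 : v (1 - z) = 0 :=
    map_eq_zero_of_map_one_sub_pos (by rw [h1]; exact WithTop.coe_pos.2 ht0)
  have hne : v (1 - (1 - z)) ≠ v (1 - w) := by
    rw [h1]
    rcases hw with h | h
    exacts [h.ne, h.1.ne']
  refine hquot (1 - z) w (fun h => ?_) (hW _ (h1 ▸ ht)) (hW _ ?_)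
  · rw [h, AddValuation.map_zero] at h0
    exact WithTop.top_ne_zero h0
  · rw [map_one_sub_mul_of_ne h0 hne, h1]
    rcases hw with h | h
    · rwa [min_eq_left h.le]
    · rw [min_eq_right h.1.le]
      exact h.2

theorem mem_of_separated {D : Set K} {B W : Set (WithTop Γ)} {x y : K}
    (hB : ∀ y z, (∀ β ∈ B, (β < v (y - 1) ∧ β < v (z - 1)) ∨
      (v (y - 1) < β ∧ v (z - 1) < β)) → y ∈ D → z ∈ D)
    (hW : ∀ β ∈ B, (∀ γ ∈ W, β < γ) ∨ ∀ γ ∈ W, γ < β) (hx : x ∈ D) (hxW : v (1 - x) ∈ W)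
    (hyW : v (1 - y) ∈ W) : y ∈ D := by
  rw [AddValuation.map_sub_swap] at hxW hyW
  exact hB x y (fun β hβ => (hW β hβ).imp (fun h => ⟨h _ hxW, h _ hyW⟩)
    fun h => ⟨h _ hxW, h _ hyW⟩) hx

theorem map_sub_eq_of_generic {ρ : WithTop Γ} {y z c : K} (hyz : ρ ≤ v (y - z))
    (hy : v (y - c) ≤ ρ) (hz : v (z - c) ≤ ρ) : v (y - c) = v (z - c) := by
  have key : ∀ y z : K, ρ ≤ v (y - z) → v (z - c) ≤ ρ → v (z - c) ≤ v (y - c) := by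
    intro y z hyz hz
    have h := v.map_add (y - z) (z - c)
    rw [sub_add_sub_cancel] at h
    exact (le_min (hz.trans hyz) le_rfl).trans h
  exact le_antisymm (key z y (by rwa [AddValuation.map_sub_swap]) hy) (key y z hyz hz)

/-- A group of units which meets infinitely many cosets of `v(1 - y) > ρ` contains a point whose
distance to each of finitely many given points is at most `ρ`. -/
theorem exists_generic_mem {X : Subgroup Kˣ} {ρ : Γ}
    (hX0 : ∀ x ∈ X, v (x : K) = 0) (hX : (openUnits v ρ).relIndex X = 0) (C : Finset K) :
    ∃ x ∈ X, ∀ c ∈ C, v ((x : K) - c) ≤ ρ := by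
  by_contra! h
  choose f hfC hf using fun x : X => h x x.2
  -- Otherwise each coset would be assigned a given point within its open ball; two cosets with the
  -- same point coincide, so there would be finitely many.
  have hinj : Function.Injective
      fun q : X ⧸ (openUnits v ρ).subgroupOf X => (⟨f q.out, hfC q.out⟩ : C) := by
    intro q q' hqq
    have hff : f q.out = f q'.out := congrArg Subtype.val hqq
    rw [← q.out_eq', ← q'.out_eq', QuotientGroup.eq, Subgroup.mem_subgroupOf]
    have hx0 := map_inv_of_map_eq_zero (hX0 _ q.out.2)
    refine ⟨?_, ?_⟩
    · exact hX0 _ (X.mul_mem (X.inv_mem q.out.2) q'.out.2)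
    · have h1 := v.map_sub ((q.out : Kˣ) - f q.out : K) ((q'.out : Kˣ) - f q'.out)
      have h2 : 1 - ((((q.out)⁻¹ * q'.out : X) : Kˣ) : K) =
          (((q.out : Kˣ)⁻¹ : Kˣ) : K) *
            (((q.out : Kˣ) - f q.out : K) - ((q'.out : Kˣ) - f q'.out)) := by
        rw [hff, sub_sub_sub_cancel_right, mul_sub, Units.inv_mul, Subgroup.coe_mul,
          Subgroup.coe_inv, Units.val_mul]
      rw [h2, AddValuation.map_mul, hx0, zero_add]
      exact (lt_min (hf _) (hf _)).trans_le h1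
  have : Finite (X ⧸ (openUnits v ρ).subgroupOf X) := Finite.of_injective _ hinj
  exact Subgroup.index_ne_zero_of_finite hX

/-- `X` meets infinitely many classes of `U_ρ` modulo `U_ρ⁻`, so it has a point generic for the
centers of `D'`. All generic points of the ball of radius `ρ` around `1` have the same distances to
these centers, so they lie in `D'`, and every element of the group is a quotient of two of them. -/
theorem IsGroupSystem.mem_of_mem_closedUnits [IsAlgClosed K] (hv : Function.Surjective v)
    {X : Subgroup Kˣ} {𝓓 : Set (Set K)} (hX : IsGroupSystem v X 𝓓) {ρ : Γ}
    (h1 : (closedUnits v ρ).relIndex X ≠ 0) (h2 : (openUnits v ρ).relIndex X = 0)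
    {D : Set K} (hD : D ∈ 𝓓) {w : Kˣ} (hw : w ∈ closedUnits v ρ) : (w : K) ∈ D := by
  classical
  obtain ⟨D', hD', hquot⟩ := hX.quot D hD
  obtain ⟨C, F, hCF⟩ := hX.tame D' hD'
  have hY : (openUnits v ρ).relIndex (X ⊓ closedUnits v ρ) = 0 := by
    by_contra h
    exact Subgroup.relIndex_ne_zero_trans h (by rwa [Subgroup.inf_relIndex_left]) h2
  obtain ⟨x₀, hx₀, hx₀C⟩ := exists_generic_mem (fun x (hx : x ∈ X ⊓ closedUnits v ρ) => hx.2.1) hY C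
  have hgen : ∀ y : K, (ρ : WithTop Γ) ≤ v (1 - y) → (∀ c ∈ C, v (y - c) ≤ ρ) → y ∈ D' := by
    intro y hy hyC
    refine hCF x₀ y (fun c hc r _ => ?_) (hX.mem D' hD' x₀ hx₀.1)
    have hle : (ρ : WithTop Γ) ≤ v ((x₀ : K) - y) := by
      have h := v.map_sub (1 - y) (1 - (x₀ : K))
      rw [sub_sub_sub_cancel_left] at h
      exact (le_min hy hx₀.2.2).trans h
    rw [map_sub_eq_of_generic hle (hx₀C c hc) (hyC c hc)]
    exact ⟨Iff.rfl, Iff.rfl⟩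
  -- Avoiding both `C` and `C w⁻¹` makes `x` and `x * w` generic at once; avoiding `0` makes `x`
  -- invertible.
  obtain ⟨x, hx1, hxC⟩ :=
    exists_generic hv 1 ρ (insert 0 C ∪ C.image fun c => c * ((w⁻¹ : Kˣ) : K))
  have hxle : ∀ c ∈ insert 0 C ∪ C.image fun c => c * ((w⁻¹ : Kˣ) : K), v (x - c) ≤ ρ := by
    intro c hc
    rcases le_or_gt (ρ : WithTop Γ) (v (c - 1)) with h | h
    · exact (hxC c hc h).le
    · rw [← sub_sub_sub_cancel_right x c 1,
        AddValuation.map_sub_eq_of_lt_right v (by rwa [hx1])]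
      exact h.le
  have hx0 : x ≠ 0 := by
    rintro rfl
    have := hxle 0 (Finset.mem_union_left _ (Finset.mem_insert_self _ _))
    rw [sub_zero, AddValuation.map_zero, top_le_iff] at this
    exact WithTop.coe_ne_top this
  refine hquot x w hx0 (hgen x ?_ fun c hc => ?_) (hgen _ ?_ fun c hc => ?_)
  · rw [AddValuation.map_sub_swap, hx1]
  · exact hxle c (Finset.mem_union_left _ (Finset.mem_insert_of_mem hc))
  · have h := map_one_sub_mul hw.1 x
    rw [mul_comm]
    refine le_trans (le_min hw.2 ?_) h
    rw [AddValuation.map_sub_swap, hx1]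
  · have h := hxle _ (Finset.mem_union_right _ (Finset.mem_image_of_mem _ hc))
    have h3 : x * w - c = (x - c * ((w⁻¹ : Kˣ) : K)) * w := by
      rw [sub_mul, mul_assoc c, Units.inv_mul, mul_one]
    rwa [h3, AddValuation.map_mul, hw.1, add_zero]

/-! ### Finding a unit ball of finite index inside each member of the system -/

/-- `U` is one of the groups `U_r`, `r > 0`, or `U_r⁻`, `r ≥ 0`. -/
def IsUnitBall (v : AddValuation K (WithTop Γ)) (U : Subgroup Kˣ) : Prop :=
  (∃ r : Γ, 0 < r ∧ U = closedUnits v r) ∨ ∃ r : Γ, 0 ≤ r ∧ U = openUnits v r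

/-- Let `t` be the first critical value above `ρ`, or `∞`. The index jumps between `U_ρ⁻` and `U_t`,
so `X` has a point in the window `(ρ, t)`, and `D'` contains all of it. -/
theorem IsGroupSystem.exists_openUnits [IsAlgClosed K] [Nontrivial Γ]
    (hv : Function.Surjective v) {X : Subgroup Kˣ} {𝓓 : Set (Set K)}
    (hX : IsGroupSystem v X 𝓓) {ρ : Γ} (hρ : 0 ≤ ρ) (h1 : (openUnits v ρ).relIndex X ≠ 0)
    (h2 : ∀ t : WithTop Γ, (ρ : WithTop Γ) < t → (closedUnits v t).relIndex X = 0)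
    {D : Set K} (hD : D ∈ 𝓓) {w : Kˣ} (hw : w ∈ openUnits v ρ) : (w : K) ∈ D := by
  classical
  have := denselyOrdered_of_isAlgClosed hv
  obtain ⟨D', hD', hquot⟩ := hX.quot D hD
  obtain ⟨B, hB⟩ := (hX.tame D' hD').exists_values 1
  set s : Finset (WithTop Γ) := insert ⊤ (B.filter fun β => (ρ : WithTop Γ) < β) with hs
  have hmin := s.min'_mem (Finset.insert_nonempty _ _)
  set t := s.min' (Finset.insert_nonempty _ _)
  have hρt : (ρ : WithTop Γ) < t := by
    rcases Finset.mem_insert.1 hmin with h | h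
    · rw [h]; exact WithTop.coe_lt_top ρ
    · exact (Finset.mem_filter.1 h).2
  obtain ⟨x, hx, hx1, hx2⟩ := exists_mem_notMem_of_relIndex h1 (h2 t hρt)
  have hxt : v (1 - (x : K)) < t := by
    by_contra! h
    exact hx2 ⟨hx1.1, h⟩
  -- The denominator is taken at a distance `τ` in the window that is smaller than `v (1 - w)`, so
  -- multiplying by `w` does not change that distance.
  obtain ⟨τ, hτ1, hτ2⟩ := exists_between (lt_min hρt hw.2)
  rw [lt_min_iff] at hτ2
  lift τ to Γ using (hτ2.1.trans_le le_top).ne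
  refine mem_of_window hquot hv (W := Set.Ioo (ρ : WithTop Γ) t) (fun y hy => ?_)
    (hρ.trans_lt (WithTop.coe_lt_coe.1 hτ1)) ⟨hτ1, hτ2.1⟩ (Or.inl hτ2.2)
  refine mem_of_separated (B := B) (W := Set.Ioo ρ t) hB (fun β hβ => ?_) (hX.mem D' hD' x hx) ⟨hx1.2, hxt⟩ hy
  rcases le_or_gt β ρ with h | h
  · exact Or.inl fun γ hγ => h.trans_lt hγ.1
  · exact Or.inr fun γ hγ => hγ.2.trans_le
      (s.min'_le β (Finset.mem_insert_of_mem (Finset.mem_filter.2 ⟨hβ, h⟩)))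

/-- If the finite-index groups `U_s` have no smallest member, then `D` contains one of them. -/
theorem IsGroupSystem.exists_closedUnits [IsAlgClosed K] [Nontrivial Γ]
    (hv : Function.Surjective v) {X : Subgroup Kˣ} {𝓓 : Set (Set K)}
    (hX : IsGroupSystem v X 𝓓) (htop : (closedUnits v ⊤).relIndex X = 0)
    (hS : ∀ ρ : Γ, 0 ≤ ρ → (ρ = 0 ∨ (closedUnits v (ρ : WithTop Γ)).relIndex X ≠ 0) →
      ∃ t : WithTop Γ, (ρ : WithTop Γ) < t ∧ (closedUnits v t).relIndex X ≠ 0)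
    {D : Set K} (hD : D ∈ 𝓓) :
    ∃ r : Γ, 0 < r ∧ (closedUnits v (r : WithTop Γ)).relIndex X ≠ 0 ∧
      ∀ w ∈ closedUnits v (r : WithTop Γ), (w : K) ∈ D := by
  classical
  have := denselyOrdered_of_isAlgClosed hv
  obtain ⟨D', hD', hquot⟩ := hX.quot D hD
  obtain ⟨B, hB⟩ := (hX.tame D' hD').exists_values 1
  -- Nonnegative critical values are split by whether the closed ball of that radius has finite
  -- index in `X`. Passing beyond the last low one, possible as there is no smallest ball of finite
  -- index, leaves a window `[s, t)` free of critical values.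
  set low : Finset (WithTop Γ) :=
    insert 0 (B.filter fun β => 0 ≤ β ∧ (closedUnits v β).relIndex X ≠ 0) with hlow
  set high : Finset (WithTop Γ) :=
    insert ⊤ (B.filter fun β => (closedUnits v β).relIndex X = 0) with hhigh
  obtain ⟨s, hs0, hs, hlows⟩ : ∃ s : Γ, 0 < s ∧
      (closedUnits v (s : WithTop Γ)).relIndex X ≠ 0 ∧ ∀ β ∈ low, β < s := by
    have hmax := low.max'_mem (Finset.insert_nonempty _ _)
    have hle : ∀ β ∈ low, β ≤ low.max' (Finset.insert_nonempty _ _) := fun β hβ =>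
      low.le_max' β hβ
    generalize low.max' (Finset.insert_nonempty _ _) = ρ at hmax hle
    have hρ : 0 ≤ ρ ∧ (ρ = 0 ∨ (closedUnits v ρ).relIndex X ≠ 0) := by
      rcases Finset.mem_insert.1 hmax with h | h
      · exact ⟨h.ge, Or.inl h⟩
      · exact ⟨(Finset.mem_filter.1 h).2.1, Or.inr (Finset.mem_filter.1 h).2.2⟩
    have hρtop : ρ ≠ ⊤ := by
      intro h
      rw [h] at hρ
      exact hρ.2.elim WithTop.top_ne_zero fun h => h htop
    lift ρ to Γ using hρtop
    obtain ⟨s, hs, hs'⟩ := hS ρ (WithTop.coe_nonneg.1 hρ.1) (hρ.2.imp_left WithTop.coe_eq_zero.1)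
    have hs_top : s ≠ ⊤ := by
      rintro rfl
      exact hs' htop
    lift s to Γ using hs_top
    exact ⟨s, (WithTop.coe_nonneg.1 hρ.1).trans_lt (WithTop.coe_lt_coe.1 hs), hs',
      fun β hβ => (hle β hβ).trans_lt hs⟩
  have hmin := high.min'_mem (Finset.insert_nonempty _ _)
  set t := high.min' (Finset.insert_nonempty _ _)
  have ht : (closedUnits v t).relIndex X = 0 := by
    rcases Finset.mem_insert.1 hmin with h | h
    · rwa [h]
    · exact (Finset.mem_filter.1 h).2
  have hst : (s : WithTop Γ) < t := by
    by_contra! h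
    exact hs (Subgroup.relIndex_eq_zero_of_le_left (closedUnits_le h) ht)
  obtain ⟨x, hx, hx1, hx2⟩ := exists_mem_notMem_of_relIndex hs ht
  have hxt : v (1 - (x : K)) < t := by
    by_contra! h
    exact hx2 ⟨hx1.1, h⟩
  have hwin : ∀ y : K, v (1 - y) ∈ Set.Ico (s : WithTop Γ) t → y ∈ D' := fun y hy => by
    refine mem_of_separated (B := B) (W := Set.Ico s t) hB (fun β hβ => ?_) (hX.mem D' hD' x hx) ⟨hx1.2, hxt⟩ hy
    by_cases hβS : (closedUnits v β).relIndex X = 0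
    · exact Or.inr fun γ hγ => hγ.2.trans_le
        (high.min'_le β (Finset.mem_insert_of_mem (Finset.mem_filter.2 ⟨hβ, hβS⟩)))
    · have hβs : β < s := by
        rcases le_or_gt 0 β with h | h
        · exact hlows β (Finset.mem_insert_of_mem (Finset.mem_filter.2 ⟨hβ, h, hβS⟩))
        · exact h.trans (WithTop.coe_pos.2 hs0)
      exact Or.inl fun γ hγ => hβs.trans_le hγ.1
  refine ⟨s, hs0, hs, fun w hw => ?_⟩
  -- For `v (1 - w) = s` a denominator at distance `s` might cause cancellation, so one at a larger
  -- distance in the window is used.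
  rcases (mem_closedUnits.1 hw).2.lt_or_eq with h | h
  · exact mem_of_window hquot hv hwin hs0 ⟨le_rfl, hst⟩ (Or.inl h)
  · obtain ⟨τ, hτ1, hτ2⟩ := exists_between hst
    lift τ to Γ using (hτ2.trans_le le_top).ne
    exact mem_of_window hquot hv hwin (hs0.trans (WithTop.coe_lt_coe.1 hτ1)) ⟨hτ1.le, hτ2⟩
      (Or.inr ⟨h ▸ hτ1, h ▸ ⟨le_rfl, hst⟩⟩)

/-- In the chain of balls the finite index is lost just after an open ball, or between `U_ρ` and
`U_ρ⁻`, or at no definite place. In the first two cases one ball serves every `D`; in the third it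
depends on `D`. As `X` is infinite, the index is infinite at radius `∞`. -/
theorem IsGroupSystem.exists_isUnitBall [IsAlgClosed K] [Nontrivial Γ]
    (hv : Function.Surjective v) {X : Subgroup Kˣ} {𝓓 : Set (Set K)}
    (hX : IsGroupSystem v X 𝓓) (hinf : ¬ (X : Set Kˣ).Finite)
    (h0 : (openUnits v (0 : Γ)).relIndex X ≠ 0) {D : Set K} (hD : D ∈ 𝓓) :
    ∃ U : Subgroup Kˣ, IsUnitBall v U ∧ U.relIndex X ≠ 0 ∧ ∀ w ∈ U, (w : K) ∈ D := by
  have htop : (closedUnits v ⊤).relIndex X = 0 := by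
    rw [closedUnits_top, Subgroup.relIndex_bot_left]
    exact Nat.card_eq_zero.2 (Or.inr (Set.infinite_coe_iff.2 hinf))
  by_cases hA : ∃ ρ : Γ, 0 ≤ ρ ∧ (openUnits v ρ).relIndex X ≠ 0 ∧
      ∀ t : WithTop Γ, (ρ : WithTop Γ) < t → (closedUnits v t).relIndex X = 0
  · obtain ⟨ρ, hρ, h1, h2⟩ := hA
    exact ⟨_, Or.inr ⟨ρ, hρ, rfl⟩, h1, fun w hw => hX.exists_openUnits hv hρ h1 h2 hD hw⟩
  by_cases hC : ∃ ρ : Γ, 0 < ρ ∧ (closedUnits v (ρ : WithTop Γ)).relIndex X ≠ 0 ∧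
      (openUnits v ρ).relIndex X = 0
  · obtain ⟨ρ, hρ, h1, h2⟩ := hC
    exact ⟨_, Or.inl ⟨ρ, hρ, rfl⟩, h1, fun w hw => hX.mem_of_mem_closedUnits hv h1 h2 hD hw⟩
  push Not at hA hC
  obtain ⟨r, hr, h1, h2⟩ := hX.exists_closedUnits hv htop (fun ρ hρ h => hA ρ hρ (by
    rcases hρ.eq_or_lt with rfl | hpos
    · exact h0
    · exact hC ρ hpos (h.resolve_left hpos.ne'))) hD
  exact ⟨_, Or.inl ⟨r, hr, rfl⟩, h1, h2⟩

/-! ### Definability of the finite extensions of unit balls -/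

theorem definable_closedBall (x : K) (r : WithTop Γ) : Definable v {y | r ≤ v (x - y)} :=
  ⟨.leValue (.var 0) (.val (.add (.var 1) (.neg (.var 0)))), fun _ => x, fun _ => r,
    fun _ => by simp, fun _ => by simp, by
      ext y
      simp [Formula.Realize, ValueTerm.eval, FieldTerm.eval, sub_eq_add_neg]⟩

theorem definable_openBall (x : K) (r : WithTop Γ) : Definable v {y | r < v (x - y)} := by
  refine ⟨.not (.leValue (.val (.add (.var 1) (.neg (.var 0)))) (.var 0)), fun _ => x,
    fun _ => r, fun _ => by simp, fun _ => by simp, ?_⟩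
  ext y
  simp [Formula.Realize, ValueTerm.eval, FieldTerm.eval, sub_eq_add_neg]

theorem IsUnitBall.definable_coset {U : Subgroup Kˣ} (hU : IsUnitBall v U) {x : Kˣ}
    (hx : v (x : K) = 0) : Definable v (Units.val '' {y | x⁻¹ * y ∈ U}) := by
  have hval : ∀ y : K, v (1 - ((x⁻¹ : Kˣ) : K) * y) = v ((x : K) - y) := fun y => by
    have h : 1 - ((x⁻¹ : Kˣ) : K) * y = ((x⁻¹ : Kˣ) : K) * (x - y) := by
      rw [mul_sub, Units.inv_mul]
    rw [h, AddValuation.map_mul, map_inv_of_map_eq_zero hx, zero_add]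
  -- A coset is a ball around `x`. That `P` forces positive values keeps `0` out of this ball.
  have key : ∀ P : WithTop Γ → Prop, (∀ γ, P γ → 0 < γ) → (∀ y : Kˣ, y ∈ U ↔ P (v (1 - (y : K)))) →
      Units.val '' {y | x⁻¹ * y ∈ U} = {y | P (v ((x : K) - y))} := by
    intro P hP hUP
    ext y
    constructor
    · rintro ⟨y, hy, rfl⟩
      have h := (hUP _).1 hy
      rwa [Units.val_mul, hval] at h
    · intro hy
      have hy0 : y ≠ 0 := by
        rintro rfl
        have h := hP _ hy
        rw [sub_zero, hx] at h
        exact h.false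
      refine ⟨Units.mk0 y hy0, (hUP _).2 ?_, rfl⟩
      rw [Units.val_mul, hval]
      exact hy
  rcases hU with ⟨r, hr, rfl⟩ | ⟨r, hr, rfl⟩
  · rw [key (fun γ => (r : WithTop Γ) ≤ γ) (fun γ h => (WithTop.coe_pos.2 hr).trans_le h)
      fun y => by rw [← SetLike.mem_coe, coe_closedUnits hr]; rfl]
    exact definable_closedBall _ _
  · rw [key (fun γ => (r : WithTop Γ) < γ) (fun γ h => (WithTop.coe_nonneg.2 hr).trans_lt h)
      fun y => by rw [← SetLike.mem_coe, coe_openUnits hr]; rfl]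
    exact definable_openBall _ _

theorem definable_of_relIndex {U H : Subgroup Kˣ} (hUH : U ≤ H) (hfin : U.relIndex H ≠ 0)
    (hdef : ∀ x ∈ H, Definable v (Units.val '' {y | x⁻¹ * y ∈ U})) :
    Definable v (Units.val '' (H : Set Kˣ)) := by
  have : Finite (H ⧸ U.subgroupOf H) := Nat.finite_of_card_ne_zero hfin
  have hunion : Units.val '' (H : Set Kˣ) = ⋃₀ Set.range fun q : H ⧸ U.subgroupOf H =>
      Units.val '' {y | (q.out : Kˣ)⁻¹ * y ∈ U} := by
    ext z
    constructor
    · rintro ⟨y, hy, rfl⟩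
      refine ⟨_, ⟨((⟨y, hy⟩ : H) : H ⧸ U.subgroupOf H), rfl⟩, y, ?_, rfl⟩
      exact Subgroup.mem_subgroupOf.1 (QuotientGroup.eq.1
        (Quotient.out_eq' ((⟨y, hy⟩ : H) : H ⧸ U.subgroupOf H)))
    · rintro ⟨_, ⟨q, rfl⟩, y, hy, rfl⟩
      refine ⟨y, ?_, rfl⟩
      have := H.mul_mem q.out.2 (hUH hy)
      rwa [mul_inv_cancel_left] at this
  rw [hunion]
  refine DefinableOver.sUnion (Set.finite_range _) ?_
  rintro _ ⟨q, rfl⟩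
  exact hdef _ q.out.2

/-- Take `H = X U` for a unit ball `U ⊆ D'` of finite index in `X`: it is a finite union of cosets
of `U`. It lies in `D` because `y * u` is the quotient of `u` by `y⁻¹`, both in `D'`. -/
theorem IsGroupSystem.exists_isDefinableFiniteExtU [IsAlgClosed K] [Nontrivial Γ]
    (hv : Function.Surjective v) {X : Subgroup Kˣ} {𝓓 : Set (Set K)}
    (hX : IsGroupSystem v X 𝓓) (hinf : ¬ (X : Set Kˣ).Finite)
    (hX0 : ∀ x ∈ X, v (x : K) = 0) (h0 : (openUnits v (0 : Γ)).relIndex X ≠ 0)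
    {D : Set K} (hD : D ∈ 𝓓) :
    ∃ H : Subgroup Kˣ, IsDefinableFiniteExtU v H ∧ X ≤ H ∧ ∀ x ∈ H, (x : K) ∈ D := by
  obtain ⟨D', hD', hquot⟩ := hX.quot D hD
  obtain ⟨U, hU, hUX, hUD⟩ := hX.exists_isUnitBall hv hinf h0 hD'
  have hUH : U.relIndex (X ⊔ U) ≠ 0 := by rwa [Subgroup.relIndex_sup_right]
  have hU0 : ∀ u ∈ U, v (u : K) = 0 := by
    rcases hU with ⟨r, -, rfl⟩ | ⟨r, -, rfl⟩ <;> exact fun u hu => hu.1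
  refine ⟨X ⊔ U, ⟨definable_of_relIndex le_sup_right hUH fun x hx => ?_, U, ?_, le_sup_right,
    hUH⟩, le_sup_left, fun z hz => ?_⟩
  · obtain ⟨y, hy, u, hu, rfl⟩ := Subgroup.mem_sup.1 hx
    refine hU.definable_coset ?_
    rw [Units.val_mul, AddValuation.map_mul, hX0 y hy, hU0 u hu, zero_add]
  · rcases hU with ⟨r, hr, rfl⟩ | ⟨r, hr, rfl⟩
    exacts [Or.inl ⟨r, hr, coe_closedUnits hr⟩, Or.inr ⟨r, hr, coe_openUnits hr⟩]
  · obtain ⟨y, hy, u, hu, rfl⟩ := Subgroup.mem_sup.1 hz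
    refine hquot _ _ (y⁻¹).ne_zero (hX.mem D' hD' _ (X.inv_mem hy)) ?_
    rw [← Units.val_mul, inv_mul_cancel_left]
    exact hUD u hu

end UnitGroups

end ACVF

/-! ### The classification -/

theorem mainTheorem4 {K Γ : Type u} [Field K] [IsAlgClosed K]
    [AddCommGroup Γ] [LinearOrder Γ] [IsOrderedAddMonoid Γ] [Nontrivial Γ]
    (v : AddValuation K (WithTop Γ)) (hv : Function.Surjective v)
    (κ : Cardinal.{u}) (hκ : Cardinal.aleph0 ≤ κ) (hsat : ACVF.IsSaturated κ v)
    (X : Subgroup Kˣ) (hX : ACVF.TypeDefinable κ v (Units.val '' (X : Set Kˣ))) :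
    X = ⊤ ∨
    (X : Set Kˣ) = ACVF.valuationUnits v ∨
    ACVF.IsSmallInter κ (ACVF.IsLittleO v) X ∨
    ACVF.IsSmallInter κ (ACVF.IsDefinableFiniteExtU v) X ∨
    (X : Set Kˣ).Finite := by
  obtain ⟨𝒟, h𝒟, hdef, hX𝒟⟩ := hX
  obtain ⟨𝓓, hsub, hsys⟩ := ACVF.exists_isGroupSystem hv hκ hsat h𝒟 hdef hX𝒟
  by_cases hne : ∃ x ∈ X, ACVF.ord v x ≠ 0
  · obtain ⟨x, hx, hx0⟩ : ∃ x ∈ X, 0 < ACVF.ord v x := by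
      obtain ⟨x, hx, hx0⟩ := hne
      rcases lt_or_gt_of_ne hx0 with h | h
      · exact ⟨x⁻¹, X.inv_mem hx, by rw [ACVF.ord_inv]; exact neg_pos.2 h⟩
      · exact ⟨x, hx, h⟩
    by_cases htop : X = ⊤
    · exact Or.inl htop
    · refine Or.inr (Or.inr (Or.inl (ACVF.isSmallInter_of_forall h𝒟 hX𝒟 fun D hD => ?_)))
      exact ACVF.exists_littleO_between hv
        (fun x hx hx0 w hw0 hwx => hsys.mem_of_ord_le hx hx0 hw0 hwx) htop hx hx0
        (hsys.tame D (hsub hD)) (hsys.mem D (hsub hD))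
  · push Not at hne
    have hX0 : ∀ x ∈ X, v (x : K) = 0 := fun x hx => by
      rw [← ACVF.coe_ord, hne x hx, WithTop.coe_zero]
    -- The index is the number of residue classes that `X` meets. If it is infinite, radius `0` is
    -- generic, and the closed group of radius `0` consists of all units of the valuation ring.
    by_cases h0 : (ACVF.openUnits v (0 : Γ)).relIndex X = 0
    · refine Or.inr (Or.inl (Set.Subset.antisymm hX0 fun w hw => ?_))
      have hball : ∀ x : Kˣ, v (x : K) = 0 → x ∈ ACVF.closedUnits v ((0 : Γ) : WithTop Γ) :=
        fun x hx => ⟨hx, by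
          have h := v.map_sub 1 (x : K)
          rwa [AddValuation.map_one, hx, min_self] at h⟩
      have h1 : (ACVF.closedUnits v ((0 : Γ) : WithTop Γ)).relIndex X ≠ 0 := by
        rw [Subgroup.relIndex_eq_one.2 fun x hx => hball x (hX0 x hx)]
        exact one_ne_zero
      exact hsys.inter w fun D hD => hsys.mem_of_mem_closedUnits hv h1 h0 hD (hball w hw)
    · by_cases hfin : (X : Set Kˣ).Finite
      · exact Or.inr (Or.inr (Or.inr (Or.inr hfin)))
      · exact Or.inr (Or.inr (Or.inr (Or.inl (ACVF.isSmallInter_of_forall h𝒟 hX𝒟 fun D hD =>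
          hsys.exists_isDefinableFiniteExtU hv hfin hX0 h0 (hsub hD)))))
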